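/- Let $p$ be an odd prime, let $F$ be the field with $p$ elements, and let $G$ and $H$ be finite $p$-groups whose group algebras $FG$ and $FH$ are isomorphic as $F$-algebras. Write $Z(G)$ for the center and $\Phi(G)$ for the Frattini subgroup of $G$, let $\gamma_1(G)=G$ and $\gamma_{i+1}(G)=[\gamma_i(G),G]$ denote the lower central series, and for a subgroup $K$ of $G$ let $K^p$ be the subgroup generated by the $p$-th powers of the elements of $K$; use the same notation for $H$. Let $d\ge 0$ be the integer with $|G/\Phi(G)Z(G)|=p^d$. Suppose that (a) $G^p\cap\gamma_2(G)\subseteq\gamma_2(G)^p\gamma_3(G)$, and (b) $|\gamma_2(G)/\gamma_2(G)^p\gamma_3(G)|=p^{\binom{d}{2}}$. Then $G/\gamma_2(G)^p\gamma_4(G)\cong H/\gamma_2(H)^p\gamma_4(H)$. -/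

import Mathlib

/-- The `i`-th term `γ_i(G)` of the lower central series of `G`, indexed from `1`:
`γ_1(G) = G` and `γ_{i+1}(G) = [γ_i(G), G]`. -/
def lcsTerm (G : Type*) [Group G] (i : ℕ) : Subgroup G :=
  (⊤ : Subgroup G).lowerCentralSeries (i - 1)

instance lcsTerm_normal (G : Type*) [Group G] (i : ℕ) : (lcsTerm G i).Normal :=
  inferInstanceAs ((⊤ : Subgroup G).lowerCentralSeries (i - 1)).Normal

/-- `K^p`: the subgroup of `G` generated by the `p`-th powers of the elements of `K`. -/
def powerSubgroup {G : Type*} [Group G] (p : ℕ) (K : Subgroup G) : Subgroup G :=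
  Subgroup.closure ((fun x : G => x ^ p) '' (K : Set G))

instance powerSubgroup_normal {G : Type*} [Group G] (p : ℕ) (K : Subgroup G) [hK : K.Normal] :
    (powerSubgroup p K).Normal := by
  refine ⟨fun n hn g => ?_⟩
  induction hn using Subgroup.closure_induction with
  | mem y hy =>
    obtain ⟨x, hx, rfl⟩ := hy
    exact Subgroup.subset_closure ⟨g * x * g⁻¹, hK.conj_mem x hx g, conj_pow⟩
  | one => simp
  | mul x y _ _ hx hy => simpa using mul_mem hx hy
  | inv x _ hx => simpa [mul_assoc] using inv_mem hx

/-- `γ_2(G)^p γ_i(G)`. Both factors are normal, so their product is their join. -/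
def gammaTwoPowMul (G : Type*) [Group G] (p i : ℕ) : Subgroup G :=
  powerSubgroup p (lcsTerm G 2) ⊔ lcsTerm G i

instance gammaTwoPowMul_normal (G : Type*) [Group G] (p i : ℕ) :
    (gammaTwoPowMul G p i).Normal :=
  Subgroup.sup_normal (powerSubgroup p (lcsTerm G 2)) (lcsTerm G i)

/-! ### Order bounds for groups with central commutators -/

open scoped commutatorElement

/-! Write F for the field with p elements, I for the augmentation ideal of FG, J for its commutator
ideal and S for FG/(IIJ + IJI + JII). An isomorphism FG ≅ FH respects I and J: J is defined by the
ring alone, and a p-group has only one algebra map to F. So G and H both map to the units of the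
same ring S, and in both the filtration I ≥ J ≥ IJ + JI ≥ 0 corresponds to the group, γ_2, γ_2^p γ_3
and γ_2^p γ_4 (`IsGroupBasis`). The last of these is the kernel of the map to S.

The isomorphism comes from a subgroup D of H × G, generated by pairs congruent modulo I² and
projecting onto both factors. Let N be `matchThree`. If every pair in D with one coordinate in its
group's γ_2^p γ_3 lies in N, then for pairs in D one coordinate is trivial in S exactly when the
other is, and D induces the isomorphism. Since D maps onto H and onto G, and both quotients by γ_2^p
γ_3 have order |H : γ_2(H)| p^binom(d,2), it suffices to bound |D : D ∩ N| by this number.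

The generators of D lift a cyclic decomposition of the abelianization of H, with orders q_i. The
bound rests on three facts. (1) Powers: FG/J is commutative of characteristic p, so each generator
h_i of H has a partner g_i in G with g_i^q_i in γ_2. Hypothesis (a) moves this power into γ_2^p γ_3,
and as p is odd the two q_i-th powers agree in S (`pow_eq_of_sub_mem`). (2) Double commutators in S
depend only on classes modulo I², so commutators of the generators are central modulo N; they also
have exponent p there. (3) Only d generators have commutators that count: modulo products of these,
the others are central up to I², and factors from γ_2 make them central in S (`exists_mul_central`).

Fact (3) is the hard one. It concerns w in I² whose commutator with each group element has the form
z - 1 in S, with z in γ_2. A derivation of FG given by a character of G kills z - 1, so the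
derivative of w commutes with I modulo IJ + JI. Let R be spanned by I² and all z - 1 with z central
in G. By hypothesis (b) the commutator pairing from I/R to J/(IJ + JI) has an image too large for
the pairing to be degenerate, so the derivative lies in R (`mem_centralSpan_of_comm_mem`). An
antisymmetry argument, again with p odd, puts w in J + I³ + ZZ, where Z is spanned by the same z - 1
(`mem_of_derivation_mem`). Both I³ and ZZ become central in S, so subtracting an element of J makes
w central. -/

theorem Subgroup.card_closure_range_le_prod {K ι : Type*} [Group K] [Finite K] [Fintype ι]
    (k : ι → K) (q : ι → ℕ) (hq : ∀ i, 0 < q i) (hk : ∀ i, k i ^ q i = 1)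
    (hc : ∀ i j, Commute (k i) (k j)) :
    Nat.card (Subgroup.closure (Set.range k)) ≤ ∏ i, q i := by
  have hcomm : Pairwise fun i j : ι => ∀ x y : K, x ∈ Subgroup.zpowers (k i) →
      y ∈ Subgroup.zpowers (k j) → Commute x y := by
    intro i j _ x y hx hy
    obtain ⟨a, rfl⟩ := Subgroup.mem_zpowers_iff.1 hx
    obtain ⟨b, rfl⟩ := Subgroup.mem_zpowers_iff.1 hy
    exact (hc i j).zpow_zpow a b
  have hle : Subgroup.closure (Set.range k) ≤ (Subgroup.noncommPiCoprod hcomm).range := by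
    rw [Subgroup.noncommPiCoprod_range, Subgroup.closure_le]
    rintro _ ⟨i, rfl⟩
    exact (le_iSup (fun i => Subgroup.zpowers (k i)) i) (Subgroup.mem_zpowers _)
  calc Nat.card (Subgroup.closure (Set.range k))
      ≤ Nat.card (Subgroup.noncommPiCoprod hcomm).range := Subgroup.card_le_of_le hle
    _ ≤ Nat.card (∀ i, Subgroup.zpowers (k i)) :=
        Nat.card_le_card_of_surjective _ (MonoidHom.rangeRestrict_surjective _)
    _ = ∏ i, Nat.card (Subgroup.zpowers (k i)) := Nat.card_pi
    _ ≤ ∏ i, q i := by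
        refine Finset.prod_le_prod' fun i _ => ?_
        rw [Nat.card_zpowers]
        exact orderOf_le_of_pow_eq_one (hq i) (hk i)

/-- The order of a group generated by elements `e i` with `(e i) ^ (q i) = 1`, all of which are
central modulo the subgroup generated by the `e i`, `i ∈ S`, and such that the commutators of the
latter are central of exponent `p`. -/
theorem Subgroup.card_closure_range_le_of_central_commutators {E ι : Type*} [Group E] [Finite E]
    [Fintype ι] (e : ι → E) (q : ι → ℕ) (hq : ∀ i, 0 < q i) (he : ∀ i, e i ^ q i = 1)
    (p : ℕ) (hp : 0 < p) (S : Finset ι)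
    (hcen : ∀ i ∈ S, ∀ j ∈ S, ⁅e i, e j⁆ ∈ Subgroup.center E)
    (hpow : ∀ i ∈ S, ∀ j ∈ S, ⁅e i, e j⁆ ^ p = 1)
    (hS : ∀ j ∉ S, ∃ k ∈ Subgroup.closure (e '' S), e j * k⁻¹ ∈ Subgroup.center E) :
    Nat.card (Subgroup.closure (Set.range e)) ≤ (∏ i, q i) * p ^ (S.card.choose 2) := by
  classical
  -- Swapping two elements inverts their commutator, so one commutator per unordered pair suffices;
  -- this gives the exponent `S.card.choose 2`.
  let P := {a : Sym2 S // ¬ a.IsDiag}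
  let c : P → E := fun s => ⁅e s.1.out.1, e s.1.out.2⁆
  have hcc : ∀ s, c s ∈ Subgroup.center E := fun s => hcen _ s.1.out.1.2 _ s.1.out.2.2
  let C : Subgroup E := Subgroup.closure (Set.range c)
  have hCcen : C ≤ Subgroup.center E := by
    rw [Subgroup.closure_le]; rintro _ ⟨s, rfl⟩; exact hcc s
  have hCn : C.Normal := ⟨fun n hn g => by
    have := Subgroup.mem_center_iff.1 (hCcen hn) g
    rw [this, mul_inv_cancel_right]; exact hn⟩
  have hCcard : Nat.card C ≤ p ^ (S.card.choose 2) := by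
    refine (Subgroup.card_closure_range_le_prod c (fun _ => p) (fun _ => hp)
      (fun s => hpow _ s.1.out.1.2 _ s.1.out.2.2)
      (fun s t => (Subgroup.mem_center_iff.1 (hcc t) (c s)))).trans ?_
    rw [Finset.prod_const, Finset.card_univ, Sym2.card_subtype_not_diag, Fintype.card_coe]
  have hSS : ∀ i ∈ S, ∀ j ∈ S, ⁅e i, e j⁆ ∈ C := by
    intro i hi j hj
    by_cases hij : i = j
    · subst hij; rw [commutatorElement_self]; exact one_mem _
    · have hnd : ¬ (s((⟨i, hi⟩ : S), (⟨j, hj⟩ : S))).IsDiag := by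
        simpa using hij
      have hmem : c ⟨_, hnd⟩ ∈ C := Subgroup.subset_closure ⟨_, rfl⟩
      have hout : s((s((⟨i, hi⟩ : S), (⟨j, hj⟩ : S))).out.1, (s((⟨i, hi⟩ : S), (⟨j, hj⟩ : S))).out.2)
          = s((⟨i, hi⟩ : S), (⟨j, hj⟩ : S)) := Quot.out_eq _
      rw [Sym2.eq_iff] at hout
      rcases hout with ⟨h1, h2⟩ | ⟨h1, h2⟩
      · simpa [c, h1, h2] using hmem
      · have := C.inv_mem hmem
        simpa [c, h1, h2] using this
  let π := QuotientGroup.mk' C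
  have hcomm1 : ∀ i ∈ S, ∀ j ∈ S, Commute (π (e i)) (π (e j)) := by
    intro i hi j hj
    rw [← commutatorElement_eq_one_iff_commute, ← map_commutatorElement]
    exact (QuotientGroup.eq_one_iff _).2 (hSS i hi j hj)
  have hcenmap : ∀ z ∈ Subgroup.center E, ∀ x, Commute (π z) (π x) := fun z hz x =>
    (show Commute z x from (Subgroup.mem_center_iff.1 hz x).symm).map π
  have hcl : ∀ x : E, (∀ i ∈ S, Commute (π (e i)) (π x)) →
      ∀ k ∈ Subgroup.closure (e '' S), Commute (π k) (π x) := by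
    intro x hx k hk
    induction hk using Subgroup.closure_induction with
    | mem y hy => obtain ⟨i, hi, rfl⟩ := hy; exact hx i hi
    | one => rw [map_one]; exact Commute.one_left _
    | mul a b _ _ ha hb => rw [map_mul]; exact ha.mul_left hb
    | inv a _ ha => rw [map_inv]; exact ha.inv_left
  -- Each generator outside `S` is a central element times a product of generators in `S`, so
  -- commuting with the latter is enough. Using this in both arguments makes the image modulo `C`
  -- abelian.
  have hstep : ∀ x : E, (∀ i ∈ S, Commute (π (e i)) (π x)) → ∀ j, Commute (π (e j)) (π x) := by
    intro x hx j
    by_cases hj : j ∈ S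
    · exact hx j hj
    · obtain ⟨k, hk, hz⟩ := hS j hj
      have h : π (e j) = π (e j * k⁻¹) * π k := by rw [← map_mul, inv_mul_cancel_right]
      rw [h]
      exact (hcenmap _ hz x).mul_left (hcl x hx k hk)
  have hcomm : ∀ i j, Commute (π (e i)) (π (e j)) := by
    intro i j
    exact hstep (e j) (fun i' hi' => (hstep (e i') (fun j' hj' => hcomm1 j' hj' i' hi') j).symm) i
  have hquot : Nat.card (Subgroup.closure (Set.range fun i => π (e i))) ≤ ∏ i, q i :=
    Subgroup.card_closure_range_le_prod _ q hq
      (fun i => by rw [← map_pow, he, map_one]) hcomm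
  have hmap : (Subgroup.closure (Set.range e)).map π
      = Subgroup.closure (Set.range fun i => π (e i)) := by
    rw [MonoidHom.map_closure, ← Set.range_comp]; rfl
  let f : Subgroup.closure (Set.range e) →* E ⧸ C := π.comp (Subgroup.subtype _)
  have hrange : f.range = (Subgroup.closure (Set.range e)).map π := by
    rw [MonoidHom.range_comp, Subgroup.range_subtype]
  have hker : Nat.card f.ker ≤ Nat.card C :=
    Nat.card_le_card_of_injective
      (fun x : f.ker => (⟨x.1.1, (QuotientGroup.eq_one_iff _).1 x.2⟩ : C))
      (fun x y h => Subtype.ext (Subtype.ext (congrArg (fun z : C => (z : E)) h)))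
  calc Nat.card (Subgroup.closure (Set.range e))
      = Nat.card f.range * Nat.card f.ker := by
        rw [← Subgroup.index_ker f, mul_comm, Subgroup.card_mul_index]
    _ ≤ (∏ i, q i) * p ^ (S.card.choose 2) := by
        refine Nat.mul_le_mul ?_ (hker.trans hCcard)
        rw [hrange, hmap]; exact hquot

/-! ### Lower central series, maximal subgroups and Frattini subgroup -/

section PGroup

variable {G : Type*} [Group G] [Finite G] {p : ℕ} [Fact p.Prime]

theorem lcsTerm_two_eq (G : Type*) [Group G] : lcsTerm G 2 = commutator G :=
  Subgroup.top_lowerCentralSeries_one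

theorem lcsTerm_succ (G : Type*) [Group G] (i : ℕ) (hi : 1 ≤ i) :
    lcsTerm G (i + 1) = ⁅lcsTerm G i, ⊤⁆ := by
  obtain ⟨k, rfl⟩ := Nat.exists_eq_add_of_le' hi
  rfl

theorem lcsTerm_antitone (G : Type*) [Group G] : Antitone (lcsTerm G) := fun _ _ h =>
  Subgroup.lowerCentralSeries_antitone _ (Nat.sub_le_sub_right h 1)

/-- By nilpotency a maximal subgroup is normal, and the quotient is a simple p-group. Its nontrivial
center is everything, so it is cyclic of order p. -/
theorem IsPGroup.exists_hom_ker_eq_of_isCoatom (hG : IsPGroup p G) {M : Subgroup G}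
    (hM : IsCoatom M) : ∃ χ : G →* Multiplicative (ZMod p), χ.ker = M := by
  have : Group.IsNilpotent G := hG.isNilpotent
  have hn : M.Normal := Subgroup.NormalizerCondition.normal_of_coatom M
    Group.normalizerCondition_of_isNilpotent hM
  have : Nontrivial (G ⧸ M) := QuotientGroup.nontrivial_iff.2 hM.1
  have hs : IsSimpleGroup (G ⧸ M) := ⟨fun N _ => by
    have hle : M ≤ N.comap (QuotientGroup.mk' M) := by
      intro x hx
      rw [Subgroup.mem_comap]
      have : QuotientGroup.mk' M x = 1 := (QuotientGroup.eq_one_iff x).2 hx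
      rw [this]; exact one_mem _
    have hsur := QuotientGroup.mk'_surjective M
    rcases hM.le_iff.1 hle with h | h
    · right
      rw [← Subgroup.map_comap_eq_self_of_surjective hsur N, h]
      exact Subgroup.map_top_of_surjective _ hsur
    · left
      rw [← Subgroup.map_comap_eq_self_of_surjective hsur N, h]
      simp⟩
  have hpq : IsPGroup p (G ⧸ M) := hG.to_quotient M
  have hc : Subgroup.center (G ⧸ M) = ⊤ := by
    have := hpq.center_nontrivial
    rcases hs.eq_bot_or_eq_top_of_normal (Subgroup.center (G ⧸ M)) inferInstance with h | h
    · exact absurd h ((Subgroup.nontrivial_iff_ne_bot _).1 this)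
    · exact h
  let _ : CommGroup (G ⧸ M) := Group.commGroupOfCenterEqTop hc
  have hprime : (Nat.card (G ⧸ M)).Prime := IsSimpleGroup.prime_card
  have hcard : Nat.card (G ⧸ M) = p := by
    obtain ⟨n, hn⟩ := IsPGroup.iff_card.1 hpq
    rw [hn] at hprime ⊢
    rw [(Nat.Prime.eq_one_of_pow hprime), pow_one]
  have hcard' : Nat.card (Multiplicative (ZMod p)) = p := by simp
  let φ : G ⧸ M ≃* Multiplicative (ZMod p) := mulEquivOfPrimeCardEq hcard hcard'
  refine ⟨φ.toMonoidHom.comp (QuotientGroup.mk' M), ?_⟩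
  ext x
  simp

theorem IsPGroup.lcsTerm_two_le_frattini (hG : IsPGroup p G) : lcsTerm G 2 ≤ frattini G := by
  rw [lcsTerm_two_eq, frattini, Order.radical]
  refine le_iInf₂ fun M hM => ?_
  obtain ⟨χ, rfl⟩ := hG.exists_hom_ker_eq_of_isCoatom hM
  exact Abelianization.commutator_subset_ker χ

/-- A homomorphism to a group of prime order kills the Frattini subgroup. -/
theorem frattini_le_ker {G : Type*} [Group G] {p : ℕ} [Fact p.Prime]
    (χ : G →* Multiplicative (ZMod p)) : frattini G ≤ χ.ker := by
  by_cases h : χ.ker = ⊤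
  · rw [h]; exact le_top
  refine frattini_le_coatom ⟨h, fun N hN => ?_⟩
  have hp : p.Prime := Fact.out
  have hdvd : χ.ker.index ∣ p := by
    rw [Subgroup.index_ker]
    have := Subgroup.card_subgroup_dvd_card χ.range
    simpa using this
  have hi : χ.ker.index = p := by
    rcases (Nat.dvd_prime hp).1 hdvd with h1 | h1
    · exact absurd (Subgroup.index_eq_one.1 h1) h
    · exact h1
  have h2 := Subgroup.relIndex_mul_index hN.le
  rw [hi] at h2
  rcases (Nat.dvd_prime hp).1 ⟨_, h2.symm.trans (mul_comm _ _)⟩ with h1 | h1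
  · exact Subgroup.index_eq_one.1 h1
  · rw [h1] at h2
    have : χ.ker.relIndex N = 1 := by
      have := hp.pos
      exact Nat.eq_of_mul_eq_mul_right this (by rw [h2, one_mul])
    exact absurd (Subgroup.relIndex_eq_one.1 this) (not_le_of_gt hN)

end PGroup

/-- The three subgroups lemma, applied in `G/γ_4(G)`. -/
theorem commutator_lcsTerm_two_le (G : Type*) [Group G] :
    ⁅lcsTerm G 2, lcsTerm G 2⁆ ≤ lcsTerm G 4 := by
  have hker : (QuotientGroup.mk' (lcsTerm G 4)).ker = lcsTerm G 4 := QuotientGroup.ker_mk' _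
  have h2 : lcsTerm G 2 = ⁅(⊤ : Subgroup G), ⊤⁆ := rfl
  have h4 : lcsTerm G 4 = ⁅⁅lcsTerm G 2, ⊤⁆, ⊤⁆ := rfl
  have key : ⁅⁅(lcsTerm G 2).map (QuotientGroup.mk' (lcsTerm G 4)),
      (⊤ : Subgroup G).map (QuotientGroup.mk' (lcsTerm G 4))⁆,
      (⊤ : Subgroup G).map (QuotientGroup.mk' (lcsTerm G 4))⁆ = ⊥ := by
    rw [← Subgroup.map_commutator, ← Subgroup.map_commutator, ← h4, Subgroup.map_eq_bot_iff, hker]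
  rw [← hker, ← Subgroup.map_eq_bot_iff, Subgroup.map_commutator]
  conv_lhs => enter [1]; rw [h2, Subgroup.map_commutator]
  refine Subgroup.commutator_commutator_eq_bot_of_rotate ?_ key
  rwa [Subgroup.commutator_comm (Subgroup.map _ _) (Subgroup.map _ (lcsTerm G 2))]

/-! ### Spans of the elements `u b - 1` -/

section Delta

variable {p : ℕ} [Fact p.Prime] {R G : Type*} [Ring R] [Algebra (ZMod p) R] [Group G]

/-- The span of the elements `u b - 1`, `b ∈ B`. -/
def deltaSpan (p : ℕ) [Fact p.Prime] {R G : Type*} [Ring R] [Algebra (ZMod p) R] [Group G]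
    (u : G →* R) (B : Set G) : Submodule (ZMod p) R :=
  Submodule.span (ZMod p) ((fun g => u g - 1) '' B)

theorem sub_one_mem_deltaSpan (u : G →* R) {B : Set G} {g : G} (hg : g ∈ B) :
    u g - 1 ∈ deltaSpan p u B :=
  Submodule.subset_span ⟨g, hg, rfl⟩

theorem deltaSpan_le {u : G →* R} {B : Set G} {N : Submodule (ZMod p) R} :
    deltaSpan p u B ≤ N ↔ ∀ g ∈ B, u g - 1 ∈ N := by
  rw [deltaSpan, Submodule.span_le, Set.image_subset_iff]; rfl

theorem deltaSpan_mono (u : G →* R) {B C : Set G} (h : B ⊆ C) :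
    deltaSpan p u B ≤ deltaSpan p u C :=
  Submodule.span_mono (Set.image_mono h)

theorem zmod_smul_eq_nsmul {M : Type*} [AddCommGroup M] [Module (ZMod p) M] (c : ZMod p) (x : M) :
    c • x = c.val • x := by
  conv_lhs => rw [← ZMod.natCast_zmod_val c]
  rw [Nat.cast_smul_eq_nsmul]

/-- The identity `kl - 1 = (k - 1) + (l - 1) + (k - 1)(l - 1)` makes `k ↦ u k - 1` additive modulo
products. Over the prime field scalars are repeated sums, so linear combinations are also
represented by single group elements. -/
theorem exists_mem_closure_sub_mem (u : G →* R) {B : Set G} {x : R}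
    (hx : x ∈ deltaSpan p u B) :
    ∃ k ∈ Subgroup.closure B, x - (u k - 1) ∈
      deltaSpan p u (Subgroup.closure B) * deltaSpan p u (Subgroup.closure B) := by
  set D := deltaSpan p u (Subgroup.closure B : Set G)
  have hadd : ∀ x y : R, (∃ k ∈ Subgroup.closure B, x - (u k - 1) ∈ D * D) →
      (∃ k ∈ Subgroup.closure B, y - (u k - 1) ∈ D * D) →
      ∃ k ∈ Subgroup.closure B, x + y - (u k - 1) ∈ D * D := by
    rintro x y ⟨k, hk, hx⟩ ⟨l, hl, hy⟩
    refine ⟨k * l, mul_mem hk hl, ?_⟩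
    have h : x + y - (u (k * l) - 1)
        = (x - (u k - 1)) + (y - (u l - 1)) - (u k - 1) * (u l - 1) := by
      rw [map_mul]; noncomm_ring
    rw [h]
    exact sub_mem (add_mem hx hy)
      (Submodule.mul_mem_mul (sub_one_mem_deltaSpan u hk) (sub_one_mem_deltaSpan u hl))
  have hzero : ∃ k ∈ Subgroup.closure B, (0 : R) - (u k - 1) ∈ D * D :=
    ⟨1, one_mem _, by simp⟩
  induction hx using Submodule.span_induction with
  | mem x hx =>
    obtain ⟨b, hb, rfl⟩ := hx
    exact ⟨b, Subgroup.subset_closure hb, by simp⟩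
  | zero => exact hzero
  | add x y _ _ hx hy => exact hadd x y hx hy
  | smul c x _ hx =>
    rw [zmod_smul_eq_nsmul]
    induction c.val with
    | zero => simpa using hzero
    | succ n ih => rw [succ_nsmul]; exact hadd _ _ ih hx

theorem exists_mem_subgroup_sub_mem (u : G →* R) {B : Subgroup G} {x : R}
    (hx : x ∈ deltaSpan p u (B : Set G)) :
    ∃ k ∈ B, x - (u k - 1) ∈ deltaSpan p u (B : Set G) * deltaSpan p u (B : Set G) := by
  simpa using exists_mem_closure_sub_mem u hx

end Delta

/-! ### Augmentation kernel, commutator ideal and mixed products -/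

section Ideals

variable {F R : Type*} [Field F] [Ring R] [Algebra F R]

/-- The kernel of an augmentation, as a subspace. -/
def augKer (ε : R →ₐ[F] F) : Submodule F R := LinearMap.ker ε.toLinearMap

/-- The ideal generated by the additive commutators, as a subspace. -/
def commSpan (F R : Type*) [Field F] [Ring R] [Algebra F R] : Submodule F R :=
  ⊤ * Submodule.span F {z | ∃ x y : R, z = x * y - y * x} * ⊤

/-- `I J + J I`. -/
def mixTwo (I J : Submodule F R) : Submodule F R := I * J ⊔ J * I

/-- `I I J + I J I + J I I`. -/
def mixThree (I J : Submodule F R) : Submodule F R := I * I * J ⊔ I * J * I ⊔ J * I * I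

theorem mem_augKer {ε : R →ₐ[F] F} {x : R} : x ∈ augKer ε ↔ ε x = 0 := Iff.rfl

theorem top_mul_top_eq : (⊤ : Submodule F R) * ⊤ = ⊤ :=
  top_le_iff.1 fun x _ => by
    simpa using Submodule.mul_mem_mul (Submodule.mem_top (R := F) (x := x))
      (Submodule.mem_top (R := F) (x := (1 : R)))

theorem le_top_mul (I : Submodule F R) : I ≤ ⊤ * I := fun x hx => by
  simpa using Submodule.mul_mem_mul (Submodule.mem_top (R := F) (x := (1 : R))) hx

theorem le_mul_top (I : Submodule F R) : I ≤ I * ⊤ := fun x hx => by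
  simpa using Submodule.mul_mem_mul hx (Submodule.mem_top (R := F) (x := (1 : R)))

theorem top_mul_augKer (ε : R →ₐ[F] F) : ⊤ * augKer ε ≤ augKer ε :=
  Submodule.mul_le.2 fun a _ b hb => by
    rw [mem_augKer] at hb ⊢; rw [map_mul, hb, mul_zero]

theorem augKer_mul_top (ε : R →ₐ[F] F) : augKer ε * ⊤ ≤ augKer ε :=
  Submodule.mul_le.2 fun a ha b _ => by
    rw [mem_augKer] at ha ⊢; rw [map_mul, ha, zero_mul]

theorem top_mul_commSpan : ⊤ * commSpan F R ≤ commSpan F R := by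
  rw [commSpan, ← mul_assoc, ← mul_assoc, top_mul_top_eq]

theorem commSpan_mul_top : commSpan F R * ⊤ ≤ commSpan F R := by
  rw [commSpan, mul_assoc, top_mul_top_eq]

theorem comm_mem_commSpan (x y : R) : x * y - y * x ∈ commSpan F R :=
  le_mul_top _ (le_top_mul _ (Submodule.subset_span ⟨x, y, rfl⟩))

theorem commSpan_le_of {N : Submodule F R} (h1 : ⊤ * N ≤ N) (h2 : N * ⊤ ≤ N)
    (h : ∀ x y : R, x * y - y * x ∈ N) : commSpan F R ≤ N := by
  have hs : Submodule.span F {z | ∃ x y : R, z = x * y - y * x} ≤ N := by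
    rw [Submodule.span_le]; rintro _ ⟨x, y, rfl⟩; exact h x y
  exact (mul_le_mul_left ((mul_le_mul_right hs _).trans h1) _).trans h2

theorem comm_eq_comm_sub_algebraMap (a b : F) (x y : R) :
    x * y - y * x = (x - algebraMap F R a) * (y - algebraMap F R b)
      - (y - algebraMap F R b) * (x - algebraMap F R a) := by
  have h1 := Algebra.commutes a y
  have h2 := Algebra.commutes b x
  have h3 := Algebra.commutes b (algebraMap F R a)
  generalize algebraMap F R a = a at *
  generalize algebraMap F R b = b at *
  have e : (x - a) * (y - b) - (y - b) * (x - a)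
      = x * y - y * x - (a * y - y * a) + (b * x - x * b) - (b * a - a * b) := by noncomm_ring
  rw [e, h1, h2, h3]; simp

/-- Subtracting scalars does not change a commutator, so both factors may be taken in the kernel of
the augmentation. -/
theorem commSpan_le_augKer_sq (ε : R →ₐ[F] F) : commSpan F R ≤ augKer ε * augKer ε := by
  refine commSpan_le_of ?_ ?_ fun x y => ?_
  · rw [← mul_assoc]; exact mul_le_mul_left (top_mul_augKer ε) _
  · rw [mul_assoc]; exact mul_le_mul_right (augKer_mul_top ε) _
  · have hx : ∀ z : R, z - algebraMap F R (ε z) ∈ augKer ε := fun z => by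
      rw [mem_augKer, map_sub, AlgHom.commutes]; simp
    rw [comm_eq_comm_sub_algebraMap (ε x) (ε y)]
    exact sub_mem (Submodule.mul_mem_mul (hx x) (hx y)) (Submodule.mul_mem_mul (hx y) (hx x))

variable {S : Type*} [Ring S] [Algebra F S]

theorem map_mixTwo (f : R →ₐ[F] S) (I J : Submodule F R) :
    (mixTwo I J).map f.toLinearMap = mixTwo (I.map f.toLinearMap) (J.map f.toLinearMap) := by
  simp only [mixTwo, Submodule.map_sup, Submodule.map_mul]

theorem map_mixThree (f : R →ₐ[F] S) (I J : Submodule F R) :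
    (mixThree I J).map f.toLinearMap = mixThree (I.map f.toLinearMap) (J.map f.toLinearMap) := by
  simp only [mixThree, Submodule.map_sup, Submodule.map_mul]

theorem map_commSpan (f : R →ₐ[F] S) (hf : Function.Surjective f) :
    (commSpan F R).map f.toLinearMap = commSpan F S := by
  have ht : (⊤ : Submodule F R).map f.toLinearMap = ⊤ := by
    rw [Submodule.map_top, LinearMap.range_eq_top]; exact hf
  rw [commSpan, Submodule.map_mul, Submodule.map_mul, ht, Submodule.map_span, commSpan]
  congr 3
  ext z
  constructor
  · rintro ⟨_, ⟨x, y, rfl⟩, rfl⟩; exact ⟨f x, f y, by simp⟩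
  · rintro ⟨x, y, rfl⟩
    obtain ⟨x, rfl⟩ := hf x
    obtain ⟨y, rfl⟩ := hf y
    exact ⟨_, ⟨x, y, rfl⟩, by simp⟩

end Ideals

/-! ### Which group elements lie in the ideal filtration of the group algebra -/

section GroupAlgebra

variable {p : ℕ} [Fact p.Prime] {G : Type*} [Group G]

/-- The augmentation of the group algebra over `ZMod p`. -/
noncomputable def augmentation (p : ℕ) [Fact p.Prime] (G : Type*) [Group G] :
    MonoidAlgebra (ZMod p) G →ₐ[ZMod p] ZMod p :=
  MonoidAlgebra.lift (ZMod p) (ZMod p) G 1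

/-- The canonical embedding of a group into its group algebra over `ZMod p`. -/
noncomputable abbrev toAlg (p : ℕ) [Fact p.Prime] (G : Type*) [Group G] :
    G →* MonoidAlgebra (ZMod p) G :=
  MonoidAlgebra.of (ZMod p) G

theorem augmentation_toAlg (g : G) : augmentation p G (toAlg p G g) = 1 := by
  simp [augmentation]

theorem span_range_toAlg : Submodule.span (ZMod p) (Set.range (toAlg p G)) = ⊤ := by
  refine top_le_iff.1 fun x _ => ?_
  induction x using MonoidAlgebra.induction_linear with
  | zero => exact zero_mem _
  | add x y hx hy => exact add_mem (hx trivial) (hy trivial)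
  | single g c =>
    have h : MonoidAlgebra.single g c = c • toAlg p G g := by
      simp [MonoidAlgebra.of_apply]
    rw [h]
    exact Submodule.smul_mem _ _ (Submodule.subset_span ⟨g, rfl⟩)

/-- To check that a subspace contains everything it suffices to check group elements. -/
theorem mem_of_toAlg_mem {N : Submodule (ZMod p) (MonoidAlgebra (ZMod p) G)}
    (h : ∀ g, toAlg p G g ∈ N) (x : MonoidAlgebra (ZMod p) G) : x ∈ N := by
  have : (⊤ : Submodule (ZMod p) (MonoidAlgebra (ZMod p) G)) ≤ N := by
    rw [← span_range_toAlg, Submodule.span_le]; rintro _ ⟨g, rfl⟩; exact h g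
  exact this trivial

theorem linearMap_eq_of_toAlg {M : Type*} [AddCommGroup M] [Module (ZMod p) M]
    {f g : MonoidAlgebra (ZMod p) G →ₗ[ZMod p] M}
    (h : ∀ a, f (toAlg p G a) = g (toAlg p G a)) (x : MonoidAlgebra (ZMod p) G) : f x = g x := by
  have := mem_of_toAlg_mem (N := LinearMap.eqLocus f g) (fun a => h a) x
  exact this

theorem augKer_augmentation :
    augKer (augmentation p G) = deltaSpan p (toAlg p G) Set.univ := by
  apply le_antisymm
  · have key : ∀ x : MonoidAlgebra (ZMod p) G,
        x - augmentation p G x • (1 : MonoidAlgebra (ZMod p) G) ∈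
          deltaSpan p (toAlg p G) Set.univ := by
      intro x
      let L : MonoidAlgebra (ZMod p) G →ₗ[ZMod p] MonoidAlgebra (ZMod p) G :=
        LinearMap.id - (augmentation p G).toLinearMap.smulRight 1
      have := mem_of_toAlg_mem (N := (deltaSpan p (toAlg p G) Set.univ).comap L) (fun g => by
        have h : L (toAlg p G g) = toAlg p G g - 1 := by
          simp [L, augmentation]
        rw [Submodule.mem_comap, h]
        exact sub_one_mem_deltaSpan _ trivial) x
      simpa [L] using this
    intro x hx
    have h := key x
    rw [mem_augKer] at hx
    rwa [hx, zero_smul, sub_zero] at h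
  · rw [deltaSpan_le]
    intro g _
    rw [mem_augKer, map_sub, augmentation_toAlg, map_one, sub_self]

theorem toAlg_sub_one_mem (g : G) : toAlg p G g - 1 ∈ augKer (augmentation p G) := by
  rw [augKer_augmentation]; exact sub_one_mem_deltaSpan _ trivial

theorem deltaSpan_le_augKer (B : Set G) :
    deltaSpan p (toAlg p G) B ≤ augKer (augmentation p G) := by
  rw [augKer_augmentation]; exact deltaSpan_mono _ (Set.subset_univ _)

theorem mapDomain_eq_zero_iff {G' : Type*} [Group G'] (θ : G →* G')
    (x : MonoidAlgebra (ZMod p) G) :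
    MonoidAlgebra.mapDomainAlgHom (ZMod p) (ZMod p) θ x = 0 ↔
      x ∈ deltaSpan p (toAlg p G) (θ.ker : Set G) * ⊤ := by
  set f := MonoidAlgebra.mapDomainAlgHom (ZMod p) (ZMod p) θ
  have hf : ∀ g, f (toAlg p G g) = toAlg p G' (θ g) := fun g => by
    simp [f, MonoidAlgebra.of_apply]
  constructor
  · intro hx
    -- A section of `θ` over its image. Its linear extension `σ` reduces the claim to `g - s (θ g)`,
    -- which is `k - 1` times a group element with `k` in the kernel.
    let s : G' → G := Function.invFun θ
    have hs : ∀ g, θ (s (θ g)) = θ g := fun g => Function.invFun_eq ⟨g, rfl⟩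
    let σ : MonoidAlgebra (ZMod p) G' →ₗ[ZMod p] MonoidAlgebra (ZMod p) G :=
      (MonoidAlgebra.basis G' (ZMod p)).constr (ZMod p) (fun a => toAlg p G (s a))
    have hσ : ∀ a, σ (toAlg p G' a) = toAlg p G (s a) := fun a => by
      have := (MonoidAlgebra.basis G' (ZMod p)).constr_basis (ZMod p) (fun a => toAlg p G (s a)) a
      simpa [σ, MonoidAlgebra.of_apply] using this
    have key := mem_of_toAlg_mem
      (N := (deltaSpan p (toAlg p G) (θ.ker : Set G) * ⊤).comap
        (LinearMap.id - σ.comp f.toLinearMap)) (fun g => by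
        rw [Submodule.mem_comap]
        have h : (LinearMap.id - σ.comp f.toLinearMap : _ →ₗ[ZMod p] _) (toAlg p G g)
            = (toAlg p G (g * (s (θ g))⁻¹) - 1) * toAlg p G (s (θ g)) := by
          rw [sub_mul, one_mul, ← map_mul, inv_mul_cancel_right]
          simp only [LinearMap.sub_apply, LinearMap.id_apply, LinearMap.comp_apply,
            AlgHom.toLinearMap_apply, hf, hσ]
        rw [h]
        refine Submodule.mul_mem_mul (sub_one_mem_deltaSpan _ ?_) trivial
        rw [SetLike.mem_coe, MonoidHom.mem_ker, map_mul, map_inv, hs, mul_inv_cancel]) x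
    rw [Submodule.mem_comap] at key
    simpa [hx] using key
  · intro hx
    have hle : deltaSpan p (toAlg p G) (θ.ker : Set G) * ⊤ ≤ LinearMap.ker f.toLinearMap := by
      refine Submodule.mul_le.2 fun a ha b _ => ?_
      have h1 : deltaSpan p (toAlg p G) (θ.ker : Set G) ≤ LinearMap.ker f.toLinearMap := by
        rw [deltaSpan_le]
        intro g hg
        rw [LinearMap.mem_ker, AlgHom.toLinearMap_apply, map_sub, hf, MonoidHom.mem_ker.1 hg,
          map_one, map_one, sub_self]
      have h2 : f a = 0 := h1 ha
      rw [LinearMap.mem_ker, AlgHom.toLinearMap_apply, map_mul, h2, zero_mul]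
    exact hle hx

theorem commSpan_eq_deltaSpan :
    commSpan (ZMod p) (MonoidAlgebra (ZMod p) G) =
      deltaSpan p (toAlg p G) (lcsTerm G 2 : Set G) * ⊤ := by
  have hker : (Abelianization.of (G := G)).ker = lcsTerm G 2 := by
    rw [Abelianization.ker_of, lcsTerm_two_eq]
  have hmem := fun x => mapDomain_eq_zero_iff (p := p) (Abelianization.of (G := G)) x
  rw [hker] at hmem
  apply le_antisymm
  · refine commSpan_le_of ?_ ?_ fun x y => ?_
    · refine Submodule.mul_le.2 fun a _ b hb => ?_
      rw [← hmem] at hb ⊢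
      rw [map_mul, hb, mul_zero]
    · rw [mul_assoc, top_mul_top_eq]
    · rw [← hmem, map_sub, map_mul, map_mul, mul_comm, sub_self]
  · refine (mul_le_mul_left ?_ _).trans commSpan_mul_top
    rw [deltaSpan_le]
    let C := commSpan (ZMod p) (MonoidAlgebra (ZMod p) G)
    have hr : ∀ {a} b, a ∈ C → a * b ∈ C := fun b ha =>
      commSpan_mul_top (Submodule.mul_mem_mul ha trivial)
    intro g hg
    rw [lcsTerm_two_eq, SetLike.mem_coe, commutator_eq_closure] at hg
    induction hg using Subgroup.closure_induction with
    | mem x hx =>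
      obtain ⟨a, b, rfl⟩ := hx
      have h : toAlg p G ⁅a, b⁆ - 1 = (toAlg p G a * toAlg p G b - toAlg p G b * toAlg p G a)
          * toAlg p G (a⁻¹ * b⁻¹) := by
        rw [sub_mul, ← map_mul, ← map_mul, ← map_mul, ← map_mul, ← map_one (toAlg p G)]
        congr 2 <;> group
      rw [h]
      exact hr _ (comm_mem_commSpan _ _)
    | one => rw [map_one, sub_self]; exact zero_mem _
    | mul x y _ _ hx hy =>
      have h : toAlg p G (x * y) - 1 = (toAlg p G x - 1) * toAlg p G y + (toAlg p G y - 1) := by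
        rw [map_mul]; noncomm_ring
      rw [h]
      exact add_mem (hr _ hx) hy
    | inv x _ hx =>
      have h : toAlg p G x⁻¹ - 1 = -((toAlg p G x - 1) * toAlg p G x⁻¹) := by
        rw [sub_mul, ← map_mul, mul_inv_cancel, map_one, one_mul, neg_sub]
      rw [h]
      exact neg_mem (hr _ hx)

/-- Moving `g - 1` past `n - 1` costs `(⁅g, n⁆ - 1) n g`, and the commutator lies one step further
down the series. -/
theorem augKer_mul_deltaSpan_le (i : ℕ) (hi : 1 ≤ i) :
    augKer (augmentation p G) * deltaSpan p (toAlg p G) (lcsTerm G i : Set G) ≤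
      deltaSpan p (toAlg p G) (lcsTerm G (i + 1) : Set G) * ⊤ ⊔
        deltaSpan p (toAlg p G) (lcsTerm G i : Set G) * augKer (augmentation p G) := by
  rw [augKer_augmentation]
  conv_lhs => rw [deltaSpan, deltaSpan, Submodule.span_mul_span]
  rw [Submodule.span_le]
  rintro _ ⟨_, ⟨g, _, rfl⟩, _, ⟨n, hn, rfl⟩, rfl⟩
  have hc : ⁅g, n⁆ ∈ lcsTerm G (i + 1) := by
    rw [lcsTerm_succ G i hi, Subgroup.commutator_comm]
    exact Subgroup.commutator_mem_commutator trivial hn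
  have h : (toAlg p G g - 1) * (toAlg p G n - 1)
      = (toAlg p G ⁅g, n⁆ - 1) * toAlg p G (n * g) + (toAlg p G n - 1) * (toAlg p G g - 1) := by
    have : toAlg p G ⁅g, n⁆ * toAlg p G (n * g) = toAlg p G g * toAlg p G n := by
      rw [← map_mul, ← map_mul]; congr 1; group
    rw [sub_mul _ 1 (toAlg p G (n * g)), this, map_mul]; noncomm_ring
  refine (congrArg (· ∈ _) h).mpr
    (add_mem (Submodule.mem_sup_left ?_) (Submodule.mem_sup_right ?_))
  · exact Submodule.mul_mem_mul (sub_one_mem_deltaSpan _ hc) trivial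
  · exact Submodule.mul_mem_mul (sub_one_mem_deltaSpan _ hn) (sub_one_mem_deltaSpan _ trivial)

local notation "I" => augKer (augmentation p G)
local notation "J" => commSpan (ZMod p) (MonoidAlgebra (ZMod p) G)
local notation "Δ" i => deltaSpan p (toAlg p G) (lcsTerm G i : Set G)

theorem deltaSpan_lcsTerm_two_le : (Δ 2) ≤ J := by
  rw [commSpan_eq_deltaSpan]; exact le_mul_top _

theorem commSpan_mul_augKer_eq : J * I = (Δ 2) * I := by
  rw [commSpan_eq_deltaSpan, mul_assoc]
  exact le_antisymm (mul_le_mul_right (top_mul_augKer _) _) (mul_le_mul_right (le_top_mul _) _)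

theorem mixTwo_le : mixTwo I J ≤ (Δ 3) * ⊤ ⊔ J * I := by
  refine sup_le ?_ le_sup_right
  rw [commSpan_mul_augKer_eq, commSpan_eq_deltaSpan, ← mul_assoc]
  refine (mul_le_mul_left (augKer_mul_deltaSpan_le 2 (by norm_num)) _).trans ?_
  rw [Submodule.sup_mul, mul_assoc, top_mul_top_eq, mul_assoc]
  exact sup_le_sup_left (mul_le_mul_right (augKer_mul_top _) _) _

/-- All factors from `I` are moved to the right of the factor from `J`. Each move costs a term one
step further down the lower central series; everything else is absorbed by `J * I`, the part that
the functionals of `exists_linearMap_of_hom` kill. -/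
theorem mixThree_le : mixThree I J ≤ (Δ 4) * ⊤ ⊔ J * I := by
  have h3 : (Δ 3) ≤ J :=
    (deltaSpan_mono _ (lcsTerm_antitone G (by norm_num))).trans deltaSpan_lcsTerm_two_le
  have hJII : J * I * I ≤ J * I := by
    rw [mul_assoc]; exact mul_le_mul_right ((mul_le_mul_right le_top _).trans (augKer_mul_top _)) _
  have hIJI : I * J * I ≤ J * I := by
    refine mul_le_mul_left ?_ _
    exact (mul_le_mul_left le_top _).trans top_mul_commSpan
  refine sup_le (sup_le ?_ ?_) ?_
  · have h : I * J ≤ (Δ 3) * ⊤ ⊔ J * I := le_sup_left.trans mixTwo_le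
    rw [mul_assoc]
    refine (mul_le_mul_right h _).trans ?_
    rw [Submodule.mul_sup, ← mul_assoc, ← mul_assoc]
    refine sup_le ?_ (hIJI.trans le_sup_right)
    refine (mul_le_mul_left (augKer_mul_deltaSpan_le 3 (by norm_num)) _).trans ?_
    rw [Submodule.sup_mul, mul_assoc, top_mul_top_eq, mul_assoc]
    refine sup_le_sup_left ?_ _
    exact (mul_le_mul_right (augKer_mul_top _) _).trans (mul_le_mul_left h3 _)
  · exact hIJI.trans le_sup_right
  · exact hJII.trans le_sup_right

universe w in
theorem exists_hom_zmodModule_ker_eq {V : Type w} [Group V] (N : Subgroup V) [N.Normal]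
    (hc : ∀ a b : V, ⁅a, b⁆ ∈ N) (hp : ∀ a : V, a ^ p ∈ N) :
    ∃ (M : Type w) (_ : AddCommGroup M) (_ : Module (ZMod p) M) (l : V →* Multiplicative M),
      l.ker = N := by
  let c : CommGroup (V ⧸ N) :=
    { (inferInstance : Group (V ⧸ N)) with
      mul_comm := by
        intro x y
        obtain ⟨a, rfl⟩ := QuotientGroup.mk'_surjective N x
        obtain ⟨b, rfl⟩ := QuotientGroup.mk'_surjective N y
        rw [← commutatorElement_eq_one_iff_mul_comm, ← map_commutatorElement]
        exact (QuotientGroup.eq_one_iff _).2 (hc a b) }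
  have hexp : ∀ x : Additive (V ⧸ N), p • x = 0 := by
    intro x
    obtain ⟨a, ha⟩ := QuotientGroup.mk'_surjective N x.toMul
    have : x.toMul ^ p = 1 := by
      rw [← ha, ← map_pow]
      exact (QuotientGroup.eq_one_iff _).2 (hp a)
    exact this
  exact ⟨Additive (V ⧸ N), inferInstance, AddCommGroup.zmodModule hexp, QuotientGroup.mk' N,
    QuotientGroup.ker_mk' N⟩

/-- A linear functional on the group algebra that detects elements of `γ_2(G)`. -/
theorem exists_linearMap_of_hom {M : Type*} [AddCommGroup M] [Module (ZMod p) M]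
    (l : lcsTerm G 2 →* Multiplicative M) :
    ∃ f : MonoidAlgebra (ZMod p) G →ₗ[ZMod p] M,
      ∀ (n : lcsTerm G 2) (x : MonoidAlgebra (ZMod p) G),
        f ((toAlg p G n - 1) * x) = augmentation p G x • (l n).toAdd := by
  let s : G → G := fun g => (QuotientGroup.mk (s := lcsTerm G 2) g).out
  have hs : ∀ g, g * (s g)⁻¹ ∈ lcsTerm G 2 := fun g => by
    have h1 : (s g)⁻¹ * g ∈ lcsTerm G 2 := by
      rw [← QuotientGroup.eq]; exact QuotientGroup.out_eq' _
    have h2 := (lcsTerm_normal G 2).conj_mem _ h1 (s g)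
    simpa [mul_assoc] using h2
  have hs' : ∀ (n : lcsTerm G 2) (g : G), s (n * g) = s g := fun n g => by
    have : (QuotientGroup.mk (s := lcsTerm G 2) ((n : G) * g)) = QuotientGroup.mk g := by
      rw [QuotientGroup.mk_mul, (QuotientGroup.eq_one_iff (n : G)).2 n.2, one_mul]
    simp only [s, this]
  let t : G → M := fun g => (l ⟨g * (s g)⁻¹, hs g⟩).toAdd
  have ht : ∀ (n : lcsTerm G 2) (g : G), t (n * g) = (l n).toAdd + t g := fun n g => by
    have : (⟨n * g * (s (n * g))⁻¹, hs _⟩ : lcsTerm G 2) = n * ⟨g * (s g)⁻¹, hs g⟩ := by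
      ext; simp [hs', mul_assoc]
    simp only [t, this, map_mul, toAdd_mul]
  let f : MonoidAlgebra (ZMod p) G →ₗ[ZMod p] M := (MonoidAlgebra.basis G (ZMod p)).constr (ZMod p) t
  have hf : ∀ g, f (toAlg p G g) = t g := fun g => by
    have := (MonoidAlgebra.basis G (ZMod p)).constr_basis (ZMod p) t g
    simpa [f, MonoidAlgebra.of_apply] using this
  refine ⟨f, fun n x => ?_⟩
  refine linearMap_eq_of_toAlg (f := f.comp (LinearMap.mulLeft (ZMod p) (toAlg p G n - 1)))
    (g := (augmentation p G).toLinearMap.smulRight (l n).toAdd) (fun g => ?_) x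
  simp only [LinearMap.comp_apply, LinearMap.mulLeft_apply, LinearMap.smulRight_apply,
    AlgHom.toLinearMap_apply, augmentation_toAlg, one_smul]
  rw [sub_mul, one_mul, ← map_mul, map_sub, hf, hf, ht, add_sub_cancel_right]

/-- Since `⁅γ_2, γ_2⁆ ≤ γ_4`, for `i ≤ 4` the quotient of `γ_2` by `γ_2^p γ_i` is elementary
abelian. Its quotient map `l` extends to a functional `f` with `f ((n - 1) x) = ε(x) l(n)`. This `f`
kills both `Δ i * ⊤` and `J * I` but still sees `l g`. -/
theorem mem_gammaTwoPowMul_of_sub_one_mem (i : ℕ) (hi : 2 ≤ i) (hi4 : i ≤ 4) {g : G}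
    (hg : toAlg p G g - 1 ∈ (Δ i) * ⊤ ⊔ J * I) : g ∈ gammaTwoPowMul G p i := by
  have hJI : J * I ≤ J := (mul_le_mul_right le_top _).trans commSpan_mul_top
  have hg2 : g ∈ lcsTerm G 2 := by
    have hJ : toAlg p G g - 1 ∈ J := by
      refine (sup_le ?_ hJI) hg
      exact (mul_le_mul_left ((deltaSpan_mono _ (lcsTerm_antitone G hi)).trans
        deltaSpan_lcsTerm_two_le) _).trans commSpan_mul_top
    have hker : (Abelianization.of (G := G)).ker = lcsTerm G 2 := by
      rw [Abelianization.ker_of, lcsTerm_two_eq]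
    rw [commSpan_eq_deltaSpan, ← hker, ← mapDomain_eq_zero_iff, map_sub, map_one,
      sub_eq_zero] at hJ
    rw [← hker, MonoidHom.mem_ker]
    apply MonoidAlgebra.of_injective (R := ZMod p)
    rw [map_one, ← hJ]
    simp [MonoidAlgebra.of_apply]
  obtain ⟨M, _, _, l, hl⟩ := exists_hom_zmodModule_ker_eq (p := p)
    ((gammaTwoPowMul G p i).subgroupOf (lcsTerm G 2))
    (fun a b => by
      have h2 := commutator_lcsTerm_two_le G (Subgroup.commutator_mem_commutator a.2 b.2)
      exact (le_sup_right : lcsTerm G i ≤ gammaTwoPowMul G p i) (lcsTerm_antitone G hi4 h2))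
    (fun a => (le_sup_left : powerSubgroup p (lcsTerm G 2) ≤ gammaTwoPowMul G p i)
      (Subgroup.subset_closure ⟨a, a.2, rfl⟩))
  obtain ⟨f, hf⟩ := exists_linearMap_of_hom (p := p) l
  have hker : (Δ i) * ⊤ ⊔ J * I ≤ LinearMap.ker f := by
    refine sup_le ?_ ?_
    · rw [Submodule.mul_le]
      intro a ha b _
      have : (Δ i) ≤ (LinearMap.ker f).comap (LinearMap.mulRight (ZMod p) b) := by
        rw [deltaSpan_le]
        intro n hn
        have h2 : l ⟨n, lcsTerm_antitone G hi hn⟩ = 1 := by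
          rw [← MonoidHom.mem_ker, hl]
          exact (le_sup_right : lcsTerm G i ≤ gammaTwoPowMul G p i) hn
        rw [Submodule.mem_comap, LinearMap.mulRight_apply, LinearMap.mem_ker,
          hf ⟨n, lcsTerm_antitone G hi hn⟩, h2, toAdd_one, smul_zero]
      exact this ha
    · rw [commSpan_mul_augKer_eq, Submodule.mul_le]
      intro a ha b hb
      have : (Δ 2) ≤ (LinearMap.ker f).comap (LinearMap.mulRight (ZMod p) b) := by
        rw [deltaSpan_le]
        intro n hn
        rw [Submodule.mem_comap, LinearMap.mulRight_apply, LinearMap.mem_ker, hf ⟨n, hn⟩,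
          mem_augKer.1 hb, zero_smul]
      exact this ha
  have h0 : f (toAlg p G g - 1) = 0 := hker hg
  have h1 := hf ⟨g, hg2⟩ 1
  rw [mul_one, h0, map_one, one_smul] at h1
  have h2 : (⟨g, hg2⟩ : lcsTerm G 2) ∈ l.ker := by
    rw [MonoidHom.mem_ker, ← ofAdd_toAdd (l _), ← h1, ofAdd_zero]
  rw [hl] at h2
  exact h2

end GroupAlgebra

/-! ### Truncated ideals and group bases -/

section Truncated

variable {F S : Type*} [Field F] [Ring S] [Algebra F S]

/-- The elements of a group whose images are congruent to `1` modulo a left ideal. -/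
def congrOneSubgroup {G : Type*} [Group G] (u : G →* S) (X : Submodule F S) (hX : ⊤ * X ≤ X) :
    Subgroup G where
  carrier := {g | u g - 1 ∈ X}
  one_mem' := by simp
  mul_mem' := by
    intro a b ha hb
    have h : u (a * b) - 1 = u a * (u b - 1) + (u a - 1) := by rw [map_mul]; noncomm_ring
    rw [Set.mem_ofPred_eq, h]
    exact add_mem (hX (Submodule.mul_mem_mul trivial hb)) ha
  inv_mem' := by
    intro a ha
    have h : u a⁻¹ - 1 = -(u a⁻¹ * (u a - 1)) := by
      rw [mul_sub, ← map_mul, inv_mul_cancel, map_one, mul_one, neg_sub]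
    rw [Set.mem_ofPred_eq, h]
    exact neg_mem (hX (Submodule.mul_mem_mul trivial ha))

theorem mem_congrOneSubgroup {G : Type*} [Group G] {u : G →* S} {X : Submodule F S}
    {hX : ⊤ * X ≤ X} {g : G} : g ∈ congrOneSubgroup u X hX ↔ u g - 1 ∈ X := Iff.rfl

/-- An ideal `I` with a commutator ideal `J` such that threefold products involving `J` vanish. -/
structure IsTruncated (I J : Submodule F S) : Prop where
  mul_le : I * I ≤ I
  le_sq : J ≤ I * I
  mixTwo_le : mixTwo I J ≤ J
  comm_mem : ∀ x ∈ I, ∀ y ∈ I, x * y - y * x ∈ J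
  three : mixThree I J = ⊥

end Truncated

/-- The group `G` maps to the ring `S` in such a way that the filtration `I ≥ J ≥ IJ + JI ≥ 0`
induces the filtration `G ≥ γ_2(G) ≥ γ_2(G)^p γ_3(G) ≥ γ_2(G)^p γ_4(G)`. -/
structure IsGroupBasis (p : ℕ) [Fact p.Prime] {S : Type*} [Ring S] [Algebra (ZMod p) S]
    (I J : Submodule (ZMod p) S) {G : Type*} [Group G] (u : G →* S) : Prop where
  span_range : Submodule.span (ZMod p) (Set.range u) = ⊤
  sub_one_mem : ∀ g, u g - 1 ∈ I
  le_deltaSpan : I ≤ deltaSpan p u Set.univ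
  exists_sub_mem : ∀ x ∈ I, ∃ g, x - (u g - 1) ∈ I * I
  two_mem : ∀ n ∈ lcsTerm G 2, u n - 1 ∈ J
  exists_two_sub_mem : ∀ x ∈ J, ∃ n ∈ lcsTerm G 2, x - (u n - 1) ∈ mixTwo I J
  mem_three : ∀ g, u g - 1 ∈ mixTwo I J ↔ g ∈ gammaTwoPowMul G p 3
  mem_four : ∀ g, u g = 1 ↔ g ∈ gammaTwoPowMul G p 4

/-! ### The group algebra modulo `mixThree` carries a group basis -/

section GroupAlgebra

variable {p : ℕ} [Fact p.Prime] {G : Type*} [Group G]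

local notation "I" => augKer (augmentation p G)
local notation "J" => commSpan (ZMod p) (MonoidAlgebra (ZMod p) G)
local notation "Δ" i => deltaSpan p (toAlg p G) (lcsTerm G i : Set G)

theorem top_mul_mixTwo {F R : Type*} [Field F] [Ring R] [Algebra F R] (ε : R →ₐ[F] F) :
    ⊤ * mixTwo (augKer ε) (commSpan F R) ≤ mixTwo (augKer ε) (commSpan F R) := by
  rw [mixTwo, Submodule.mul_sup, ← mul_assoc, ← mul_assoc]
  exact sup_le_sup (mul_le_mul_left (top_mul_augKer ε) _) (mul_le_mul_left top_mul_commSpan _)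

theorem mixTwo_mul_top {F R : Type*} [Field F] [Ring R] [Algebra F R] (ε : R →ₐ[F] F) :
    mixTwo (augKer ε) (commSpan F R) * ⊤ ≤ mixTwo (augKer ε) (commSpan F R) := by
  rw [mixTwo, Submodule.sup_mul, mul_assoc, mul_assoc]
  exact sup_le_sup (mul_le_mul_right commSpan_mul_top _) (mul_le_mul_right (augKer_mul_top ε) _)

theorem top_mul_mixThree {F R : Type*} [Field F] [Ring R] [Algebra F R] (ε : R →ₐ[F] F) :
    ⊤ * mixThree (augKer ε) (commSpan F R) ≤ mixThree (augKer ε) (commSpan F R) := by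
  rw [mixThree, Submodule.mul_sup, Submodule.mul_sup]
  simp only [← mul_assoc]
  exact sup_le_sup (sup_le_sup
    (mul_le_mul_left (mul_le_mul_left (top_mul_augKer ε) _) _)
    (mul_le_mul_left (mul_le_mul_left (top_mul_augKer ε) _) _))
    (mul_le_mul_left (mul_le_mul_left top_mul_commSpan _) _)

theorem mixThree_mul_top {F R : Type*} [Field F] [Ring R] [Algebra F R] (ε : R →ₐ[F] F) :
    mixThree (augKer ε) (commSpan F R) * ⊤ ≤ mixThree (augKer ε) (commSpan F R) := by
  rw [mixThree, Submodule.sup_mul, Submodule.sup_mul]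
  simp only [mul_assoc]
  exact sup_le_sup (sup_le_sup
    (mul_le_mul_right (mul_le_mul_right commSpan_mul_top _) _)
    (mul_le_mul_right (mul_le_mul_right (augKer_mul_top ε) _) _))
    (mul_le_mul_right (mul_le_mul_right (augKer_mul_top ε) _) _)

theorem augKer_mul_self_le {F R : Type*} [Field F] [Ring R] [Algebra F R] (ε : R →ₐ[F] F) :
    augKer ε * augKer ε ≤ augKer ε :=
  (mul_le_mul_left le_top _).trans (top_mul_augKer ε)

theorem augKer_mul_mixTwo_le {F R : Type*} [Field F] [Ring R] [Algebra F R] (ε : R →ₐ[F] F) :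
    augKer ε * mixTwo (augKer ε) (commSpan F R) ≤ mixThree (augKer ε) (commSpan F R) := by
  rw [mixTwo, Submodule.mul_sup, ← mul_assoc, ← mul_assoc]
  exact le_sup_left

theorem mixTwo_mul_augKer_le {F R : Type*} [Field F] [Ring R] [Algebra F R] (ε : R →ₐ[F] F) :
    mixTwo (augKer ε) (commSpan F R) * augKer ε ≤ mixThree (augKer ε) (commSpan F R) := by
  rw [mixTwo, Submodule.sup_mul]
  exact sup_le (le_sup_right.trans le_sup_left) le_sup_right

theorem mixThree_le_mixTwo {F R : Type*} [Field F] [Ring R] [Algebra F R] (ε : R →ₐ[F] F) :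
    mixThree (augKer ε) (commSpan F R) ≤ mixTwo (augKer ε) (commSpan F R) := by
  refine sup_le (sup_le ?_ ?_) ?_
  · exact (mul_le_mul_left (augKer_mul_self_le ε) _).trans le_sup_left
  · rw [mul_assoc]
    exact (mul_le_mul_right ((mul_le_mul_right le_top _).trans commSpan_mul_top) _).trans
      le_sup_left
  · rw [mul_assoc]
    exact (mul_le_mul_right (augKer_mul_self_le ε) _).trans le_sup_right

theorem toAlg_commutator_sub_one (a b : G) :
    toAlg p G ⁅a, b⁆ - 1 = ((toAlg p G a - 1) * (toAlg p G b - 1)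
      - (toAlg p G b - 1) * (toAlg p G a - 1)) * toAlg p G (a⁻¹ * b⁻¹) := by
  have h : (toAlg p G a - 1) * (toAlg p G b - 1) - (toAlg p G b - 1) * (toAlg p G a - 1)
      = toAlg p G (a * b) - toAlg p G (b * a) := by
    rw [map_mul, map_mul]; noncomm_ring
  rw [h, sub_mul, ← map_mul, ← map_mul, ← map_one (toAlg p G)]
  congr 2 <;> group

theorem sub_one_mem_of_lcsTerm_succ (i : ℕ) (hi : 1 ≤ i)
    {X Y : Submodule (ZMod p) (MonoidAlgebra (ZMod p) G)}
    (hX : ∀ n ∈ lcsTerm G i, toAlg p G n - 1 ∈ X) (hXY : I * X ≤ Y) (hYX : X * I ≤ Y)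
    (hY : ⊤ * Y ≤ Y) (hY' : Y * ⊤ ≤ Y) : ∀ n ∈ lcsTerm G (i + 1), toAlg p G n - 1 ∈ Y := by
  have h : lcsTerm G (i + 1) ≤ congrOneSubgroup (toAlg p G) Y hY := by
    rw [lcsTerm_succ G i hi, Subgroup.commutator_le]
    intro a ha b _
    rw [mem_congrOneSubgroup, toAlg_commutator_sub_one]
    exact hY' (Submodule.mul_mem_mul
      (sub_mem (hYX (Submodule.mul_mem_mul (hX a ha) (toAlg_sub_one_mem b)))
        (hXY (Submodule.mul_mem_mul (toAlg_sub_one_mem b) (hX a ha)))) trivial)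
  exact fun n hn => h hn

theorem lcsTerm_two_sub_one_mem (n : G) (hn : n ∈ lcsTerm G 2) : toAlg p G n - 1 ∈ J :=
  deltaSpan_lcsTerm_two_le (sub_one_mem_deltaSpan _ hn)

theorem lcsTerm_three_sub_one_mem (n : G) (hn : n ∈ lcsTerm G 3) :
    toAlg p G n - 1 ∈ mixTwo I J := by
  refine sub_one_mem_of_lcsTerm_succ (X := J) (Y := mixTwo I J) 2 (by norm_num) ?_ ?_ ?_ ?_ ?_ n hn
  · exact lcsTerm_two_sub_one_mem
  · exact le_sup_left
  · exact le_sup_right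
  · exact top_mul_mixTwo _
  · exact mixTwo_mul_top _

theorem lcsTerm_four_sub_one_mem (n : G) (hn : n ∈ lcsTerm G 4) :
    toAlg p G n - 1 ∈ mixThree I J := by
  refine sub_one_mem_of_lcsTerm_succ (X := mixTwo I J) (Y := mixThree I J) 3 (by norm_num)
    ?_ ?_ ?_ ?_ ?_ n hn
  · exact lcsTerm_three_sub_one_mem
  · exact augKer_mul_mixTwo_le _
  · exact mixTwo_mul_augKer_le _
  · exact top_mul_mixThree _
  · exact mixThree_mul_top _

/-- In characteristic p, `n^p - 1 = (n - 1)^p`. As `p ≥ 2` this has two factors in `J`, one of which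
may be taken in `I * I`. -/
theorem pow_sub_one_mem (n : G) (hn : n ∈ lcsTerm G 2) :
    toAlg p G (n ^ p) - 1 ∈ mixThree I J := by
  have hp : p.Prime := Fact.out
  obtain ⟨k, hk⟩ := Nat.exists_eq_add_of_le hp.two_le
  have : CharP (MonoidAlgebra (ZMod p) G) p := charP_of_injective_algebraMap'  (ZMod p) p
  have h : toAlg p G (n ^ p) - 1 = (toAlg p G n - 1) ^ p := by
    rw [map_pow, sub_pow_char_of_commute p (Commute.one_right _), one_pow]
  have hJ := lcsTerm_two_sub_one_mem (p := p) n hn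
  have h2 : (toAlg p G n - 1) ^ p ∈ J * J * ⊤ := by
    have hx : (toAlg p G n - 1) ^ p = (toAlg p G n - 1) * (toAlg p G n - 1)
        * (toAlg p G n - 1) ^ k := by
      rw [← sq, ← pow_add, ← hk]
    rw [hx]
    exact Submodule.mul_mem_mul (Submodule.mul_mem_mul hJ hJ) trivial
  rw [h]
  have h3 : J * J ≤ mixThree I J := (mul_le_mul_left (commSpan_le_augKer_sq (augmentation p G)) _).trans
    (le_sup_left.trans le_sup_left)
  have h4 : J * J * ⊤ ≤ mixThree I J * ⊤ := mul_le_mul_left h3 _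
  exact mixThree_mul_top _ (h4 h2)

theorem powerSubgroup_sub_one_mem (n : G) (hn : n ∈ powerSubgroup p (lcsTerm G 2)) :
    toAlg p G n - 1 ∈ mixThree I J := by
  have h : powerSubgroup p (lcsTerm G 2) ≤ congrOneSubgroup (toAlg p G) _
      (top_mul_mixThree (augmentation p G)) := by
    rw [powerSubgroup, Subgroup.closure_le]
    rintro _ ⟨n, hn, rfl⟩
    exact pow_sub_one_mem n hn
  exact h hn

theorem sub_one_mem_mixTwo_iff (g : G) :
    toAlg p G g - 1 ∈ mixTwo I J ↔ g ∈ gammaTwoPowMul G p 3 := by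
  refine ⟨fun h => mem_gammaTwoPowMul_of_sub_one_mem 3 (by norm_num) (by norm_num) (mixTwo_le h),
    fun h => ?_⟩
  have hle : gammaTwoPowMul G p 3 ≤ congrOneSubgroup (toAlg p G) _
      (top_mul_mixTwo (augmentation p G)) :=
    sup_le (fun n hn => mixThree_le_mixTwo _ (powerSubgroup_sub_one_mem n hn))
      lcsTerm_three_sub_one_mem
  exact hle h

theorem sub_one_mem_mixThree_iff (g : G) :
    toAlg p G g - 1 ∈ mixThree I J ↔ g ∈ gammaTwoPowMul G p 4 := by
  refine ⟨fun h => mem_gammaTwoPowMul_of_sub_one_mem 4 (by norm_num) (by norm_num)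
    (mixThree_le h), fun h => ?_⟩
  have hle : gammaTwoPowMul G p 4 ≤ congrOneSubgroup (toAlg p G) _
      (top_mul_mixThree (augmentation p G)) :=
    sup_le powerSubgroup_sub_one_mem lcsTerm_four_sub_one_mem
  exact hle h

theorem exists_toAlg_sub_mem (x : MonoidAlgebra (ZMod p) G) (hx : x ∈ I) :
    ∃ g, x - (toAlg p G g - 1) ∈ I * I := by
  rw [augKer_augmentation, ← Subgroup.coe_top] at hx
  obtain ⟨k, -, hk⟩ := exists_mem_subgroup_sub_mem _ hx
  exact ⟨k, mul_le_mul' (deltaSpan_le_augKer _) (deltaSpan_le_augKer _) hk⟩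

theorem deltaSpan_mul_top (B : Set G) : deltaSpan p (toAlg p G) B * ⊤ ≤
    deltaSpan p (toAlg p G) B ⊔ deltaSpan p (toAlg p G) B * I := by
  refine Submodule.mul_le.2 fun a ha b _ => ?_
  have h : a * b = augmentation p G b • a
      + a * (b - algebraMap (ZMod p) (MonoidAlgebra (ZMod p) G) (augmentation p G b)) := by
    rw [mul_sub, ← Algebra.commutes, ← Algebra.smul_def]; abel
  rw [h]
  refine add_mem (Submodule.mem_sup_left (Submodule.smul_mem _ _ ha))
    (Submodule.mem_sup_right (Submodule.mul_mem_mul ha ?_))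
  rw [mem_augKer, map_sub, AlgHom.commutes]; simp

theorem exists_two_toAlg_sub_mem (x : MonoidAlgebra (ZMod p) G) (hx : x ∈ J) :
    ∃ n ∈ lcsTerm G 2, x - (toAlg p G n - 1) ∈ mixTwo I J := by
  rw [commSpan_eq_deltaSpan] at hx
  obtain ⟨y, hy, z, hz, rfl⟩ := Submodule.mem_sup.1 (deltaSpan_mul_top _ hx)
  obtain ⟨n, hn, hk⟩ := exists_mem_subgroup_sub_mem _ hy
  refine ⟨n, hn, ?_⟩
  have h : y + z - (toAlg p G n - 1) = (y - (toAlg p G n - 1)) + z := by abel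
  rw [h]
  have hle : (Δ 2) * I ≤ J * I := mul_le_mul_left deltaSpan_lcsTerm_two_le _
  exact add_mem (Submodule.mem_sup_right (hle (mul_le_mul_right (deltaSpan_le_augKer _) _ hk)))
    (Submodule.mem_sup_right (hle hz))

variable {S : Type*} [Ring S] [Algebra (ZMod p) S]

theorem isGroupBasis_of_surjective (π : MonoidAlgebra (ZMod p) G →ₐ[ZMod p] S)
    (hπ : Function.Surjective π) (hker : LinearMap.ker π.toLinearMap = mixThree I J) :
    IsGroupBasis p ((I).map π.toLinearMap) ((J).map π.toLinearMap)
      ((π : MonoidAlgebra (ZMod p) G →* S).comp (toAlg p G)) where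
  span_range := by
    have h := congrArg (Submodule.map π.toLinearMap) (span_range_toAlg (p := p) (G := G))
    rw [Submodule.map_span, Submodule.map_top, LinearMap.range_eq_top.2 hπ, ← Set.range_comp] at h
    exact h
  sub_one_mem g := ⟨toAlg p G g - 1, toAlg_sub_one_mem g, by simp⟩
  le_deltaSpan := by
    rw [augKer_augmentation, deltaSpan, deltaSpan, Submodule.map_span, ← Set.image_comp]
    refine Submodule.span_mono ?_
    rintro _ ⟨g, hg, rfl⟩
    exact ⟨g, hg, by simp⟩
  exists_sub_mem := by
    rintro _ ⟨x, hx, rfl⟩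
    obtain ⟨g, hg⟩ := exists_toAlg_sub_mem x hx
    refine ⟨g, ?_⟩
    rw [← Submodule.map_mul]
    exact ⟨_, hg, by simp⟩
  two_mem n hn := ⟨toAlg p G n - 1, lcsTerm_two_sub_one_mem n hn, by simp⟩
  exists_two_sub_mem := by
    rintro _ ⟨x, hx, rfl⟩
    obtain ⟨g, hg, hg'⟩ := exists_two_toAlg_sub_mem x hx
    refine ⟨g, hg, ?_⟩
    rw [← map_mixTwo]
    exact ⟨_, hg', by simp⟩
  mem_three g := by
    rw [← sub_one_mem_mixTwo_iff, ← map_mixTwo]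
    have h1 : (Submodule.map π.toLinearMap (mixTwo I J)).comap π.toLinearMap = mixTwo I J := by
      rw [Submodule.comap_map_eq, hker, sup_eq_left.2 (mixThree_le_mixTwo _)]
    conv_rhs => rw [← h1]
    rw [Submodule.mem_comap, AlgHom.toLinearMap_apply, map_sub, map_one]
    rfl
  mem_four g := by
    rw [← sub_one_mem_mixThree_iff, ← hker, LinearMap.mem_ker, AlgHom.toLinearMap_apply, map_sub,
      map_one, sub_eq_zero]
    rfl

theorem isTruncated_of_surjective (π : MonoidAlgebra (ZMod p) G →ₐ[ZMod p] S)
    (hker : LinearMap.ker π.toLinearMap = mixThree I J) :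
    IsTruncated ((I).map π.toLinearMap) ((J).map π.toLinearMap) where
  mul_le := by rw [← Submodule.map_mul]; exact Submodule.map_mono (augKer_mul_self_le _)
  mixTwo_le := by
    rw [← map_mixTwo]
    exact Submodule.map_mono (sup_le ((mul_le_mul_left le_top _).trans top_mul_commSpan)
      ((mul_le_mul_right le_top _).trans commSpan_mul_top))
  le_sq := by rw [← Submodule.map_mul]; exact Submodule.map_mono (commSpan_le_augKer_sq _)
  comm_mem := by
    rintro _ ⟨x, hx, rfl⟩ _ ⟨y, hy, rfl⟩
    exact ⟨_, comm_mem_commSpan x y, by simp⟩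
  three := by
    rw [← map_mixThree, ← hker, eq_bot_iff, Submodule.map_le_iff_le_comap]
    exact fun x hx => hx

end GroupAlgebra

/-! ### Commutator calculus in a truncated ring -/

namespace IsTruncated

variable {F S : Type*} [Field F] [Ring S] [Algebra F S] {I J : Submodule F S}
  (hT : IsTruncated I J)

include hT

theorem sq_mul_eq_zero {a z : S} (ha : a ∈ I * I) (hz : z ∈ J) : a * z = 0 := by
  have h : a * z ∈ mixThree I J :=
    (le_sup_left.trans le_sup_left : I * I * J ≤ mixThree I J) <| Submodule.mul_mem_mul ha hz
  rwa [hT.three, Submodule.mem_bot] at h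

theorem mul_sq_eq_zero {a z : S} (ha : a ∈ I * I) (hz : z ∈ J) : z * a = 0 := by
  have h : z * a ∈ mixThree I J := by
    have : z * a ∈ J * (I * I) := Submodule.mul_mem_mul hz ha
    rw [← mul_assoc] at this
    exact Submodule.mem_sup_right this
  rwa [hT.three, Submodule.mem_bot] at h

theorem mul_mul_eq_zero {x y z : S} (hx : x ∈ I) (hz : z ∈ J) (hy : y ∈ I) : x * z * y = 0 := by
  have h : x * z * y ∈ mixThree I J :=
    (le_sup_right.trans le_sup_left : I * J * I ≤ mixThree I J) <|
      Submodule.mul_mem_mul (Submodule.mul_mem_mul hx hz) hy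
  rwa [hT.three, Submodule.mem_bot] at h

theorem mul_mixTwo_eq_zero {x k : S} (hx : x ∈ I) (hk : k ∈ mixTwo I J) : x * k = 0 := by
  have h : x * k ∈ mixThree I J := by
    have : x * k ∈ I * mixTwo I J := Submodule.mul_mem_mul hx hk
    rw [mixTwo, Submodule.mul_sup, ← mul_assoc, ← mul_assoc] at this
    exact (le_sup_left : _ ≤ mixThree I J) this
  rwa [hT.three, Submodule.mem_bot] at h

theorem mixTwo_mul_eq_zero {x k : S} (hx : x ∈ I) (hk : k ∈ mixTwo I J) : k * x = 0 := by
  have h : k * x ∈ mixThree I J := by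
    have : k * x ∈ mixTwo I J * I := Submodule.mul_mem_mul hk hx
    rw [mixTwo, Submodule.sup_mul] at this
    exact (sup_le (le_sup_right.trans le_sup_left) le_sup_right :
      I * J * I ⊔ J * I * I ≤ mixThree I J) this
  rwa [hT.three, Submodule.mem_bot] at h

theorem sq_comm_mem {a x : S} (ha : a ∈ I * I) (hx : x ∈ I) : a * x - x * a ∈ mixTwo I J := by
  induction ha using Submodule.mul_induction_on' with
  | mem_mul_mem b hb c hc =>
    have h : b * c * x - x * (b * c) = b * (c * x - x * c) + (b * x - x * b) * c := by
      noncomm_ring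
    rw [h]
    exact add_mem (Submodule.mem_sup_left (Submodule.mul_mem_mul hb (hT.comm_mem c hc x hx)))
      (Submodule.mem_sup_right (Submodule.mul_mem_mul (hT.comm_mem b hb x hx) hc))
  | add b _ c _ hb hc =>
    have h : (b + c) * x - x * (b + c) = (b * x - x * b) + (c * x - x * c) := by noncomm_ring
    rw [h]; exact add_mem hb hc

/-- Write `b` as a sum of products `c d` and expand `[a, cd] = [a, c] d + c [a, d]`. The inner
commutators lie in `mixTwo I J`, which `I` annihilates on both sides. -/
theorem commute_of_mem_sq {a b : S} (ha : a ∈ I * I) (hb : b ∈ I * I) : Commute a b := by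
  induction hb using Submodule.mul_induction_on' with
  | mem_mul_mem c hc d hd =>
    have h : a * (c * d) - c * d * a = (a * c - c * a) * d + c * (a * d - d * a) := by
      noncomm_ring
    rw [hT.mixTwo_mul_eq_zero hd (hT.sq_comm_mem ha hc),
      hT.mul_mixTwo_eq_zero hc (hT.sq_comm_mem ha hd), add_zero] at h
    exact sub_eq_zero.1 h
  | add c _ d _ hc hd => exact hc.add_right hd

/-- Replacing elements by congruent ones does not change a commutator with an element of `J`. -/
theorem comm_eq_of_sub_mem {z z' x x' : S} (hz : z ∈ J) (hzz' : z - z' ∈ mixTwo I J)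
    (hx' : x' ∈ I) (hxx' : x - x' ∈ I * I) : z * x - x * z = z' * x' - x' * z' := by
  have h : z * x - x * z - (z' * x' - x' * z')
      = z * (x - x') - (x - x') * z + ((z - z') * x' - x' * (z - z')) := by noncomm_ring
  rw [hT.mul_sq_eq_zero hxx' hz, hT.sq_mul_eq_zero hxx' hz, hT.mixTwo_mul_eq_zero hx' hzz',
    hT.mul_mixTwo_eq_zero hx' hzz', sub_zero, add_zero] at h
  exact sub_eq_zero.1 h

theorem comm_sub_comm_mem {x x' y y' : S} (hx : x ∈ I) (hy' : y' ∈ I)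
    (hxx' : x - x' ∈ I * I) (hyy' : y - y' ∈ I * I) :
    x * y - y * x - (x' * y' - y' * x') ∈ mixTwo I J := by
  have h : x * y - y * x - (x' * y' - y' * x')
      = ((x - x') * y' - y' * (x - x')) - ((y - y') * x - x * (y - y')) := by noncomm_ring
  rw [h]
  exact sub_mem (hT.sq_comm_mem hxx' hy') (hT.sq_comm_mem hyy' hx)

/-- Each reordering creates a commutator in `J` standing between two factors from `I`, and `I * J *
I` is zero. -/
theorem mul_pow_eq {x y : S} (hx : x ∈ I) (hy : y ∈ I) (n : ℕ) :
    (x * y) ^ n = x ^ n * y ^ n := by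
  have hpow : ∀ {z : S}, z ∈ I → ∀ n, z ^ (n + 1) ∈ I := by
    intro z hz n
    induction n with
    | zero => simpa using hz
    | succ n ih => rw [pow_succ]; exact hT.mul_le (Submodule.mul_mem_mul ih hz)
  induction n with
  | zero => simp
  | succ n ih =>
    rw [pow_succ, ih]
    cases n with
    | zero => simp
    | succ n =>
      have h : x ^ (n + 1) * y ^ (n + 1) * (x * y) = x ^ (n + 1) * x * (y ^ (n + 1) * y)
          + x ^ (n + 1) * (y ^ (n + 1) * x - x * y ^ (n + 1)) * y := by noncomm_ring
      rw [h, hT.mul_mul_eq_zero (hpow hx n) (hT.comm_mem _ (hpow hy n) _ hx) hy, add_zero,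
        ← pow_succ, ← pow_succ]

end IsTruncated

theorem map_commutator_sub_one {S : Type*} [Ring S] {G : Type*} [Group G] (u : G →* S) (a b : G) :
    u ⁅a, b⁆ - 1 = ((u a - 1) * (u b - 1) - (u b - 1) * (u a - 1)) * u (a⁻¹ * b⁻¹) := by
  have h : (u a - 1) * (u b - 1) - (u b - 1) * (u a - 1) = u (a * b) - u (b * a) := by
    rw [map_mul, map_mul]; noncomm_ring
  rw [h, sub_mul, ← map_mul, ← map_mul, ← map_one u]
  congr 2 <;> group

/-! ### Group commutators against ring commutators -/

namespace IsGroupBasis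

variable {p : ℕ} [Fact p.Prime] {S : Type*} [Ring S] [Algebra (ZMod p) S]
  {I J : Submodule (ZMod p) S} {G : Type*} [Group G] {u : G →* S}
  (hT : IsTruncated I J) (hu : IsGroupBasis p I J u)

include hT hu

theorem mul_mixTwo (g : G) {k : S} (hk : k ∈ mixTwo I J) : u g * k = k := by
  have h := hT.mul_mixTwo_eq_zero (hu.sub_one_mem g) hk
  rwa [sub_mul, one_mul, sub_eq_zero] at h

theorem mixTwo_mul (g : G) {k : S} (hk : k ∈ mixTwo I J) : k * u g = k := by
  have h := hT.mixTwo_mul_eq_zero (hu.sub_one_mem g) hk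
  rwa [mul_sub, mul_one, sub_eq_zero] at h

omit hT in
theorem commute_all {x : S} (h : ∀ g, Commute x (u g)) (y : S) : Commute x y := by
  have hy : y ∈ Submodule.span (ZMod p) (Set.range u) := by rw [hu.span_range]; trivial
  induction hy using Submodule.span_induction with
  | mem y hy => obtain ⟨g, rfl⟩ := hy; exact h g
  | zero => exact Commute.zero_right _
  | add y z _ _ hy hz => exact hy.add_right hz
  | smul c y _ hy => exact hy.smul_right c

theorem commute_of_mem_mixTwo {k : S} (hk : k ∈ mixTwo I J) (y : S) : Commute k y :=
  commute_all hu (fun g => by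
    rw [commute_iff_eq, mixTwo_mul hT hu g hk, mul_mixTwo hT hu g hk]) y

/-- In general the two sides differ by a unit factor; group elements act trivially on `mixTwo I J`,
so that factor disappears. -/
theorem commutator_sub_one_eq {a b : G}
    (h : (u a - 1) * (u b - 1) - (u b - 1) * (u a - 1) ∈ mixTwo I J) :
    u ⁅a, b⁆ - 1 = (u a - 1) * (u b - 1) - (u b - 1) * (u a - 1) := by
  rw [map_commutator_sub_one, mixTwo_mul hT hu _ h]

theorem commutator_sub_one_sub_mem (a b : G) :
    u ⁅a, b⁆ - 1 - ((u a - 1) * (u b - 1) - (u b - 1) * (u a - 1)) ∈ mixTwo I J := by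
  have h : u ⁅a, b⁆ - 1 - ((u a - 1) * (u b - 1) - (u b - 1) * (u a - 1))
      = ((u a - 1) * (u b - 1) - (u b - 1) * (u a - 1)) * (u (a⁻¹ * b⁻¹) - 1) := by
    rw [map_commutator_sub_one]; noncomm_ring
  rw [h]
  exact Submodule.mem_sup_right (Submodule.mul_mem_mul
    (hT.comm_mem _ (hu.sub_one_mem a) _ (hu.sub_one_mem b)) (hu.sub_one_mem _))

theorem comm_two_mem {n : G} (hn : n ∈ lcsTerm G 2) (g : G) :
    (u n - 1) * (u g - 1) - (u g - 1) * (u n - 1) ∈ mixTwo I J :=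
  hT.sq_comm_mem (hT.le_sq (hu.two_mem n hn)) (hu.sub_one_mem g)

variable {H : Type*} [Group H] {v : H →* S} (hv : IsGroupBasis p I J v)

include hv

/-- Here the comparison of the two groups becomes exact: the errors in `n` and `h` only contribute
products that vanish in the truncated ring. -/
theorem commutator_eq_of_two {n : H} {m : G} {h : H} {g : G} (hn : n ∈ lcsTerm H 2)
    (hm : m ∈ lcsTerm G 2) (hnm : v n - u m ∈ mixTwo I J) (hhg : v h - u g ∈ I * I) :
    v ⁅n, h⁆ = u ⁅m, g⁆ := by
  have h1 := commutator_sub_one_eq hT hv (comm_two_mem hT hv hn h)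
  have h2 := commutator_sub_one_eq hT hu (comm_two_mem hT hu hm g)
  have h3 := hT.comm_eq_of_sub_mem (z := v n - 1) (z' := u m - 1) (x := v h - 1) (x' := u g - 1)
    (hv.two_mem n hn) (by rwa [sub_sub_sub_cancel_right]) (hu.sub_one_mem g)
    (by rwa [sub_sub_sub_cancel_right])
  exact sub_left_injective (h1.trans (h3.trans h2.symm))

theorem commutator_sub_mem {h h' : H} {g g' : G} (h1 : v h - u g ∈ I * I)
    (h2 : v h' - u g' ∈ I * I) : v ⁅h, h'⁆ - u ⁅g, g'⁆ ∈ mixTwo I J := by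
  have e1 := commutator_sub_one_sub_mem hT hv h h'
  have e2 := commutator_sub_one_sub_mem hT hu g g'
  have e3 := hT.comm_sub_comm_mem (x := v h - 1) (x' := u g - 1) (y := v h' - 1) (y' := u g' - 1)
    (hv.sub_one_mem h) (hu.sub_one_mem g') (by rwa [sub_sub_sub_cancel_right])
    (by rwa [sub_sub_sub_cancel_right])
  have e := add_mem (sub_mem e1 e2) e3
  convert e using 1
  abel

end IsGroupBasis

/-! ### Comparison of p-power maps -/

section Power

variable {p : ℕ} [Fact p.Prime] {S : Type*} [Ring S] [Algebra (ZMod p) S]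
  {I J : Submodule (ZMod p) S} {G : Type*} [Group G] {u : G →* S}

/-- Reordering `(a y)^n` takes `n.choose 2` swaps, each adding one copy of `k`. For odd p and `n = p
^ e` with `e ≠ 0` this multiple vanishes, which is where parity enters the comparison of powers. -/
theorem mul_pow_of_mul_eq {S : Type*} [Ring S] {a y k : S} (hak : a * k = k) (hka : k * a = k)
    (hyk : y * k = k) (hky : k * y = k) (hya : y * a = a * y + k) (n : ℕ) :
    (a * y) ^ n = a ^ n * y ^ n + (n.choose 2 : ℕ) • k := by
  have hank : ∀ n, a ^ n * k = k := fun n => by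
    induction n with
    | zero => simp
    | succ n ih => rw [pow_succ, mul_assoc, hak, ih]
  have hyn : ∀ n, y ^ n * a = a * y ^ n + n • k := fun n => by
    induction n with
    | zero => simp
    | succ n ih =>
      have hyk' : y ^ n * k = k := by
        clear ih
        induction n with
        | zero => simp
        | succ n ih => rw [pow_succ, mul_assoc, hyk, ih]
      rw [pow_succ, mul_assoc, hya, mul_add, ← mul_assoc, ih, add_mul, smul_mul_assoc, hky, hyk',
        mul_assoc, add_assoc, succ_nsmul]
  induction n with
  | zero => simp
  | succ n ih =>
    have h1 : a ^ n * y ^ n * (a * y) = a ^ (n + 1) * y ^ (n + 1) + n • k := by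
      rw [← mul_assoc, mul_assoc (a ^ n), hyn, mul_add, add_mul, ← mul_assoc (a ^ n), ← pow_succ,
        mul_assoc _ _ y, ← pow_succ, mul_smul_comm, hank, smul_mul_assoc, hky]
    have h2 : k * (a * y) = k := by rw [← mul_assoc, hka, hky]
    rw [pow_succ, ih, add_mul, h1, smul_mul_assoc, h2, Nat.choose_succ_succ' n 1,
      Nat.choose_one_right, add_assoc, ← add_smul]

theorem dvd_choose_two (hodd : p ≠ 2) (e : ℕ) (he : e ≠ 0) : p ∣ (p ^ e).choose 2 := by
  have hp : p.Prime := Fact.out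
  have h1 : (p ^ e).choose 2 * 2 = p ^ e * (p ^ e - 1) := by
    rw [Nat.choose_two_right]
    exact Nat.div_mul_cancel (Nat.even_mul_pred_self _).two_dvd
  have h2 : p ∣ (p ^ e).choose 2 * 2 := by
    rw [h1]; exact (dvd_pow_self p he).mul_right _
  refine (Nat.Coprime.dvd_of_dvd_mul_right ?_ h2)
  exact (Nat.coprime_primes hp Nat.prime_two).2 hodd

variable (hT : IsTruncated I J) (hu : IsGroupBasis p I J u)

include hT hu

theorem mul_pow_of_sub_one_mem_sq (hodd : p ≠ 2) (g : G) {y : S} (hy : y - 1 ∈ I * I)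
    (e : ℕ) (he : e ≠ 0) : (u g * y) ^ p ^ e = u g ^ p ^ e * y ^ p ^ e := by
  set k := y * u g - u g * y
  have hk : k ∈ mixTwo I J := by
    have h : k = (y - 1) * (u g - 1) - (u g - 1) * (y - 1) := by simp only [k]; noncomm_ring
    rw [h]
    exact hT.sq_comm_mem hy (hu.sub_one_mem g)
  have hyk : y * k = k := by
    have h := hT.mul_mixTwo_eq_zero (hT.mul_le hy) hk
    rwa [sub_mul, one_mul, sub_eq_zero] at h
  have hky : k * y = k := by
    have h := hT.mixTwo_mul_eq_zero (hT.mul_le hy) hk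
    rwa [mul_sub, mul_one, sub_eq_zero] at h
  rw [mul_pow_of_mul_eq (k := k) (hu.mul_mixTwo hT g hk) (hu.mixTwo_mul hT g hk) hyk hky
    (by simp [k])]
  obtain ⟨c, hc⟩ := dvd_choose_two hodd e he
  rw [hc, mul_smul, ← Nat.cast_smul_eq_nsmul (ZMod p) p, ZMod.natCast_self, zero_smul, add_zero]

/-- For a generator, `((b - 1)(g - 1))^q = (b^q - 1)(g^q - 1)`, and its first factor lies in `mixTwo
I J`, so the product is zero. Elements of `J` square to zero. The `q`-th power is additive on `I *
I`, which is commutative of characteristic p. -/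
theorem pow_eq_zero_of_mem {B : Set G} {q : ℕ} {e : ℕ} (hq : q = p ^ e)
    (hB : ∀ b ∈ B, b ^ q ∈ gammaTwoPowMul G p 3) (he : e ≠ 0) {w : S}
    (hw : w ∈ deltaSpan p u B * I ⊔ J) : w ^ q = 0 := by
  subst hq
  have hp : p.Prime := Fact.out
  have hadd : ∀ x ∈ I * I, ∀ y ∈ I * I, x ^ p ^ e = 0 → y ^ p ^ e = 0 → (x + y) ^ p ^ e = 0 := by
    intro x hx y hy h1 h2
    rcases subsingleton_or_nontrivial S with hS | hS
    · exact Subsingleton.elim _ _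
    have : CharP S p := charP_of_injective_algebraMap' (ZMod p) p
    rw [add_pow_char_pow_of_commute p e (hT.commute_of_mem_sq hx hy), h1, h2, add_zero]
  have hJ : ∀ z ∈ J, z ^ p ^ e = 0 := by
    intro z hz
    obtain ⟨k, hk⟩ := Nat.exists_eq_add_of_le (hp.two_le.trans (Nat.le_self_pow he p))
    rw [hk, pow_add, sq, hT.sq_mul_eq_zero (hT.le_sq hz) hz, zero_mul]
  have hBI : deltaSpan p u B ≤ I := deltaSpan_le.2 fun g _ => hu.sub_one_mem g
  have hprod : ∀ x ∈ deltaSpan p u B * I, x ∈ I * I ∧ x ^ p ^ e = 0 := by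
    intro x hx
    have hx' := mul_le_mul_right hu.le_deltaSpan (deltaSpan p u B) hx
    rw [deltaSpan, deltaSpan, Submodule.span_mul_span] at hx'
    refine ⟨mul_le_mul_left hBI I hx, ?_⟩
    clear hx
    suffices h : x ∈ I * I ∧ x ^ p ^ e = 0 from h.2
    induction hx' using Submodule.span_induction with
    | mem x hx =>
      obtain ⟨_, ⟨b, hb, rfl⟩, _, ⟨g, _, rfl⟩, rfl⟩ := hx
      refine ⟨Submodule.mul_mem_mul (hu.sub_one_mem b) (hu.sub_one_mem g), ?_⟩
      change ((u b - 1) * (u g - 1)) ^ p ^ e = 0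
      rw [hT.mul_pow_eq (hu.sub_one_mem b) (hu.sub_one_mem g)]
      rcases subsingleton_or_nontrivial S with hS | hS
      · exact Subsingleton.elim _ _
      have : CharP S p := charP_of_injective_algebraMap' (ZMod p) p
      rw [sub_pow_char_pow_of_commute p e (Commute.one_right _),
        sub_pow_char_pow_of_commute p e (Commute.one_right _), one_pow, ← map_pow, ← map_pow]
      exact hT.mixTwo_mul_eq_zero (hu.sub_one_mem _) ((hu.mem_three _).2 (hB b hb))
    | zero => exact ⟨zero_mem _, zero_pow (pow_ne_zero _ hp.ne_zero)⟩
    | add x y _ _ hx hy => exact ⟨add_mem hx.1 hy.1, hadd x hx.1 y hy.1 hx.2 hy.2⟩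
    | smul c x _ hx =>
      exact ⟨Submodule.smul_mem _ _ hx.1, by rw [smul_pow, hx.2, smul_zero]⟩
  obtain ⟨x, hx, z, hz, rfl⟩ := Submodule.mem_sup.1 hw
  exact hadd x (hprod x hx).1 z (hT.le_sq hz) (hprod x hx).2 (hJ z hz)

/-- Elements congruent modulo products `(b - 1) (x - 1)` with `b ^ q` deep in the filtration have
the same `q`-th power. -/
theorem pow_eq_of_sub_mem (hodd : p ≠ 2) {B : Set G} {e : ℕ}
    (hB : ∀ b ∈ B, b ^ p ^ e ∈ gammaTwoPowMul G p 3) (he : e ≠ 0) {s : S} {g : G}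
    (hs : s - u g ∈ deltaSpan p u B * I ⊔ J) : s ^ p ^ e = u (g ^ p ^ e) := by
  have hBI : deltaSpan p u B ≤ I := deltaSpan_le.2 fun g _ => hu.sub_one_mem g
  have hW : deltaSpan p u B * I ⊔ J ≤ I * I := sup_le (mul_le_mul_left hBI I) hT.le_sq
  -- The factor from `I` is moved past `b - 1` at the cost of a commutator in `J`. This lets `s` be
  -- written as `u g * (1 + w)` with `w` in the same subspace as `s - u g`.
  have hIW : I * (deltaSpan p u B * I ⊔ J) ≤ deltaSpan p u B * I ⊔ J := by
    rw [Submodule.mul_sup]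
    refine sup_le ?_ ((le_sup_left.trans hT.mixTwo_le).trans le_sup_right)
    rw [← mul_assoc]
    refine Submodule.mul_le.2 fun a ha z hz => ?_
    induction ha using Submodule.mul_induction_on' with
    | mem_mul_mem x hx b hb =>
      have h : x * b * z = b * (x * z) + (x * b - b * x) * z := by noncomm_ring
      rw [h]
      refine add_mem (Submodule.mem_sup_left (Submodule.mul_mem_mul hb
        (hT.mul_le (Submodule.mul_mem_mul hx hz)))) (Submodule.mem_sup_right (hT.mixTwo_le
          (Submodule.mem_sup_right (Submodule.mul_mem_mul (hT.comm_mem x hx b (hBI hb)) hz))))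
    | add x _ y _ hx hy => rw [add_mul]; exact add_mem hx hy
  set w := u g⁻¹ * (s - u g)
  have hw : w ∈ deltaSpan p u B * I ⊔ J := by
    have h : w = (u g⁻¹ - 1) * (s - u g) + (s - u g) := by simp only [w]; noncomm_ring
    rw [h]
    exact add_mem (hIW (Submodule.mul_mem_mul (hu.sub_one_mem _) hs)) hs
  have hsw : s = u g * (1 + w) := by
    simp only [w]
    rw [mul_add, ← mul_assoc, ← map_mul, mul_inv_cancel, map_one, one_mul, mul_one]; abel
  rw [hsw, mul_pow_of_sub_one_mem_sq hT hu hodd g (by simpa using hW hw) e he, map_pow]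
  rcases subsingleton_or_nontrivial S with hS | hS
  · exact Subsingleton.elim _ _
  have : CharP S p := charP_of_injective_algebraMap' (ZMod p) p
  rw [add_pow_char_pow_of_commute p e (Commute.one_left _), one_pow,
    pow_eq_zero_of_mem hT hu rfl hB he hw, add_zero, mul_one]

end Power

/-! ### Roots modulo the commutator ideal, and derivations -/

section GroupAlgebra

variable {p : ℕ} [Fact p.Prime] {G : Type*} [Group G]

local notation "I" => augKer (augmentation p G)
local notation "J" => commSpan (ZMod p) (MonoidAlgebra (ZMod p) G)

/-- Frobenius is additive on this commutative algebra of characteristic p and fixes coefficients in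
the prime field. -/
theorem pow_eq_mapDomain {V : Type*} [CommGroup V] (e : ℕ) (y : MonoidAlgebra (ZMod p) V) :
    y ^ p ^ e = MonoidAlgebra.mapDomainAlgHom (ZMod p) (ZMod p) (powMonoidHom (p ^ e)) y := by
  have hp : p.Prime := Fact.out
  have : CharP (MonoidAlgebra (ZMod p) V) p := charP_of_injective_algebraMap' (ZMod p) p
  induction y using MonoidAlgebra.induction_linear with
  | zero => rw [map_zero, zero_pow (pow_ne_zero _ hp.ne_zero)]
  | add x y hx hy => rw [add_pow_char_pow, hx, hy, map_add]
  | single g c =>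
    rw [MonoidAlgebra.single_pow, ZMod.pow_card_pow]
    simp

/-- Modulo `J` the `p ^ e`-th power is the algebra map induced by powering in the abelianization. So
`x` lies in the kernel of the map induced by `θ`, which is generated by `b - 1` with `b` in the
kernel of `θ`. -/
theorem exists_pow_mem_sub_mem (e : ℕ) (x : MonoidAlgebra (ZMod p) G) (hx : x ^ p ^ e ∈ J) :
    ∃ b ∈ {b : G | b ^ p ^ e ∈ lcsTerm G 2}, x - (toAlg p G b - 1) ∈
      deltaSpan p (toAlg p G) {b : G | b ^ p ^ e ∈ lcsTerm G 2} * I := by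
  let θ : G →* Abelianization G := (powMonoidHom (p ^ e)).comp Abelianization.of
  have hker : (Abelianization.of (G := G)).ker = lcsTerm G 2 := by
    rw [Abelianization.ker_of, lcsTerm_two_eq]
  have hθ : (θ.ker : Set G) = {b : G | b ^ p ^ e ∈ lcsTerm G 2} := by
    ext b
    rw [SetLike.mem_coe, MonoidHom.mem_ker, Set.mem_ofPred_eq, ← hker, MonoidHom.mem_ker, map_pow]
    rfl
  have hx' : MonoidAlgebra.mapDomainAlgHom (ZMod p) (ZMod p) θ x = 0 := by
    have h1 := pow_eq_mapDomain e
      (MonoidAlgebra.mapDomainAlgHom (ZMod p) (ZMod p) (Abelianization.of (G := G)) x)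
    rw [← map_pow, ← AlgHom.comp_apply, ← MonoidAlgebra.mapDomainAlgHom_comp] at h1
    rw [← h1, mapDomain_eq_zero_iff, hker, ← commSpan_eq_deltaSpan]
    exact hx
  rw [mapDomain_eq_zero_iff] at hx'
  rw [← hθ]
  obtain ⟨y, hy, z, hz, rfl⟩ := Submodule.mem_sup.1 (deltaSpan_mul_top _ hx')
  obtain ⟨b, hb, hk⟩ := exists_mem_subgroup_sub_mem _ hy
  refine ⟨b, hb, ?_⟩
  have h : y + z - (toAlg p G b - 1) = (y - (toAlg p G b - 1)) + z := by abel
  rw [h]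
  exact add_mem (mul_le_mul_right (deltaSpan_le_augKer _) _ hk) hz

/-- The quotient by `J` is the group algebra of the abelianization; so isomorphic group algebras
give abelianizations of equal order. -/
theorem card_abelianization_eq [Finite G] :
    Nat.card (G ⧸ lcsTerm G 2) + Module.finrank (ZMod p) J
      = Module.finrank (ZMod p) (MonoidAlgebra (ZMod p) G) := by
  have hfin : Module.Finite (ZMod p) (MonoidAlgebra (ZMod p) G) :=
    Module.Finite.of_basis (MonoidAlgebra.basis G (ZMod p))
  let f := MonoidAlgebra.mapDomainAlgHom (ZMod p) (ZMod p) (QuotientGroup.mk' (lcsTerm G 2))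
  have hf : Function.Surjective f := by
    intro y
    refine mem_of_toAlg_mem (N := LinearMap.range f.toLinearMap) (fun g => ?_) y
    obtain ⟨g, rfl⟩ := QuotientGroup.mk'_surjective _ g
    exact ⟨toAlg p G g, by simp [f, MonoidAlgebra.of_apply]⟩
  have hker : LinearMap.ker f.toLinearMap = J := by
    ext x
    have h := mapDomain_eq_zero_iff (p := p) (QuotientGroup.mk' (lcsTerm G 2)) x
    rw [QuotientGroup.ker_mk'] at h
    rw [commSpan_eq_deltaSpan, ← h]
    rfl
  have h := LinearMap.finrank_range_add_finrank_ker f.toLinearMap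
  rw [hker, LinearMap.range_eq_top.2 hf, finrank_top,
    Module.finrank_eq_nat_card_basis (MonoidAlgebra.basis (G ⧸ lcsTerm G 2) (ZMod p))] at h
  exact h

/-- The derivation of the group algebra attached to a homomorphism `χ : G → ZMod p`. -/
theorem exists_derivation (χ : G →* Multiplicative (ZMod p)) :
    ∃ D : MonoidAlgebra (ZMod p) G →ₗ[ZMod p] MonoidAlgebra (ZMod p) G,
      (∀ g, D (toAlg p G g) = (χ g).toAdd • toAlg p G g) ∧
      ∀ x y, D (x * y) = D x * y + x * D y := by
  let D : MonoidAlgebra (ZMod p) G →ₗ[ZMod p] MonoidAlgebra (ZMod p) G :=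
    (MonoidAlgebra.basis G (ZMod p)).constr (ZMod p) (fun g => (χ g).toAdd • toAlg p G g)
  have hD : ∀ g, D (toAlg p G g) = (χ g).toAdd • toAlg p G g := fun g => by
    have := (MonoidAlgebra.basis G (ZMod p)).constr_basis (ZMod p)
      (fun g => (χ g).toAdd • toAlg p G g) g
    simpa [D, MonoidAlgebra.of_apply] using this
  refine ⟨D, hD, fun x y => ?_⟩
  refine linearMap_eq_of_toAlg (f := D.comp (LinearMap.mulRight (ZMod p) y))
    (g := (LinearMap.mulRight (ZMod p) y).comp D + LinearMap.mulRight (ZMod p) (D y)) (fun g => ?_) x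
  refine linearMap_eq_of_toAlg (f := D.comp (LinearMap.mulLeft (ZMod p) (toAlg p G g)))
    (g := LinearMap.mulLeft (ZMod p) (D (toAlg p G g))
      + (LinearMap.mulLeft (ZMod p) (toAlg p G g)).comp D) (fun h => ?_) y
  simp only [LinearMap.comp_apply, LinearMap.add_apply, LinearMap.mulLeft_apply, hD]
  rw [← map_mul, hD, map_mul χ, toAdd_mul, map_mul, add_smul, smul_mul_assoc, mul_smul_comm]

section Derivation

variable {χ : G →* Multiplicative (ZMod p)}
  {D : MonoidAlgebra (ZMod p) G →ₗ[ZMod p] MonoidAlgebra (ZMod p) G}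
  (hD : ∀ g, D (toAlg p G g) = (χ g).toAdd • toAlg p G g)
  (hmul : ∀ x y, D (x * y) = D x * y + x * D y)

include hmul

theorem derivation_one : D 1 = 0 := by
  have h := hmul 1 1
  simpa using h

theorem derivation_mul_mem {X Y Z : Submodule (ZMod p) (MonoidAlgebra (ZMod p) G)}
    (hX : ∀ x ∈ X, ∀ y ∈ Y, D x * y ∈ Z) (hY : ∀ x ∈ X, ∀ y ∈ Y, x * D y ∈ Z) :
    ∀ w ∈ X * Y, D w ∈ Z := by
  intro w hw
  induction hw using Submodule.mul_induction_on' with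
  | mem_mul_mem x hx y hy => rw [hmul]; exact add_mem (hX x hx y hy) (hY x hx y hy)
  | add x _ y _ hx hy => rw [map_add]; exact add_mem hx hy

theorem derivation_sq_mem : ∀ w ∈ I * I, D w ∈ I :=
  derivation_mul_mem hmul
    (fun _ _ _ hy => top_mul_augKer _ (Submodule.mul_mem_mul trivial hy))
    (fun _ hx _ _ => augKer_mul_top _ (Submodule.mul_mem_mul hx trivial))

theorem derivation_cube_mem : ∀ w ∈ I * I * I, D w ∈ I * I :=
  derivation_mul_mem hmul
    (fun x hx _ hy => Submodule.mul_mem_mul (derivation_sq_mem hmul x hx) hy)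
    (fun x hx y _ => by
      have h : x * D y ∈ I * I * ⊤ := Submodule.mul_mem_mul hx trivial
      rw [mul_assoc] at h
      exact mul_le_mul_right (augKer_mul_top _) _ h)

include hD

theorem derivation_deltaSpan_two_mem :
    ∀ x ∈ deltaSpan p (toAlg p G) (lcsTerm G 2 : Set G), D x = 0 := by
  have h : deltaSpan p (toAlg p G) (lcsTerm G 2 : Set G) ≤ LinearMap.ker D := by
    rw [deltaSpan_le]
    intro n hn
    have hn' : n ∈ χ.ker := by
      rw [lcsTerm_two_eq] at hn; exact Abelianization.commutator_subset_ker χ hn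
    rw [LinearMap.mem_ker, map_sub, hD, derivation_one hmul, MonoidHom.mem_ker.1 hn', toAdd_one,
      zero_smul, sub_zero]
  exact fun x hx => h hx

theorem derivation_commSpan_mem : ∀ x ∈ J, D x ∈ J := by
  rw [commSpan_eq_deltaSpan]
  exact derivation_mul_mem hmul
    (fun x hx y _ => by
      rw [derivation_deltaSpan_two_mem hD hmul x hx, zero_mul]; exact zero_mem _)
    (fun x hx y _ => Submodule.mul_mem_mul hx trivial)

/-- `D` preserves `J`, since characters are trivial on `γ_2(G)`. By the Leibniz rule a product of
two factors from `I` and one from `J` thus loses at most one factor from `I`. -/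
theorem derivation_mixThree_mem : ∀ x ∈ mixThree I J, D x ∈ mixTwo I J := by
  have hJ := derivation_commSpan_mem hD hmul
  have hIJ : I * J ≤ J := (mul_le_mul_left le_top _).trans top_mul_commSpan
  have hJI : J * I ≤ J := (mul_le_mul_right le_top _).trans commSpan_mul_top
  have h : mixThree I J ≤ (mixTwo I J).comap D := by
    refine sup_le (sup_le ?_ ?_) ?_
    · exact derivation_mul_mem hmul
        (fun x hx y hy => Submodule.mem_sup_left
          (Submodule.mul_mem_mul (derivation_sq_mem hmul x hx) hy))
        (fun x hx y hy => Submodule.mem_sup_left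
          (Submodule.mul_mem_mul (augKer_mul_self_le _ hx) (hJ y hy)))
    · exact derivation_mul_mem hmul
        (fun x hx y hy => Submodule.mem_sup_right (Submodule.mul_mem_mul (hJ x (hIJ hx)) hy))
        (fun x hx y hy => Submodule.mem_sup_left (by
          have h : x * D y ∈ I * J * ⊤ := Submodule.mul_mem_mul hx trivial
          rw [mul_assoc] at h
          exact mul_le_mul_right commSpan_mul_top _ h))
    · exact derivation_mul_mem hmul
        (fun x hx y hy => Submodule.mem_sup_right (Submodule.mul_mem_mul (hJ x (hJI hx)) hy))
        (fun x hx y hy => Submodule.mem_sup_right (by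
          have h : x * D y ∈ J * I * ⊤ := Submodule.mul_mem_mul hx trivial
          rw [mul_assoc] at h
          exact mul_le_mul_right (augKer_mul_top _) _ h))
  exact fun x hx => h hx

end Derivation

/-- The homomorphism `g ↦ l (g - 1)` attached to a linear functional `l` that vanishes on the
square of the augmentation ideal. -/
noncomputable def homOfFunctional (l : MonoidAlgebra (ZMod p) G →ₗ[ZMod p] ZMod p)
    (hl : ∀ x ∈ I * I, l x = 0) : G →* Multiplicative (ZMod p) :=
    MonoidHom.mk' (fun g => Multiplicative.ofAdd (l (toAlg p G g - 1))) (fun g h => by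
      have e : toAlg p G (g * h) - 1 = (toAlg p G g - 1) * (toAlg p G h - 1)
          + (toAlg p G g - 1) + (toAlg p G h - 1) := by rw [map_mul]; noncomm_ring
      rw [e, map_add l, map_add l,
        hl _ (Submodule.mul_mem_mul (toAlg_sub_one_mem g) (toAlg_sub_one_mem h)), zero_add,
        ofAdd_add])

/-- The derivation attached to a linear functional `l` that vanishes on the square of the
augmentation ideal. -/
theorem exists_derivation_of_functional (l : MonoidAlgebra (ZMod p) G →ₗ[ZMod p] ZMod p)
    (hl : ∀ x ∈ I * I, l x = 0) :
    ∃ (χ : G →* Multiplicative (ZMod p))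
      (D : MonoidAlgebra (ZMod p) G →ₗ[ZMod p] MonoidAlgebra (ZMod p) G),
      (∀ g, D (toAlg p G g) = (χ g).toAdd • toAlg p G g) ∧
      (∀ x y, D (x * y) = D x * y + x * D y) ∧
      ∀ a ∈ I, ∀ b ∈ I, D (a * b) - (l a • b + l b • a) ∈ I * I := by
  obtain ⟨D, hD, hmul⟩ := exists_derivation (homOfFunctional l hl)
  refine ⟨homOfFunctional l hl, D, hD, hmul, ?_⟩
  have hε : ∀ a ∈ I, augmentation p G (D a) = l a := by
    have h : I ≤ LinearMap.eqLocus ((augmentation p G).toLinearMap.comp D) l := by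
      rw [augKer_augmentation, deltaSpan_le]
      intro g _
      rw [LinearMap.mem_eqLocus, LinearMap.comp_apply, map_sub D, derivation_one hmul, hD, sub_zero,
        AlgHom.toLinearMap_apply, map_smul, augmentation_toAlg, smul_eq_mul, mul_one]
      rfl
    exact fun a ha => h ha
  have hsub : ∀ a ∈ I, D a - algebraMap (ZMod p) _ (l a) ∈ I := fun a ha => by
    rw [mem_augKer, map_sub, hε a ha, AlgHom.commutes]; simp
  intro a ha b hb
  have e : D (a * b) - (l a • b + l b • a) = (D a - algebraMap (ZMod p) _ (l a)) * b
      + a * (D b - algebraMap (ZMod p) _ (l b)) := by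
    rw [hmul, sub_mul, mul_sub, ← Algebra.smul_def, ← Algebra.commutes, ← Algebra.smul_def]; abel
  rw [e]
  exact add_mem (Submodule.mul_mem_mul (hsub a ha) hb) (Submodule.mul_mem_mul ha (hsub b hb))

end GroupAlgebra

/-! ### Orders of filtration layers -/

section Counting

variable {p : ℕ} [Fact p.Prime] {R G : Type*} [Ring R] [Algebra (ZMod p) R] [Group G]

/-- The order of a layer of an ideal filtration induced by a layer of a group filtration. -/
theorem card_map_mkQ_eq_relIndex {J K : Submodule (ZMod p) R} (u : G →* R) {N₂ N₃ : Subgroup G}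
    (h₁ : ∀ n ∈ N₂, u n - 1 ∈ J) (h₂ : ∀ x ∈ J, ∃ n ∈ N₂, x - (u n - 1) ∈ K)
    (h₃ : ∀ n ∈ N₂, u n - 1 ∈ K ↔ n ∈ N₃) (hJ : J * J ≤ K) :
    Nat.card (J.map K.mkQ) = N₃.relIndex N₂ := by
  let f : N₂ →* Multiplicative (R ⧸ K) :=
    MonoidHom.mk' (fun n => Multiplicative.ofAdd (K.mkQ (u n - 1))) (fun a b => by
      rw [← ofAdd_add, ← map_add]
      congr 1
      rw [Submodule.mkQ_apply, Submodule.mkQ_apply, Submodule.Quotient.eq]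
      have h : u ((a * b : N₂) : G) - 1 - (u a - 1 + (u b - 1)) = (u a - 1) * (u b - 1) := by
        rw [Subgroup.coe_mul, map_mul]; noncomm_ring
      rw [h]
      exact hJ (Submodule.mul_mem_mul (h₁ a a.2) (h₁ b b.2)))
  have hf : ∀ n : N₂, f n = Multiplicative.ofAdd (K.mkQ (u n - 1)) := fun _ => rfl
  have hker : f.ker = N₃.subgroupOf N₂ := by
    ext n
    rw [MonoidHom.mem_ker, hf, ← ofAdd_zero, EmbeddingLike.apply_eq_iff_eq, Submodule.mkQ_apply,
      Submodule.Quotient.mk_eq_zero, h₃ n n.2]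
    rfl
  have hrange : (f.range : Set (Multiplicative (R ⧸ K)))
      = Multiplicative.toAdd ⁻¹' (J.map K.mkQ : Set (R ⧸ K)) := by
    ext y
    constructor
    · rintro ⟨n, rfl⟩; exact ⟨_, h₁ n n.2, rfl⟩
    · rintro ⟨x, hx, hxy⟩
      obtain ⟨n, hn, hk⟩ := h₂ x hx
      refine ⟨⟨n, hn⟩, ?_⟩
      rw [hf, ← ofAdd_toAdd y, ← hxy]
      congr 1
      exact ((Submodule.Quotient.eq _).2 hk).symm
  rw [Subgroup.relIndex, ← hker, Subgroup.index_ker]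
  exact (congrArg Set.ncard hrange).symm

/-- A prime order would make `G` generated by the center and one element `x`, as the Frattini part
is superfluous; then `x` is central. This excludes `d = 1`, where `d.choose 2` and `(d - 1).choose
2` coincide. -/
theorem Subgroup.card_ne_prime_of_frattini_sup_center {G : Type*} [Group G] [Finite G]
    {p : ℕ} (hp : p.Prime) : Nat.card (G ⧸ (frattini G ⊔ Subgroup.center G)) ≠ p := by
  intro h
  set M := frattini G ⊔ Subgroup.center G
  have hM : M.index = p := h
  have hne : M ≠ ⊤ := fun h => hp.ne_one (by rw [← hM, h, Subgroup.index_top])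
  obtain ⟨x, -, hx⟩ := SetLike.exists_of_lt (lt_top_iff_ne_top.2 hne)
  have htop : Subgroup.zpowers x ⊔ M = ⊤ := by
    have h1 := Subgroup.relIndex_mul_index (le_sup_right : M ≤ Subgroup.zpowers x ⊔ M)
    rw [hM] at h1
    rcases (Nat.dvd_prime hp).1 ⟨_, h1.symm.trans (mul_comm _ _)⟩ with h2 | h2
    · exact Subgroup.index_eq_one.1 h2
    · rw [h2] at h1
      have h3 : M.relIndex (Subgroup.zpowers x ⊔ M) = 1 :=
        Nat.eq_of_mul_eq_mul_right hp.pos (by rw [h1, one_mul])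
      exact absurd (Subgroup.relIndex_eq_one.1 h3
        ((le_sup_left : Subgroup.zpowers x ≤ _) (Subgroup.mem_zpowers x))) hx
  have htop2 : Subgroup.zpowers x ⊔ Subgroup.center G = ⊤ := by
    refine frattini_nongenerating ?_
    rw [← htop, sup_assoc, sup_comm (Subgroup.center G)]
  have hle : Subgroup.zpowers x ⊔ Subgroup.center G ≤ Subgroup.centralizer {x} := by
    refine sup_le ?_ (Subgroup.center_le_centralizer _)
    rw [Subgroup.zpowers_le, Subgroup.mem_centralizer_singleton_iff]
  rw [htop2] at hle
  refine hx ((le_sup_right : Subgroup.center G ≤ M) (Subgroup.mem_center_iff.2 fun g => ?_))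
  exact (Subgroup.mem_centralizer_singleton_iff.1 (hle (Subgroup.mem_top g)))

end Counting

/-! ### Nondegeneracy of the commutator pairing -/

section GroupAlgebra

variable {p : ℕ} [Fact p.Prime] {G : Type*} [Group G]

local notation "I" => augKer (augmentation p G)
local notation "J" => commSpan (ZMod p) (MonoidAlgebra (ZMod p) G)

/-- The subspace of the augmentation ideal that corresponds to `Z(G) Φ(G)`. -/
noncomputable def centralSpan (p : ℕ) [Fact p.Prime] (G : Type*) [Group G] :
    Submodule (ZMod p) (MonoidAlgebra (ZMod p) G) :=
  deltaSpan p (toAlg p G) (Subgroup.center G : Set G) ⊔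
    augKer (augmentation p G) * augKer (augmentation p G)

local notation "Z'" => deltaSpan p (toAlg p G) (Subgroup.center G : Set G)
local notation "R'" => centralSpan p G

theorem mul_eq_of_mem_deltaSpan_center {z : MonoidAlgebra (ZMod p) G} (hz : z ∈ Z')
    (x : MonoidAlgebra (ZMod p) G) : z * x = x * z := by
  have h : Z' ≤ LinearMap.eqLocus (LinearMap.mulRight (ZMod p) x)
      (LinearMap.mulLeft (ZMod p) x) := by
    rw [deltaSpan_le]
    intro z hz
    rw [LinearMap.mem_eqLocus, LinearMap.mulRight_apply, LinearMap.mulLeft_apply, sub_mul, mul_sub,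
      one_mul, mul_one]
    congr 1
    exact MonoidAlgebra.of_commute (fun g => ((Subgroup.mem_center_iff.1 hz g).symm : _)) x
  exact h hz

theorem sq_comm_mem_mixTwo {a x : MonoidAlgebra (ZMod p) G} (ha : a ∈ I * I) :
    a * x - x * a ∈ mixTwo I J := by
  induction ha using Submodule.mul_induction_on' with
  | mem_mul_mem b hb c hc =>
    have h : b * c * x - x * (b * c) = b * (c * x - x * c) + (b * x - x * b) * c := by
      noncomm_ring
    rw [h]
    exact add_mem (Submodule.mem_sup_left (Submodule.mul_mem_mul hb (comm_mem_commSpan c x)))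
      (Submodule.mem_sup_right (Submodule.mul_mem_mul (comm_mem_commSpan b x) hc))
  | add b _ c _ hb hc =>
    have h : (b + c) * x - x * (b + c) = (b * x - x * b) + (c * x - x * c) := by noncomm_ring
    rw [h]; exact add_mem hb hc

theorem centralSpan_comm_mem {a x : MonoidAlgebra (ZMod p) G} (ha : a ∈ R') :
    a * x - x * a ∈ mixTwo I J := by
  obtain ⟨z, hz, s, hs, rfl⟩ := Submodule.mem_sup.1 ha
  have h : (z + s) * x - x * (z + s) = (z * x - x * z) + (s * x - x * s) := by noncomm_ring
  rw [h, mul_eq_of_mem_deltaSpan_center hz, sub_self, zero_add]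
  exact sq_comm_mem_mixTwo hs

theorem mixTwo_le_commSpan : mixTwo I J ≤ J :=
  sup_le ((mul_le_mul_left le_top _).trans top_mul_commSpan)
    ((mul_le_mul_right le_top _).trans commSpan_mul_top)

theorem card_map_mkQ_commSpan :
    Nat.card ((J).map (mixTwo I J).mkQ) = (gammaTwoPowMul G p 3).relIndex (lcsTerm G 2) :=
  card_map_mkQ_eq_relIndex (toAlg p G) lcsTerm_two_sub_one_mem exists_two_toAlg_sub_mem
    (fun n _ => sub_one_mem_mixTwo_iff n)
    ((mul_le_mul_left ((commSpan_le_augKer_sq _).trans (augKer_mul_self_le _)) _).trans le_sup_left)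

theorem top_mul_augKer_sq_sup : ⊤ * (I * I) ≤ I * I := by
  rw [← mul_assoc]; exact mul_le_mul_left (top_mul_augKer _) _

theorem frattini_sub_one_mem {g : G} (hg : g ∈ frattini G) : toAlg p G g - 1 ∈ I * I := by
  by_contra h
  obtain ⟨l, hl, hle⟩ := Submodule.exists_le_ker_of_notMem h
  have h1 := frattini_le_ker (homOfFunctional l fun x hx => hle hx) hg
  exact hl h1

/-- The map `g ↦ g - 1` is a homomorphism from `G` onto `I/R'`, trivial on the Frattini subgroup and
on the center. -/
theorem finrank_augKer_map_le [Finite G] {d : ℕ}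
    (hd : Nat.card (G ⧸ (frattini G ⊔ Subgroup.center G)) = p ^ d) :
    Module.finrank (ZMod p) ((I).map (R').mkQ) ≤ d := by
  have hp : p.Prime := Fact.out
  have hfin : Module.Finite (ZMod p) (MonoidAlgebra (ZMod p) G) :=
    Module.Finite.of_basis (MonoidAlgebra.basis G (ZMod p))
  have hR : ⊤ * R' ≤ R' ⊔ I * I := by
    rw [centralSpan, Submodule.mul_sup]
    refine sup_le ?_ (top_mul_augKer_sq_sup.trans (le_sup_right))
    refine Submodule.mul_le.2 fun a _ z hz => ?_
    rw [← mul_eq_of_mem_deltaSpan_center hz]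
    have h := deltaSpan_mul_top _ (Submodule.mul_mem_mul hz (Submodule.mem_top (x := a)))
    have h' : Z' * I ≤ I * I := mul_le_mul_left (deltaSpan_le_augKer _) _
    exact (sup_le (le_sup_left.trans le_sup_left) (h'.trans le_sup_right) :
      Z' ⊔ Z' * I ≤ Z' ⊔ I * I ⊔ I * I) h
  have hR' : ⊤ * R' ≤ R' := hR.trans (sup_le le_rfl le_sup_right)
  have h1 : Nat.card ((I).map (R').mkQ) = (congrOneSubgroup (toAlg p G) R' hR').relIndex ⊤ :=
    card_map_mkQ_eq_relIndex (toAlg p G) (fun n _ => toAlg_sub_one_mem n)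
      (fun x hx => by
        obtain ⟨g, hg⟩ := exists_toAlg_sub_mem x hx
        exact ⟨g, trivial, (le_sup_right : I * I ≤ R') hg⟩)
      (fun n _ => Iff.rfl) le_sup_right
  have h2 : frattini G ⊔ Subgroup.center G ≤ congrOneSubgroup (toAlg p G) R' hR' := by
    refine sup_le (fun g hg => (le_sup_right : I * I ≤ R') (frattini_sub_one_mem hg))
      (fun g hg => (le_sup_left : Z' ≤ R') (sub_one_mem_deltaSpan _ hg))
  have h3 := Subgroup.index_dvd_of_le h2
  have h4 : (frattini G ⊔ Subgroup.center G).index = p ^ d := hd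
  rw [h4, ← Subgroup.relIndex_top_right, ← h1, Module.natCard_eq_pow_finrank (K := ZMod p),
    Nat.card_zmod] at h3
  exact (Nat.pow_dvd_pow_iff_le_right hp.one_lt).1 h3

/-- Otherwise the alternating commutator pairing on `I/R'` would factor through the quotient by the
class of `y`, of dimension below `d`. Its values span `J/(IJ + JI)`, whose dimension `d.choose 2`
would be too large. -/
theorem mem_centralSpan_of_comm_mem [Finite G] {d : ℕ}
    (hd : Nat.card (G ⧸ (frattini G ⊔ Subgroup.center G)) = p ^ d)
    (hb : (gammaTwoPowMul G p 3).relIndex (lcsTerm G 2) = p ^ d.choose 2)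
    {y : MonoidAlgebra (ZMod p) G} (hy : y ∈ I)
    (hcomm : ∀ x ∈ I, y * x - x * y ∈ mixTwo I J) : y ∈ R' := by
  have hp : p.Prime := Fact.out
  have hfin : Module.Finite (ZMod p) (MonoidAlgebra (ZMod p) G) :=
    Module.Finite.of_basis (MonoidAlgebra.basis G (ZMod p))
  by_contra hyR
  obtain ⟨l, hl, hle⟩ := Submodule.exists_le_ker_of_notMem hyR
  let U := (I).map (R').mkQ
  let K := mixTwo I J
  let l' : (MonoidAlgebra (ZMod p) G ⧸ R') →ₗ[ZMod p] ZMod p := (R').liftQ l hle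
  have hl' : ∀ x, l' ((R').mkQ x) = l x := fun x => Submodule.liftQ_apply _ _ _
  -- A complement to the line of `y` in `I/R'`; commutators of lifts of its basis will span
  -- everything.
  let U₀ := U ⊓ LinearMap.ker l'
  have hU₀ : U₀ < U := by
    refine lt_of_le_of_ne inf_le_left fun h => hl ?_
    have h1 : (R').mkQ y ∈ U₀ := by rw [h]; exact ⟨y, hy, rfl⟩
    rw [← hl']; exact h1.2
  have hm : Module.finrank (ZMod p) U₀ < d :=
    (Submodule.finrank_lt_finrank_of_lt hU₀).trans_le (finrank_augKer_map_le hd)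
  set m := Module.finrank (ZMod p) U₀
  let b := Module.finBasis (ZMod p) U₀
  have hex : ∀ i, ∃ x ∈ I, (R').mkQ x = (b i : MonoidAlgebra (ZMod p) G ⧸ R') :=
    fun i => (b i).2.1
  choose Y hYI hYb using hex
  let B : MonoidAlgebra (ZMod p) G →ₗ[ZMod p] MonoidAlgebra (ZMod p) G →ₗ[ZMod p]
      (MonoidAlgebra (ZMod p) G ⧸ K) :=
    (LinearMap.mul (ZMod p) (MonoidAlgebra (ZMod p) G)
      - (LinearMap.mul (ZMod p) (MonoidAlgebra (ZMod p) G)).flip).compr₂ K.mkQ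
  have hB : ∀ x x', B x x' = K.mkQ (x * x' - x' * x) := fun x x' => rfl
  have hBskew : ∀ x x', B x x' = - B x' x := fun x x' => by
    rw [hB, hB, ← map_neg, neg_sub]
  let V := {a : Sym2 (Fin m) // ¬ a.IsDiag}
  let P := Submodule.span (ZMod p) (Set.range fun s : V => B (Y s.1.out.1) (Y s.1.out.2))
  have hPcard : Module.finrank (ZMod p) P ≤ m.choose 2 := by
    refine (finrank_range_le_card _).trans ?_
    rw [Sym2.card_subtype_not_diag, Fintype.card_fin]
  have hYY : ∀ i j, B (Y i) (Y j) ∈ P := by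
    intro i j
    by_cases hij : i = j
    · subst hij; rw [hB, sub_self, map_zero]; exact zero_mem _
    · have hnd : ¬ (s(i, j)).IsDiag := by simpa using hij
      have hmem : B (Y (s(i, j)).out.1) (Y (s(i, j)).out.2) ∈ P :=
        Submodule.subset_span ⟨⟨_, hnd⟩, rfl⟩
      have hout : s((s(i, j)).out.1, (s(i, j)).out.2) = s(i, j) := Quot.out_eq _
      rw [Sym2.eq_iff] at hout
      rcases hout with ⟨h1, h2⟩ | ⟨h1, h2⟩
      · rwa [h1, h2] at hmem
      · rw [h1, h2, hBskew] at hmem; exact neg_mem_iff.1 hmem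
  have hdec : ∀ x ∈ I, ∃ s ∈ Submodule.span (ZMod p) (Set.range Y), ∃ c : ZMod p,
      x - s - c • y ∈ R' := by
    intro x hx
    have hly : l y ≠ 0 := hl
    have hmem : (R').mkQ (x - (l x / l y) • y) ∈ U₀ := by
      refine ⟨⟨_, sub_mem hx (Submodule.smul_mem _ _ hy), rfl⟩, ?_⟩
      rw [SetLike.mem_coe, LinearMap.mem_ker, hl', map_sub, map_smul, smul_eq_mul,
        div_mul_cancel₀ _ hly, sub_self]
    have hrep := congrArg Subtype.val (b.sum_repr ⟨_, hmem⟩)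
    refine ⟨∑ i, b.repr ⟨_, hmem⟩ i • Y i,
      Submodule.sum_mem _ fun i _ => Submodule.smul_mem _ _ (Submodule.subset_span ⟨i, rfl⟩),
      l x / l y, ?_⟩
    rw [← Submodule.Quotient.mk_eq_zero, ← Submodule.mkQ_apply, sub_right_comm, map_sub,
      sub_eq_zero, map_sum]
    simp only [map_smul, hYb]
    refine hrep.symm.trans ?_
    rw [AddSubmonoidClass.coe_finsetSum]
    rfl
  have hker : ∀ x ∈ I, ∀ r ∈ R', ∀ c : ZMod p, B (c • y + r) x = 0 := by
    intro x hx r hr c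
    rw [map_add, LinearMap.add_apply, map_smul, LinearMap.smul_apply, hB, hB]
    have h1 : K.mkQ (y * x - x * y) = 0 := (Submodule.Quotient.mk_eq_zero _).2 (hcomm x hx)
    have h2 : K.mkQ (r * x - x * r) = 0 :=
      (Submodule.Quotient.mk_eq_zero _).2 (centralSpan_comm_mem hr)
    rw [h1, h2, smul_zero, add_zero]
  have hspan : ∀ s ∈ Submodule.span (ZMod p) (Set.range Y),
      ∀ s' ∈ Submodule.span (ZMod p) (Set.range Y), B s s' ∈ P := by
    intro s hs s' hs'
    have h := Submodule.apply_mem_map₂ B hs hs'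
    rw [Submodule.map₂_span_span] at h
    refine (Submodule.span_le.2 ?_) h
    rintro _ ⟨_, ⟨i, rfl⟩, _, ⟨j, rfl⟩, rfl⟩
    exact hYY i j
  have hspanI : Submodule.span (ZMod p) (Set.range Y) ≤ I := by
    rw [Submodule.span_le]; rintro _ ⟨i, rfl⟩; exact hYI i
  have hII : ∀ x ∈ I, ∀ x' ∈ I, B x x' ∈ P := by
    intro x hx x' hx'
    obtain ⟨s, hs, c, hr⟩ := hdec x hx
    obtain ⟨s', hs', c', hr'⟩ := hdec x' hx'
    have e1 : B x x' = B s x' := by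
      have e : x = s + (c • y + (x - s - c • y)) := by abel
      conv_lhs => rw [e]
      rw [map_add, LinearMap.add_apply, hker x' hx' _ hr, add_zero]
    have e2 : B s x' = B s s' := by
      have e : x' = s' + (c' • y + (x' - s' - c' • y)) := by abel
      conv_lhs => rw [e]
      rw [map_add, hBskew s (_ + _), hker s (hspanI hs) _ hr', neg_zero, add_zero]
    rw [e1, e2]
    exact hspan s hs s' hs'
  -- Modulo `K` multiplication on `J` by `I` is zero, so this preimage is a two-sided ideal. It
  -- contains all commutators, hence `J`.
  let P' := P.comap K.mkQ
  have hP'J : P' ≤ J := by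
    intro x hx
    have hPJ : P ≤ (J).map K.mkQ := by
      rw [Submodule.span_le]
      rintro _ ⟨s, rfl⟩
      exact ⟨_, comm_mem_commSpan _ _, rfl⟩
    have h1 : x ∈ ((J).map K.mkQ).comap K.mkQ := hPJ hx
    rwa [Submodule.comap_map_mkQ, sup_eq_right.2 mixTwo_le_commSpan] at h1
  have hKP : K ≤ P' := fun x hx => by
    have h : K.mkQ x = 0 := (Submodule.Quotient.mk_eq_zero _).2 hx
    rw [Submodule.mem_comap, h]; exact zero_mem _
  have hsub : ∀ a : MonoidAlgebra (ZMod p) G,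
      a - algebraMap (ZMod p) _ (augmentation p G a) ∈ I := fun a => by
    rw [mem_augKer, map_sub, AlgHom.commutes]; simp
  have hJP : J ≤ P' := by
    refine commSpan_le_of ?_ ?_ fun x x' => ?_
    · refine Submodule.mul_le.2 fun a _ x hx => ?_
      have e : a * x = augmentation p G a • x
          + (a - algebraMap (ZMod p) _ (augmentation p G a)) * x := by
        rw [sub_mul, ← Algebra.smul_def]; abel
      rw [e]
      exact add_mem (Submodule.smul_mem _ _ hx)
        (hKP (Submodule.mem_sup_left (Submodule.mul_mem_mul (hsub a) (hP'J hx))))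
    · refine Submodule.mul_le.2 fun x hx a _ => ?_
      have e : x * a = augmentation p G a • x
          + x * (a - algebraMap (ZMod p) _ (augmentation p G a)) := by
        rw [mul_sub, ← Algebra.commutes, ← Algebra.smul_def]; abel
      rw [e]
      exact add_mem (Submodule.smul_mem _ _ hx)
        (hKP (Submodule.mem_sup_right (Submodule.mul_mem_mul (hP'J hx) (hsub a))))
    · rw [comm_eq_comm_sub_algebraMap (augmentation p G x) (augmentation p G x')]
      exact hII _ (hsub x) _ (hsub x')
  have hrank : Module.finrank (ZMod p) ((J).map K.mkQ) = d.choose 2 := by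
    have h := card_map_mkQ_commSpan (p := p) (G := G)
    rw [hb, Module.natCard_eq_pow_finrank (K := ZMod p), Nat.card_zmod] at h
    exact Nat.pow_right_injective hp.two_le h
  have hle2 : d.choose 2 ≤ m.choose 2 := by
    rw [← hrank]
    refine (Submodule.finrank_mono ?_).trans hPcard
    rw [Submodule.map_le_iff_le_comap]; exact hJP
  obtain ⟨k, rfl⟩ : ∃ k, d = k + 1 := ⟨d - 1, by omega⟩
  have hk : k ≠ 0 := by
    rintro rfl
    exact Subgroup.card_ne_prime_of_frattini_sup_center hp (by simpa using hd)
  have h1 := Nat.choose_le_choose 2 (Nat.lt_succ_iff.1 hm)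
  -- As `k ≠ 0`, this makes `d.choose 2` exceed `k.choose 2`, which is at least `m.choose 2`.
  have h2 : (k + 1).choose 2 = k + k.choose 2 := by
    rw [Nat.choose_succ_succ' k 1, Nat.choose_one_right]
  omega

end GroupAlgebra

/-! ### Elements of `I²` detected by derivations -/

section GroupAlgebra

variable {p : ℕ} [Fact p.Prime] {G : Type*} [Group G]

local notation "I" => augKer (augmentation p G)
local notation "J" => commSpan (ZMod p) (MonoidAlgebra (ZMod p) G)
local notation "Z'" => deltaSpan p (toAlg p G) (Subgroup.center G : Set G)
local notation "R'" => centralSpan p G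

/-- Lifts to `I` of a basis of `I/R'`, with the coordinate functionals extended to the whole
algebra. -/
theorem exists_dual_family [Finite G] : ∃ (n : ℕ) (x : Fin n → MonoidAlgebra (ZMod p) G)
    (l : Fin n → MonoidAlgebra (ZMod p) G →ₗ[ZMod p] ZMod p),
    (∀ i, x i ∈ I) ∧ (∀ i, ∀ r ∈ R', l i r = 0) ∧ (∀ i j, l i (x j) = if j = i then 1 else 0) ∧
    ∀ y ∈ I, y - ∑ i, l i y • x i ∈ R' := by
  have hfin : Module.Finite (ZMod p) (MonoidAlgebra (ZMod p) G) :=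
    Module.Finite.of_basis (MonoidAlgebra.basis G (ZMod p))
  let U := (I).map (R').mkQ
  let b := Module.finBasis (ZMod p) U
  have hex : ∀ i, ∃ x ∈ I, (R').mkQ x = (b i : MonoidAlgebra (ZMod p) G ⧸ R') := fun i => (b i).2
  choose x hx hxb using hex
  have hext : ∀ i, ∃ f : (MonoidAlgebra (ZMod p) G ⧸ R') →ₗ[ZMod p] ZMod p,
      f.comp U.subtype = b.coord i := fun i => LinearMap.exists_extend _
  choose f hf using hext
  have hfU : ∀ i (u : U), f i u = b.repr u i := fun i u => LinearMap.congr_fun (hf i) u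
  refine ⟨_, x, fun i => (f i).comp (R').mkQ, hx, fun i r hr => ?_, fun i j => ?_, fun y hy => ?_⟩
  · rw [LinearMap.comp_apply, Submodule.mkQ_apply, (Submodule.Quotient.mk_eq_zero _).2 hr, map_zero]
  · rw [LinearMap.comp_apply, hxb, hfU, Module.Basis.repr_self, Finsupp.single_apply]
  · rw [← Submodule.Quotient.mk_eq_zero, ← Submodule.mkQ_apply, map_sub, sub_eq_zero, map_sum]
    simp only [map_smul, hxb, LinearMap.comp_apply]
    have hmem : (R').mkQ y ∈ U := ⟨y, hy, rfl⟩
    have hrep := congrArg Subtype.val (b.sum_repr ⟨_, hmem⟩)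
    refine hrep.symm.trans ?_
    rw [AddSubmonoidClass.coe_finsetSum]
    exact Finset.sum_congr rfl fun i _ => by
      rw [Submodule.coe_smul, ← hfU]

/-- Elements of `I²` all of whose derivatives are central modulo `I²`. -/
theorem mem_of_derivation_mem [Finite G] (hodd : p ≠ 2) {w : MonoidAlgebra (ZMod p) G}
    (hw : w ∈ I * I)
    (hDw : ∀ (χ : G →* Multiplicative (ZMod p))
      (D : MonoidAlgebra (ZMod p) G →ₗ[ZMod p] MonoidAlgebra (ZMod p) G),
      (∀ g, D (toAlg p G g) = (χ g).toAdd • toAlg p G g) →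
      (∀ x y, D (x * y) = D x * y + x * D y) → D w ∈ R') :
    w ∈ J ⊔ I * I * I ⊔ Z' * Z' := by
  have hp : p.Prime := Fact.out
  obtain ⟨n, x, l, hx, hlR, hlx, hrep⟩ := exists_dual_family (p := p) (G := G)
  set L := J ⊔ I * I * I ⊔ Z' * Z'
  have hJL : J ≤ L := le_sup_left.trans le_sup_left
  have hIL : I * I * I ≤ L := le_sup_right.trans le_sup_left
  have hZL : Z' * Z' ≤ L := le_sup_right
  have hZI : Z' ≤ I := deltaSpan_le_augKer _
  have hZR : Z' ≤ R' := le_sup_left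
  have hsqR : I * I ≤ R' := le_sup_right
  have hsq := augKer_mul_self_le (augmentation p G)
  -- Normal form modulo `L`: factors split along `I = span x + Z' + I²`, and products of two
  -- elements of `Z'` or with a factor in `I²` are absorbed.
  have hdec : ∃ (c : Fin n → Fin n → ZMod p) (r : Fin n → MonoidAlgebra (ZMod p) G),
      (∀ i, r i ∈ Z') ∧ w - (∑ i, ∑ j, c i j • (x i * x j) + ∑ i, x i * r i) ∈ L := by
    clear hDw
    induction hw using Submodule.mul_induction_on' with
    | mem_mul_mem y hy y' hy' =>
      obtain ⟨z, hz, s, hs, hzs⟩ := Submodule.mem_sup.1 (hrep y hy)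
      obtain ⟨z', hz', s', hs', hzs'⟩ := Submodule.mem_sup.1 (hrep y' hy')
      refine ⟨fun i j => l i y * l j y', fun i => l i y • z' + l i y' • z,
        fun i => add_mem (Submodule.smul_mem _ _ hz') (Submodule.smul_mem _ _ hz), ?_⟩
      set X := ∑ i, l i y • x i with hX
      set X' := ∑ i, l i y' • x i with hX'
      have e1 : ∑ i, ∑ j, (l i y * l j y') • (x i * x j) = X * X' := by
        rw [hX, hX', Finset.sum_mul_sum]
        exact Finset.sum_congr rfl fun i _ => Finset.sum_congr rfl fun j _ => by
          rw [smul_mul_smul_comm]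
      have e2 : ∑ i, x i * (l i y • z' + l i y' • z) = X * z' + X' * z := by
        rw [hX, hX', Finset.sum_mul, Finset.sum_mul, ← Finset.sum_add_distrib]
        exact Finset.sum_congr rfl fun i _ => by
          rw [mul_add, mul_smul_comm, mul_smul_comm, smul_mul_assoc, smul_mul_assoc]
      have hXI : X ∈ I := Submodule.sum_mem _ fun i _ => Submodule.smul_mem _ _ (hx i)
      have hX'I : X' ∈ I := Submodule.sum_mem _ fun i _ => Submodule.smul_mem _ _ (hx i)
      have hy1 : y = X + z + s := by rw [add_assoc, hzs]; abel
      have hy1' : y' = X' + z' + s' := by rw [add_assoc, hzs']; abel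
      rw [e1, e2]
      have e : y * y' - (X * X' + (X * z' + X' * z))
          = z * z' + (z * X' - X' * z) + ((X + z) * s' + s * y') := by
        conv_lhs => rw [hy1]
        rw [add_mul _ s y']
        conv_lhs => rw [hy1']
        conv_rhs => rw [hy1']
        noncomm_ring
      rw [e]
      refine add_mem (add_mem (hZL (Submodule.mul_mem_mul hz hz')) (hJL (comm_mem_commSpan _ _)))
        (hIL (add_mem ?_ (Submodule.mul_mem_mul hs hy')))
      have h := Submodule.mul_mem_mul (add_mem hXI (hZI hz)) hs'
      rwa [← mul_assoc] at h
    | add a _ b _ ha hb =>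
      obtain ⟨c, r, hr, h⟩ := ha
      obtain ⟨c', r', hr', h'⟩ := hb
      refine ⟨fun i j => c i j + c' i j, fun i => r i + r' i, fun i => add_mem (hr i) (hr' i), ?_⟩
      have e := add_mem h h'
      convert e using 1
      simp only [add_smul, mul_add, Finset.sum_add_distrib]
      abel
  obtain ⟨c, r, hr, hwL⟩ := hdec
  -- the coefficients are antisymmetric and the `r i` lie in the square of the augmentation ideal
  have key : ∀ k, ∑ i, (c i k + c k i) • x i + r k ∈ I * I := by
    intro k
    by_contra hk
    -- If the element is outside `I * I`, some functional `m` vanishing there detects it. Applying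
    -- `l k` to the derivative of `w` along `m` returns exactly `m` of this element, although `D w`
    -- lies in `R'`.
    obtain ⟨m, hm, hle⟩ := Submodule.exists_le_ker_of_notMem hk
    obtain ⟨χ, D, hD, hmul, hE⟩ := exists_derivation_of_functional m (fun x hx => hle hx)
    have hlE : ∀ a ∈ I, ∀ b ∈ I, l k (D (a * b)) = m a * l k b + m b * l k a := by
      intro a ha b hb
      have h := hlR k _ (hsqR (hE a ha b hb))
      rw [map_sub, sub_eq_zero] at h
      rw [h, map_add, map_smul, map_smul, smul_eq_mul, smul_eq_mul]
    have hDL : ∀ y ∈ L, l k (D y) = 0 := by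
      have hle' : L ≤ LinearMap.ker ((l k).comp D) := by
        refine sup_le (sup_le ?_ ?_) ?_
        · exact fun y hy => hlR k _ (hsqR (commSpan_le_augKer_sq _
            (derivation_commSpan_mem hD hmul y hy)))
        · exact fun y hy => hlR k _ (hsqR (derivation_cube_mem hmul y hy))
        · refine Submodule.mul_le.2 fun z hz z' hz' => ?_
          rw [LinearMap.mem_ker, LinearMap.comp_apply, hlE z (hZI hz) z' (hZI hz'),
            hlR k z (hZR hz), hlR k z' (hZR hz'), mul_zero, mul_zero, add_zero]
      exact fun y hy => hle' hy
    have h1 := hDL _ hwL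
    rw [map_sub, map_sub, hlR k _ (hDw χ D hD hmul), zero_sub, neg_eq_zero, map_add, map_add,
      map_sum, map_sum, map_sum, map_sum] at h1
    have h2 : ∑ i, l k (D (∑ j, c i j • (x i * x j))) = ∑ i, (c i k + c k i) * m (x i) := by
      have h3 : ∀ i, l k (D (∑ j, c i j • (x i * x j)))
          = c i k * m (x i) + if i = k then ∑ j, c k j * m (x j) else 0 := by
        intro i
        rw [map_sum, map_sum]
        simp only [map_smul, hlE _ (hx _) _ (hx _), hlx, smul_eq_mul, mul_add, mul_ite, mul_one,
          mul_zero, Finset.sum_add_distrib, Finset.sum_ite_eq', Finset.mem_univ, if_true]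
        congr 1
        by_cases hik : i = k
        · subst hik; simp
        · simp [hik]
      simp only [h3, Finset.sum_add_distrib, Finset.sum_ite_eq', Finset.mem_univ, if_true, add_mul]
    have h4 : ∑ i, l k (D (x i * r i)) = m (r k) := by
      have h5 : ∀ i, l k (D (x i * r i)) = if i = k then m (r i) else 0 := by
        intro i
        rw [hlE _ (hx i) _ (hZI (hr i)), hlR k _ (hZR (hr i)), mul_zero, zero_add, hlx, mul_ite,
          mul_one, mul_zero]
      simp only [h5, Finset.sum_ite_eq', Finset.mem_univ, if_true]
    rw [h2, h4] at h1
    refine hm ?_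
    rw [map_add, map_sum, ← h1]
    simp only [map_smul, smul_eq_mul]
  have hanti : ∀ i k, c i k + c k i = 0 := by
    intro i k
    have h := hlR i _ (hsqR (key k))
    rw [map_add, hlR i _ (hZR (hr k)), add_zero, map_sum] at h
    simpa [hlx] using h
  have hr2 : ∀ k, r k ∈ I * I := by
    intro k
    have h := key k
    simpa only [hanti, zero_smul, Finset.sum_const_zero, zero_add] using h
  have hsum1 : ∑ i, x i * r i ∈ L := Submodule.sum_mem _ fun i _ => hIL (by
    have h := Submodule.mul_mem_mul (hx i) (hr2 i)
    rwa [← mul_assoc] at h)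
  have hsum2 : ∑ i, ∑ j, c i j • (x i * x j) ∈ L := by
    have h2 : (2 : ZMod p) ≠ 0 := by
      intro h
      have h' : ((2 : ℕ) : ZMod p) = 0 := by exact_mod_cast h
      rw [ZMod.natCast_eq_zero_iff] at h'
      exact hodd ((Nat.prime_dvd_prime_iff_eq hp Nat.prime_two).1 h')
    -- Antisymmetry turns twice the quadratic part into a combination of commutators; 2 is
    -- invertible because p is odd.
    have e : (2 : ZMod p) • ∑ i, ∑ j, c i j • (x i * x j)
        = ∑ i, ∑ j, c i j • (x i * x j - x j * x i) := by
      have h3 : ∑ i, ∑ j, c i j • (x i * x j) = - ∑ i, ∑ j, c i j • (x j * x i) := by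
        rw [Finset.sum_comm, ← Finset.sum_neg_distrib]
        refine Finset.sum_congr rfl fun i _ => ?_
        rw [← Finset.sum_neg_distrib]
        refine Finset.sum_congr rfl fun j _ => ?_
        rw [eq_neg_of_add_eq_zero_left (hanti j i), neg_smul]
      simp only [smul_sub, Finset.sum_sub_distrib]
      rw [two_smul]
      nth_rewrite 2 [h3]
      rw [sub_eq_add_neg]
    have h4 : (2 : ZMod p) • ∑ i, ∑ j, c i j • (x i * x j) ∈ L := by
      rw [e]
      exact hJL (Submodule.sum_mem _ fun i _ => Submodule.sum_mem _ fun j _ =>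
        Submodule.smul_mem _ _ (comm_mem_commSpan _ _))
    have h5 := Submodule.smul_mem L (2 : ZMod p)⁻¹ h4
    rwa [smul_smul, inv_mul_cancel₀ h2, one_smul] at h5
  have h := add_mem hwL (add_mem hsum2 hsum1)
  simpa using h

/-- An element of `I²` whose commutators with group elements come from `γ_3(G)` is congruent to an
element of `J` modulo elements that are central modulo `IIJ + IJI + JII`. -/
theorem exists_commSpan_sub_commute [Finite G] (hodd : p ≠ 2) {d : ℕ}
    (hd : Nat.card (G ⧸ (frattini G ⊔ Subgroup.center G)) = p ^ d)
    (hb : (gammaTwoPowMul G p 3).relIndex (lcsTerm G 2) = p ^ d.choose 2)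
    {w : MonoidAlgebra (ZMod p) G} (hw : w ∈ I * I)
    (hcomm : ∀ g, ∃ z ∈ lcsTerm G 2,
      w * toAlg p G g - toAlg p G g * w - (toAlg p G z - 1) ∈ mixThree I J) :
    ∃ j ∈ J, ∀ g, (w - j) * toAlg p G g - toAlg p G g * (w - j) ∈ mixThree I J := by
  have hsub : ∀ (y : MonoidAlgebra (ZMod p) G) g, y * toAlg p G g - toAlg p G g * y
      = y * (toAlg p G g - 1) - (toAlg p G g - 1) * y := fun y g => by noncomm_ring
  have hmem := mem_of_derivation_mem hodd hw (fun χ D hD hmul => by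
    refine mem_centralSpan_of_comm_mem hd hb (derivation_sq_mem hmul w hw) fun x hx => ?_
    have hle : I ≤ (mixTwo I J).comap (LinearMap.mulLeft (ZMod p) (D w)
        - LinearMap.mulRight (ZMod p) (D w)) := by
      rw [augKer_augmentation, deltaSpan_le, ← augKer_augmentation]
      intro g _
      rw [Submodule.mem_comap, LinearMap.sub_apply, LinearMap.mulLeft_apply,
        LinearMap.mulRight_apply, ← hsub]
      obtain ⟨z, hz, hk⟩ := hcomm g
      -- Differentiating the commutator relation kills `z - 1` and leaves `[D w, g] + χ(g) [w, g]`;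
      -- the second term already lies in `mixTwo I J`.
      have h1 := derivation_mixThree_mem hD hmul _ hk
      rw [map_sub, derivation_deltaSpan_two_mem hD hmul _ (sub_one_mem_deltaSpan _ hz), sub_zero,
        map_sub, hmul, hmul, hD] at h1
      have h2 : w * toAlg p G g - toAlg p G g * w ∈ mixTwo I J := by
        rw [hsub]; exact sq_comm_mem_mixTwo hw
      have h3 := sub_mem h1 (Submodule.smul_mem _ (χ g).toAdd h2)
      convert h3 using 1
      rw [smul_mul_assoc, mul_smul_comm, smul_sub]
      abel
    exact hle hx)
  obtain ⟨a, ha, z, hz, rfl⟩ := Submodule.mem_sup.1 hmem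
  obtain ⟨j, hj, c, hc, rfl⟩ := Submodule.mem_sup.1 ha
  refine ⟨j, hj, fun g => ?_⟩
  have hz' : z * toAlg p G g = toAlg p G g * z := by
    clear hmem hcomm hw
    induction hz using Submodule.mul_induction_on' with
    | mem_mul_mem a ha b hb =>
      rw [mul_assoc, mul_eq_of_mem_deltaSpan_center hb, ← mul_assoc,
        mul_eq_of_mem_deltaSpan_center ha, mul_assoc]
    | add a _ b _ ha hb => rw [add_mul, mul_add, ha, hb]
  have e : (j + c + z - j) * toAlg p G g - toAlg p G g * (j + c + z - j)
      = (c * toAlg p G g - toAlg p G g * c) + (z * toAlg p G g - toAlg p G g * z) := by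
    noncomm_ring
  rw [e, hz', sub_self, add_zero, hsub]
  clear hmem hcomm hw e ha
  have hg := toAlg_sub_one_mem (p := p) g
  induction hc using Submodule.mul_induction_on' with
  | mem_mul_mem a ha b hb =>
    have e : a * b * (toAlg p G g - 1) - (toAlg p G g - 1) * (a * b)
        = a * (b * (toAlg p G g - 1) - (toAlg p G g - 1) * b)
          + (a * (toAlg p G g - 1) - (toAlg p G g - 1) * a) * b := by noncomm_ring
    rw [e]
    refine add_mem ((le_sup_left.trans le_sup_left : I * I * J ≤ mixThree I J)
      (Submodule.mul_mem_mul ha (comm_mem_commSpan _ _))) ?_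
    exact mixTwo_mul_augKer_le _ (Submodule.mul_mem_mul (sq_comm_mem_mixTwo ha) hb)
  | add a _ b _ ha hb =>
    have e : (a + b) * (toAlg p G g - 1) - (toAlg p G g - 1) * (a + b)
        = (a * (toAlg p G g - 1) - (toAlg p G g - 1) * a)
          + (b * (toAlg p G g - 1) - (toAlg p G g - 1) * b) := by noncomm_ring
    rw [e]
    exact add_mem ha hb

end GroupAlgebra

/-! ### Passage to the truncated quotient -/

section Quotient

variable {p : ℕ} [Fact p.Prime] {G : Type*} [Group G]

local notation "I" => augKer (augmentation p G)
local notation "J" => commSpan (ZMod p) (MonoidAlgebra (ZMod p) G)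

universe w in
theorem exists_quotient_algHom {F : Type*} {R : Type w} [Field F] [Ring R] [Algebra F R]
    (X : Submodule F R) (hl : ⊤ * X ≤ X) (hr : X * ⊤ ≤ X) :
    ∃ (S : Type w) (_ : Ring S) (_ : Algebra F S) (π : R →ₐ[F] S), Function.Surjective π ∧
      LinearMap.ker π.toLinearMap = X := by
  let T : Ideal R :=
    { X with smul_mem' := fun a x hx => hl (Submodule.mul_mem_mul trivial hx) }
  have hT : T.IsTwoSided := ⟨fun b hx => hr (Submodule.mul_mem_mul hx trivial)⟩
  refine ⟨R ⧸ T, inferInstance, inferInstance, Ideal.Quotient.mkₐ F T,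
    Ideal.Quotient.mkₐ_surjective F T, ?_⟩
  ext x
  exact Ideal.Quotient.eq_zero_iff_mem

/-- The image of a group element has p-power order in the prime field, where Frobenius is the
identity, so it is 1. Hence algebra isomorphisms preserve augmentation. -/
theorem IsPGroup.algHom_eq_augmentation (hG : IsPGroup p G)
    (f : MonoidAlgebra (ZMod p) G →ₐ[ZMod p] ZMod p) : f = augmentation p G := by
  refine AlgHom.ext fun x => linearMap_eq_of_toAlg (f := f.toLinearMap)
    (g := (augmentation p G).toLinearMap) (fun g => ?_) x
  obtain ⟨k, hk⟩ := hG g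
  have h1 : f (toAlg p G g) ^ p ^ k = 1 := by rw [← map_pow, ← map_pow, hk, map_one, map_one]
  rw [ZMod.pow_card_pow] at h1
  exact h1.trans (augmentation_toAlg g).symm

theorem IsPGroup.map_augKer (hG : IsPGroup p G) {H : Type*} [Group H]
    (φ : MonoidAlgebra (ZMod p) G ≃ₐ[ZMod p] MonoidAlgebra (ZMod p) H) :
    (I).map φ.toAlgHom.toLinearMap = augKer (augmentation p H) := by
  have h := hG.algHom_eq_augmentation ((augmentation p H).comp φ.toAlgHom)
  ext x
  constructor
  · rintro ⟨y, hy, rfl⟩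
    rw [← h] at hy
    exact hy
  · intro hx
    refine ⟨φ.symm x, ?_, φ.apply_symm_apply x⟩
    rw [← h]
    change augmentation p H (φ (φ.symm x)) = 0
    rw [φ.apply_symm_apply]
    exact hx

variable {S : Type*} [Ring S] [Algebra (ZMod p) S] (π : MonoidAlgebra (ZMod p) G →ₐ[ZMod p] S)

local notation "u" => MonoidHom.comp (MonoidHomClass.toMonoidHom π) (toAlg p G)
local notation "IS" => Submodule.map (AlgHom.toLinearMap π) I
local notation "JS" => Submodule.map (AlgHom.toLinearMap π) J

theorem map_deltaSpan (B : Set G) :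
    (deltaSpan p (toAlg p G) B).map π.toLinearMap = deltaSpan p u B := by
  rw [deltaSpan, deltaSpan, Submodule.map_span, ← Set.image_comp]
  congr 2
  funext g
  simp

theorem map_exists_pow_mem_sub_mem (hker : LinearMap.ker π.toLinearMap = mixThree I J)
    (hπ : Function.Surjective π) (e : ℕ) (x : S)
    (hx : x ^ p ^ e ∈ JS) :
    ∃ b ∈ {b : G | b ^ p ^ e ∈ lcsTerm G 2}, x - (u b - 1) ∈
      deltaSpan p u {b : G | b ^ p ^ e ∈ lcsTerm G 2} * IS := by
  obtain ⟨x, rfl⟩ := hπ x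
  have hx' : x ^ p ^ e ∈ (JS).comap π.toLinearMap := by
    rw [Submodule.mem_comap, AlgHom.toLinearMap_apply, map_pow]; exact hx
  rw [Submodule.comap_map_eq, hker,
    sup_eq_left.2 ((mixThree_le_mixTwo _).trans mixTwo_le_commSpan)] at hx'
  obtain ⟨b, hb, h⟩ := exists_pow_mem_sub_mem e x hx'
  refine ⟨b, hb, ?_⟩
  have h1 := Submodule.mem_map_of_mem (f := π.toLinearMap) h
  rw [Submodule.map_mul, map_deltaSpan] at h1
  convert h1 using 1
  simp

theorem map_centralSpan :
    (centralSpan p G).map π.toLinearMap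
      = deltaSpan p u (Subgroup.center G : Set G) ⊔ IS * IS := by
  rw [centralSpan, Submodule.map_sup, Submodule.map_mul, map_deltaSpan]

theorem finrank_map_augKer_le [Finite G] {d : ℕ}
    (hd : Nat.card (G ⧸ (frattini G ⊔ Subgroup.center G)) = p ^ d) :
    Module.finrank (ZMod p) ((IS).map
      (deltaSpan p u (Subgroup.center G : Set G) ⊔ IS * IS).mkQ) ≤ d := by
  have hfin : Module.Finite (ZMod p) (MonoidAlgebra (ZMod p) G) :=
    Module.Finite.of_basis (MonoidAlgebra.basis G (ZMod p))
  rw [← map_centralSpan]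
  have h : (IS).map ((centralSpan p G).map π.toLinearMap).mkQ
      = ((I).map (centralSpan p G).mkQ).map
        ((centralSpan p G).mapQ _ π.toLinearMap (Submodule.le_comap_map _ _)) := by
    rw [← Submodule.map_comp, ← Submodule.map_comp, Submodule.mapQ_mkQ]
  rw [h]
  exact (Submodule.finrank_map_le _ _).trans (finrank_augKer_map_le hd)

theorem map_exists_commSpan_sub_commute [Finite G]
    (hker : LinearMap.ker π.toLinearMap = mixThree I J) (hodd : p ≠ 2) {d : ℕ}
    (hd : Nat.card (G ⧸ (frattini G ⊔ Subgroup.center G)) = p ^ d)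
    (hb : (gammaTwoPowMul G p 3).relIndex (lcsTerm G 2) = p ^ d.choose 2)
    {w : S} (hw : w ∈ IS * IS)
    (hcomm : ∀ g, ∃ z ∈ lcsTerm G 2, w * u g - u g * w = u z - 1) :
    ∃ j ∈ JS, ∀ g, Commute (w - j) (u g) := by
  have hz : ∀ x, x ∈ mixThree I J ↔ π x = 0 := fun x => by rw [← hker]; rfl
  rw [← Submodule.map_mul] at hw
  obtain ⟨w, hw, rfl⟩ := hw
  obtain ⟨j, hj, h⟩ := exists_commSpan_sub_commute hodd hd hb hw (fun g => by
    obtain ⟨z, hz', h⟩ := hcomm g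
    refine ⟨z, hz', ?_⟩
    rw [hz]
    simpa [sub_eq_zero] using h)
  refine ⟨π j, ⟨j, hj, rfl⟩, fun g => ?_⟩
  have h1 := h g
  rw [hz] at h1
  rw [commute_iff_eq, ← sub_eq_zero]
  simpa using h1

/-- A maximal subgroup is the kernel of a character `χ`. Its derivation maps `I²` into `I` and sends
`g - 1` to `χ(g) g`, so the augmentation gives `χ(g) = 0`. -/
theorem IsPGroup.mem_frattini_of_map_sub_one_mem [Finite G]
    (hker : LinearMap.ker π.toLinearMap = mixThree I J) (hG : IsPGroup p G) {g : G}
    (hg : u g - 1 ∈ IS * IS) : g ∈ frattini G := by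
  have hle : mixThree I J ≤ I * I := by
    refine (mixThree_le_mixTwo _).trans (mixTwo_le_commSpan.trans (commSpan_le_augKer_sq _))
  have hg' : toAlg p G g - 1 ∈ (IS * IS).comap π.toLinearMap := by
    rw [Submodule.mem_comap, map_sub]
    simpa using hg
  rw [← Submodule.map_mul, Submodule.comap_map_eq, hker, sup_eq_left.2 hle] at hg'
  rw [frattini, Order.radical, Subgroup.mem_iInf]
  intro M
  rw [Subgroup.mem_iInf]
  intro hM
  obtain ⟨χ, rfl⟩ := hG.exists_hom_ker_eq_of_isCoatom hM
  obtain ⟨D, hD, hmul⟩ := exists_derivation χ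
  have h1 := derivation_sq_mem hmul _ hg'
  rw [mem_augKer, map_sub, derivation_one hmul, sub_zero, hD, map_smul, augmentation_toAlg,
    smul_eq_mul, mul_one] at h1
  exact h1

end Quotient

/-! ### Generators modulo the derived subgroup -/

theorem IsPGroup.exists_generators_mod_commutator {p : ℕ} [Fact p.Prime] {H : Type*} [Group H]
    [Finite H] (hH : IsPGroup p H) :
    ∃ (ι : Type) (_ : Fintype ι) (e : ι → ℕ) (h : ι → H), (∀ i, e i ≠ 0) ∧
      (∀ i, h i ^ p ^ e i ∈ lcsTerm H 2) ∧ Subgroup.closure (Set.range h) ⊔ lcsTerm H 2 = ⊤ ∧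
      ∏ i, p ^ e i = (lcsTerm H 2).index := by
  classical
  have hp : p.Prime := Fact.out
  obtain ⟨ι, _, n, hn, ⟨f⟩⟩ :=
    CommGroup.equiv_prod_multiplicative_zmod_of_finite (Abelianization H)
  have hker : (Abelianization.of (G := H)).ker = lcsTerm H 2 := by
    rw [Abelianization.ker_of, lcsTerm_two_eq]
  have hcard : ∏ i, n i = (lcsTerm H 2).index := by
    have h1 := Nat.card_congr f.toEquiv
    rw [Nat.card_pi] at h1
    simp only [Nat.card_congr Multiplicative.toAdd, Nat.card_zmod] at h1
    rw [← h1, lcsTerm_two_eq]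
    rfl
  obtain ⟨k, hk⟩ := hH.exists_card_eq
  have hpow : ∀ i, ∃ e, n i = p ^ e := fun i => by
    have h1 : n i ∣ p ^ k := by
      rw [← hk]
      exact (Finset.dvd_prod_of_mem n (Finset.mem_univ i)).trans
        (hcard ▸ Subgroup.index_dvd_card _)
    obtain ⟨e, -, he⟩ := (Nat.dvd_prime_pow hp).1 h1
    exact ⟨e, he⟩
  choose e he using hpow
  have hsurj : Function.Surjective (Abelianization.of (G := H)) := QuotientGroup.mk_surjective
  choose h hh using fun i => hsurj (f.symm (Pi.mulSingle i (Multiplicative.ofAdd 1)))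
  refine ⟨ι, inferInstance, e, h, fun i hi => ?_, fun i => ?_, ?_, ?_⟩
  · have := hn i
    rw [he, hi, pow_zero] at this
    exact lt_irrefl _ this
  · rw [← hker, MonoidHom.mem_ker, map_pow, hh, ← he, ← map_pow, ← Pi.mulSingle_pow, ← ofAdd_nsmul,
      nsmul_one, ZMod.natCast_self, ofAdd_zero, Pi.mulSingle_one, map_one]
  · have htop : Subgroup.closure (Set.range fun i : ι =>
        (Pi.mulSingle i (Multiplicative.ofAdd 1) : ∀ i, Multiplicative (ZMod (n i)))) = ⊤ := by
      refine top_le_iff.1 fun x _ => ?_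
      rw [← Finset.univ_prod_mulSingle x]
      refine Subgroup.prod_mem _ fun i _ => ?_
      have : NeZero (n i) := ⟨(zero_lt_one.trans (hn i)).ne'⟩
      have h1 : x i = Multiplicative.ofAdd (1 : ZMod (n i)) ^ (x i).toAdd.val := by
        rw [← ofAdd_nsmul, nsmul_one, ZMod.natCast_zmod_val, ofAdd_toAdd]
      rw [h1, Pi.mulSingle_pow]
      refine pow_mem (Subgroup.subset_closure ?_) _
      exact ⟨i, rfl⟩
    rw [← hker, ← Subgroup.comap_map_eq, MonoidHom.map_closure, ← Set.range_comp]
    have h2 : (Abelianization.of ∘ h) = f.symm.toMonoidHom ∘ fun i : ι =>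
        (Pi.mulSingle i (Multiplicative.ofAdd 1) : ∀ i, Multiplicative (ZMod (n i))) := by
      funext i; exact hh i
    rw [h2, Set.range_comp, ← MonoidHom.map_closure, htop, ← MonoidHom.range_eq_map,
      MonoidHom.range_eq_top.2 f.symm.surjective, Subgroup.comap_top]
  · rw [← hcard]
    exact Finset.prod_congr rfl fun i _ => (he i).symm

theorem gammaTwoPowMul_three_le (G : Type*) [Group G] (p : ℕ) :
    gammaTwoPowMul G p 3 ≤ lcsTerm G 2 := by
  refine sup_le ?_ (lcsTerm_antitone G (by norm_num))
  rw [powerSubgroup, Subgroup.closure_le]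
  rintro _ ⟨x, hx, rfl⟩
  exact pow_mem hx _

theorem gammaTwoPowMul_four_le (G : Type*) [Group G] (p : ℕ) :
    gammaTwoPowMul G p 4 ≤ gammaTwoPowMul G p 3 :=
  sup_le_sup_left (lcsTerm_antitone G (by norm_num)) _

theorem pow_mem_gammaTwoPowMul {G : Type*} [Group G] {p i : ℕ} {x : G} (hx : x ∈ lcsTerm G 2) :
    x ^ p ∈ gammaTwoPowMul G p i :=
  Subgroup.mem_sup_left (Subgroup.subset_closure ⟨x, hx, rfl⟩)

/-! ### Pairs matched in the common ring -/

section Match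

variable {p : ℕ} [Fact p.Prime] {S : Type*} [Ring S] [Algebra (ZMod p) S]
  {I J : Submodule (ZMod p) S} {G H : Type*} [Group G] [Group H] {u : G →* S} {v : H →* S}

/-- The pairs of elements of the third layers with the same image. -/
def matchThree (p : ℕ) (v : H →* S) (u : G →* S) : Subgroup (H × G) :=
  (gammaTwoPowMul H p 3).prod (gammaTwoPowMul G p 3) ⊓
    (v.comp (MonoidHom.fst H G)).eqLocus (u.comp (MonoidHom.snd H G))

/-- The pairs of elements that are congruent modulo `I * I`. -/
def congrPairs (v : H →* S) (u : G →* S) (hv : ∀ h, v h - 1 ∈ I) (hu : ∀ g, u g - 1 ∈ I)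
    (hI : I * I ≤ I) : Subgroup (H × G) where
  carrier := {z | v z.1 - u z.2 ∈ I * I}
  one_mem' := by simp
  mul_mem' := by
    intro a b ha hb
    have e : v (a * b).1 - u (a * b).2 = (v a.1 - u a.2) * (v b.1 - 1) + (v a.1 - u a.2)
        + (u a.2 - 1) * (v b.1 - u b.2) + (v b.1 - u b.2) := by
      rw [Prod.fst_mul, Prod.snd_mul, map_mul, map_mul]; noncomm_ring
    rw [Set.mem_ofPred_eq, e]
    exact add_mem (add_mem (add_mem (Submodule.mul_mem_mul (hI ha) (hv _)) ha)
      (Submodule.mul_mem_mul (hu _) (hI hb))) hb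
  inv_mem' := by
    intro a ha
    have e : v a⁻¹.1 - u a⁻¹.2 = -((v a⁻¹.1 - 1) * (v a.1 - u a.2) * u a⁻¹.2
        + (v a.1 - u a.2) * u a⁻¹.2) := by
      have h1 : v a⁻¹.1 * v a.1 = 1 := by rw [← map_mul, Prod.fst_inv, inv_mul_cancel, map_one]
      have h2 : u a.2 * u a⁻¹.2 = 1 := by rw [← map_mul, Prod.snd_inv, mul_inv_cancel, map_one]
      have h3 : (v a⁻¹.1 - 1) * (v a.1 - u a.2) * u a⁻¹.2 + (v a.1 - u a.2) * u a⁻¹.2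
          = v a⁻¹.1 * v a.1 * u a⁻¹.2 - v a⁻¹.1 * (u a.2 * u a⁻¹.2) := by noncomm_ring
      rw [h3, h1, h2, one_mul, mul_one, neg_sub]
    have hr : ∀ x ∈ I * I, x * u a⁻¹.2 ∈ I * I := fun x hx => by
      have e : x * u a⁻¹.2 = x * (u a⁻¹.2 - 1) + x := by noncomm_ring
      rw [e]
      exact add_mem (Submodule.mul_mem_mul (hI hx) (hu _)) hx
    rw [Set.mem_ofPred_eq, e]
    exact neg_mem (add_mem (hr _ (Submodule.mul_mem_mul (hv _) (hI ha))) (hr _ ha))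

variable (hT : IsTruncated I J) (hu : IsGroupBasis p I J u) (hv : IsGroupBasis p I J v)

include hT hu

theorem IsGroupBasis.map_conj_eq {x : G} (hx : x ∈ gammaTwoPowMul G p 3) (g : G) :
    u (g * x * g⁻¹) = u x := by
  have h1 := (hu.commute_of_mem_mixTwo hT ((hu.mem_three x).2 hx) (u g)).eq
  have h2 : u g * u x = u x * u g := by
    rw [sub_mul, mul_sub, one_mul, mul_one, sub_left_inj] at h1; exact h1.symm
  rw [map_mul, map_mul, h2, mul_assoc, ← map_mul, mul_inv_cancel, map_one, mul_one]

include hv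

theorem matchThree_normal : (matchThree p v u).Normal := by
  refine ⟨fun z hz a => ?_⟩
  obtain ⟨⟨h1, h2⟩, h3⟩ := hz
  refine ⟨⟨(gammaTwoPowMul_normal H p 3).conj_mem _ h1 _,
    (gammaTwoPowMul_normal G p 3).conj_mem _ h2 _⟩, ?_⟩
  change v (a.1 * z.1 * a.1⁻¹) = u (a.2 * z.2 * a.2⁻¹)
  rw [hv.map_conj_eq hT h1, hu.map_conj_eq hT h2]
  exact h3

/-- The third layers have the same image in `S`: `p`-th powers from `γ_2` become trivial, and
generators of `γ_3` are matched by `commutator_eq_of_two`. -/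
theorem exists_matchThree {x : H} (hx : x ∈ gammaTwoPowMul H p 3) :
    ∃ y, (x, y) ∈ matchThree p v u := by
  have hle : gammaTwoPowMul H p 3 ≤ (matchThree p v u).map (MonoidHom.fst H G) := by
    refine sup_le ?_ ?_
    · rw [powerSubgroup, Subgroup.closure_le]
      rintro _ ⟨n, hn, rfl⟩
      refine ⟨(n ^ p, 1), ⟨⟨pow_mem_gammaTwoPowMul hn, one_mem _⟩, ?_⟩, rfl⟩
      change v (n ^ p) = u 1
      rw [map_one, (hv.mem_four _).2 (pow_mem_gammaTwoPowMul hn)]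
    · rw [lcsTerm_succ H 2 (by norm_num), Subgroup.commutator_le]
      intro n hn h _
      obtain ⟨m, hm, hmn⟩ := hu.exists_two_sub_mem _ (hv.two_mem n hn)
      obtain ⟨g, hg⟩ := hu.exists_sub_mem _ (hv.sub_one_mem h)
      rw [sub_sub_sub_cancel_right] at hmn hg
      refine ⟨(⁅n, h⁆, ⁅m, g⁆), ⟨⟨?_, ?_⟩, hu.commutator_eq_of_two hT hv hn hm hmn hg⟩, rfl⟩
      · exact Subgroup.mem_sup_right (Subgroup.commutator_mem_commutator hn trivial)
      · exact Subgroup.mem_sup_right (Subgroup.commutator_mem_commutator hm trivial)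
  obtain ⟨z, hz, rfl⟩ := hle hx
  exact ⟨z.2, hz⟩

/-- Elements that are central modulo `I * I` can be made central by elements of `γ_2(H)`. -/
theorem exists_mul_central
    (hcen : ∀ w ∈ I * I, (∀ g, ∃ z ∈ lcsTerm G 2, w * u g - u g * w = u z - 1) →
      ∃ j ∈ J, ∀ g, Commute (w - j) (u g))
    {h : H} (hh : v h - 1 ∈ deltaSpan p u (Subgroup.center G : Set G) ⊔ I * I) :
    ∃ m ∈ lcsTerm H 2, ∀ y, Commute (v (m * h)) y := by
  obtain ⟨z, hz, s, hs, hzs⟩ := Submodule.mem_sup.1 hh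
  obtain ⟨k, hk, hkz⟩ := exists_mem_subgroup_sub_mem u hz
  have hkc : ∀ y, Commute (u k) y := hu.commute_all fun g => by
    rw [commute_iff_eq, ← map_mul, ← map_mul, Subgroup.mem_center_iff.1 hk g]
  have hDI : deltaSpan p u (Subgroup.center G : Set G) ≤ I :=
    deltaSpan_le.2 fun g _ => hu.sub_one_mem g
  have hw : v h - u k ∈ I * I := by
    have e : v h - u k = (z - (u k - 1)) + s := by
      rw [← sub_sub_sub_cancel_right (v h) (u k) 1, ← hzs]; abel
    rw [e]
    exact add_mem (mul_le_mul' hDI hDI hkz) hs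
  obtain ⟨j, hj, hjc⟩ := hcen _ hw fun g => by
    obtain ⟨h', hg⟩ := hv.exists_sub_mem _ (hu.sub_one_mem g)
    rw [sub_sub_sub_cancel_right] at hg
    -- `u k` is central and `I * I` is commutative, so replacing `g` by the congruent `h'` turns
    -- this into a ring commutator of elements of `H`. It lies in `mixTwo I J`, hence comes from a
    -- group commutator in the third layer.
    have e1 : (v h - u k) * u g - u g * (v h - u k)
        = (v h - 1) * (v h' - 1) - (v h' - 1) * (v h - 1) := by
      have h1 := (hT.commute_of_mem_sq hw hg).eq
      have h2 := (hkc (v h')).eq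
      rw [← sub_eq_zero] at h1 h2 ⊢
      have e : (v h - u k) * u g - u g * (v h - u k)
          - ((v h - 1) * (v h' - 1) - (v h' - 1) * (v h - 1))
          = ((v h - u k) * (u g - v h') - (u g - v h') * (v h - u k))
            - (u k * v h' - v h' * u k) := by noncomm_ring
      rw [e, h1, h2, sub_zero]
    have e2 : (v h - u k) * u g - u g * (v h - u k) ∈ mixTwo I J := by
      have e : (v h - u k) * u g - u g * (v h - u k)
          = (v h - u k) * (u g - 1) - (u g - 1) * (v h - u k) := by noncomm_ring
      rw [e]
      exact hT.sq_comm_mem hw (hu.sub_one_mem g)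
    rw [e1] at e2
    have e3 := hv.commutator_sub_one_eq hT e2
    rw [← e3, hv.mem_three] at e2
    obtain ⟨y, hy⟩ := exists_matchThree hT hu hv e2
    refine ⟨y, gammaTwoPowMul_three_le G p hy.1.2, ?_⟩
    rw [e1, ← e3, show v ⁅h, h'⁆ = u y from hy.2]
  -- Multiplying by `m` subtracts `j` up to `mixTwo I J`, which is central.
  obtain ⟨m, hm, hmj⟩ := hv.exists_two_sub_mem _ (neg_mem hj)
  refine ⟨m, hm, fun y => ?_⟩
  have e : v (m * h) = u k + (v h - u k - j) - (-j - (v m - 1)) + (v m - 1) * (v h - 1) := by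
    rw [map_mul]; noncomm_ring
  rw [e]
  refine Commute.add_left (Commute.sub_left ((hkc y).add_left (hu.commute_all hjc y))
    (hv.commute_of_mem_mixTwo hT hmj y)) (hv.commute_of_mem_mixTwo hT ?_ y)
  exact Submodule.mem_sup_right (Submodule.mul_mem_mul (hv.two_mem m hm) (hv.sub_one_mem h))

end Match

theorem Subgroup.inf_le_of_relIndex_le {K : Type*} [Group K] [Finite K] {A B D : Subgroup K}
    (hBA : B ≤ A) (h : B.relIndex D ≤ A.relIndex D) : A ⊓ D ≤ B := by
  have h1 := Subgroup.relIndex_mul_relIndex (H := B ⊓ D) (K := A ⊓ D) (L := D)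
    (inf_le_inf_right _ hBA) inf_le_right
  rw [Subgroup.inf_relIndex_right, Subgroup.inf_relIndex_right] at h1
  have h2 : 0 < A.relIndex D := Nat.pos_of_ne_zero Subgroup.index_ne_zero_of_finite
  have h3 : 0 < (B ⊓ D).relIndex (A ⊓ D) := Nat.pos_of_ne_zero Subgroup.index_ne_zero_of_finite
  have h4 : (B ⊓ D).relIndex (A ⊓ D) = 1 := by
    refine le_antisymm ?_ h3
    by_contra h5
    rw [← h1] at h
    nlinarith
  exact (Subgroup.relIndex_eq_one.1 h4).trans inf_le_left

/-- Goursat's argument: both quotients are quotients of `D` by the same kernel. -/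
theorem Subgroup.nonempty_quotient_mulEquiv {H G : Type*} [Group H] [Group G]
    (D : Subgroup (H × G)) (N : Subgroup H) (M : Subgroup G) [N.Normal] [M.Normal]
    (hH : ∀ h, ∃ z ∈ D, z.1 = h) (hG : ∀ g, ∃ z ∈ D, z.2 = g)
    (h : ∀ z ∈ D, z.1 ∈ N ↔ z.2 ∈ M) : Nonempty (G ⧸ M ≃* H ⧸ N) := by
  let f : D →* H ⧸ N := (QuotientGroup.mk' N).comp ((MonoidHom.fst H G).comp D.subtype)
  let f' : D →* G ⧸ M := (QuotientGroup.mk' M).comp ((MonoidHom.snd H G).comp D.subtype)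
  have hf : Function.Surjective f := fun y => by
    obtain ⟨x, rfl⟩ := QuotientGroup.mk'_surjective N y
    obtain ⟨z, hz, rfl⟩ := hH x
    exact ⟨⟨z, hz⟩, rfl⟩
  have hf' : Function.Surjective f' := fun y => by
    obtain ⟨x, rfl⟩ := QuotientGroup.mk'_surjective M y
    obtain ⟨z, hz, rfl⟩ := hG x
    exact ⟨⟨z, hz⟩, rfl⟩
  have hker : f'.ker = f.ker := by
    ext z
    change (QuotientGroup.mk' M) z.1.2 = 1 ↔ (QuotientGroup.mk' N) z.1.1 = 1
    rw [← MonoidHom.mem_ker, ← MonoidHom.mem_ker, QuotientGroup.ker_mk', QuotientGroup.ker_mk']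
    exact (h z z.2).symm
  exact ⟨(QuotientGroup.quotientKerEquivOfSurjective f' hf').symm.trans
    ((QuotientGroup.quotientMulEquivOfEq hker).trans
      (QuotientGroup.quotientKerEquivOfSurjective f hf))⟩

/-! ### Choice of matching generators -/

section Match

variable {p : ℕ} [Fact p.Prime] {S : Type*} [Ring S] [Algebra (ZMod p) S]
  {I J : Submodule (ZMod p) S} {G H : Type*} [Group G] [Group H] {u : G →* S} {v : H →* S}
  (hT : IsTruncated I J) (hu : IsGroupBasis p I J u) (hv : IsGroupBasis p I J v)

include hT hu hv

theorem pow_mem_matchThree (hodd : p ≠ 2)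
    (ha : powerSubgroup p (⊤ : Subgroup G) ⊓ lcsTerm G 2 ≤ gammaTwoPowMul G p 3)
    {e : ℕ} (he : e ≠ 0) {z : H × G} (hz : z.2 ^ p ^ e ∈ lcsTerm G 2)
    (hs : v z.1 - u z.2 ∈ deltaSpan p u {b : G | b ^ p ^ e ∈ lcsTerm G 2} * I ⊔ J) :
    z ^ p ^ e ∈ matchThree p v u := by
  have hB : ∀ b ∈ {b : G | b ^ p ^ e ∈ lcsTerm G 2}, b ^ p ^ e ∈ gammaTwoPowMul G p 3 := by
    intro b hb
    -- As `e ≠ 0`, `b ^ p ^ e` is a `p`-th power in `γ_2(G)`, so hypothesis (a) puts it into the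
    -- third layer.
    refine ha ⟨?_, hb⟩
    obtain ⟨k, rfl⟩ := Nat.exists_eq_succ_of_ne_zero he
    rw [pow_succ, pow_mul]
    exact Subgroup.subset_closure ⟨_, trivial, rfl⟩
  have h := pow_eq_of_sub_mem hT hu hodd hB he hs
  rw [← map_pow] at h
  refine ⟨⟨(hv.mem_three _).1 ?_, hB _ hz⟩, h⟩
  change v (z.1 ^ p ^ e) - 1 ∈ mixTwo I J
  rw [h, hu.mem_three]
  exact hB _ hz

theorem exists_matching_generators [Finite H] (hodd : p ≠ 2) (hH : IsPGroup p H) {d : ℕ}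
    (ha : powerSubgroup p (⊤ : Subgroup G) ⊓ lcsTerm G 2 ≤ gammaTwoPowMul G p 3)
    (hcen : ∀ w ∈ I * I, (∀ g, ∃ z ∈ lcsTerm G 2, w * u g - u g * w = u z - 1) →
      ∃ j ∈ J, ∀ g, Commute (w - j) (u g))
    (hpow : ∀ (e : ℕ) (x : S), x ^ p ^ e ∈ J → ∃ b ∈ {b : G | b ^ p ^ e ∈ lcsTerm G 2},
      x - (u b - 1) ∈ deltaSpan p u {b : G | b ^ p ^ e ∈ lcsTerm G 2} * I)
    (hS : Module.Finite (ZMod p) S)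
    (hrank : Module.finrank (ZMod p)
      (I.map (deltaSpan p u (Subgroup.center G : Set G) ⊔ I * I).mkQ) ≤ d) :
    ∃ (ι : Type) (_ : Fintype ι) (q : ι → ℕ) (c : ι → H × G) (T : Finset ι),
      (∀ i, 0 < q i) ∧ (∀ i, c i ^ q i ∈ matchThree p v u) ∧
      (∀ i, v (c i).1 - u (c i).2 ∈ I * I) ∧
      (Subgroup.closure (Set.range fun i => (c i).1) ⊔ lcsTerm H 2 = ⊤) ∧
      ∏ i, q i = (lcsTerm H 2).index ∧ T.card ≤ d ∧
      ∀ j ∉ T, ∃ k ∈ Subgroup.closure (c '' T), ∀ y,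
        Commute (v (c j * k⁻¹).1) y ∧ Commute (u (c j * k⁻¹).2) y := by
  classical
  have hp : p.Prime := Fact.out
  obtain ⟨ι, _, e, h, he, hh, hgen, hprod⟩ := hH.exists_generators_mod_commutator
  have hg : ∀ i, ∃ b ∈ {b : G | b ^ p ^ e i ∈ lcsTerm G 2},
      v (h i) - 1 - (u b - 1) ∈ deltaSpan p u {b : G | b ^ p ^ e i ∈ lcsTerm G 2} * I := by
    intro i
    refine hpow (e i) _ ?_
    rcases subsingleton_or_nontrivial S with hS | hS
    · rw [Subsingleton.elim ((v (h i) - 1) ^ p ^ e i) 0]; exact zero_mem _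
    have : CharP S p := charP_of_injective_algebraMap' (ZMod p) p
    rw [sub_pow_char_pow_of_commute p (e i) (Commute.one_right _), one_pow, ← map_pow]
    exact hv.two_mem _ (hh i)
  choose g hgq hg using hg
  set Z := deltaSpan p u (Subgroup.center G : Set G) ⊔ I * I with hZ
  -- Generators whose classes form a basis of the span modulo `Z` make up `T`; the remaining ones
  -- are products of these modulo `Z`.
  obtain ⟨κ, a, hainj, hspan, hli⟩ :=
    exists_linearIndependent' (ZMod p) (fun i => Z.mkQ (v (h i) - 1))
  have : Fintype κ := Fintype.ofInjective a hainj
  let T := Finset.univ.image a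
  have hTcard : T.card ≤ d := by
    rw [Finset.card_image_of_injective _ hainj, Finset.card_univ]
    refine le_trans ?_ hrank
    rw [← finrank_span_eq_card hli]
    refine Submodule.finrank_mono ?_
    rw [Submodule.span_le]
    rintro _ ⟨k, rfl⟩
    exact ⟨_, hv.sub_one_mem _, rfl⟩
  have hWI : ∀ i, deltaSpan p u {b : G | b ^ p ^ e i ∈ lcsTerm G 2} * I ≤ I * I := fun i =>
    mul_le_mul_left (deltaSpan_le.2 fun g _ => hu.sub_one_mem g) _
  let P := congrPairs v u hv.sub_one_mem hu.sub_one_mem hT.mul_le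
  have hP : ∀ i, (h i, g i) ∈ P := fun i => by
    have h1 := hWI i (hg i)
    rwa [sub_sub_sub_cancel_right] at h1
  have hsplit : ∀ j, ∃ k ∈ Subgroup.closure ((fun i => (h i, g i)) '' T),
      v (h j * k.1⁻¹) - 1 ∈ Z ∧ u (g j * k.2⁻¹) - 1 ∈ Z := by
    intro j
    have h1 : Z.mkQ (v (h j) - 1) ∈ (deltaSpan p v (h '' T)).map Z.mkQ := by
      have h2 : Z.mkQ (v (h j) - 1) ∈ Submodule.span (ZMod p)
          (Set.range fun i => Z.mkQ (v (h i) - 1)) := Submodule.subset_span ⟨j, rfl⟩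
      rw [← hspan] at h2
      refine (Submodule.span_le.2 ?_) h2
      rintro _ ⟨k, rfl⟩
      exact ⟨_, sub_one_mem_deltaSpan v ⟨a k, by simp [T], rfl⟩, rfl⟩
    obtain ⟨x, hx, hxj⟩ := h1
    obtain ⟨k, hk, hxk⟩ := exists_mem_closure_sub_mem v hx
    have hk' : k ∈ (Subgroup.closure ((fun i => (h i, g i)) '' T)).map (MonoidHom.fst H G) := by
      rw [MonoidHom.map_closure, ← Set.image_comp]; exact hk
    obtain ⟨z, hz, rfl⟩ := hk'
    have hzP : z ∈ P := by
      refine (Subgroup.closure_le P).2 ?_ hz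
      rintro _ ⟨i, _, rfl⟩
      exact hP i
    have hDI : deltaSpan p v (Subgroup.closure (h '' T) : Set H) ≤ I :=
      deltaSpan_le.2 fun g _ => hv.sub_one_mem g
    have hIZ : I * I ≤ Z := le_sup_right
    have hZI : Z ≤ I := sup_le (deltaSpan_le.2 fun g _ => hu.sub_one_mem g) hT.mul_le
    have h3 : v (h j) - v z.1 ∈ Z := by
      have h4 : x - (v (h j) - 1) ∈ Z := (Submodule.Quotient.eq Z).1 hxj
      have e : v (h j) - v z.1 = (x - (v z.1 - 1)) - (x - (v (h j) - 1)) := by abel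
      rw [e]
      exact sub_mem (hIZ (mul_le_mul' hDI hDI hxk)) h4
    have h5 : v (h j * z.1⁻¹) - 1 ∈ Z := by
      have e : v (h j * z.1⁻¹) - 1 = (v (h j) - v z.1) * (v z.1⁻¹ - 1) + (v (h j) - v z.1) := by
        rw [mul_sub, mul_one, sub_add_cancel, sub_mul, ← map_mul, ← map_mul, mul_inv_cancel,
          map_one]
      rw [e]
      exact add_mem (hIZ (Submodule.mul_mem_mul (hZI h3) (hv.sub_one_mem _))) h3
    refine ⟨z, hz, h5, ?_⟩
    have h6 : v (h j * z.1⁻¹) - u (g j * z.2⁻¹) ∈ I * I := mul_mem (hP j) (inv_mem hzP)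
    have e : u (g j * z.2⁻¹) - 1
        = (v (h j * z.1⁻¹) - 1) - (v (h j * z.1⁻¹) - u (g j * z.2⁻¹)) := by abel
    rw [e]
    exact sub_mem h5 (hIZ h6)
  choose k hk hkv hku using hsplit
  choose m hm hmc using fun j => exists_mul_central hT hu hv hcen (hkv j)
  choose n hn hnc using fun j => exists_mul_central hT hu hu hcen (hku j)
  -- Only generators outside `T` are corrected. The factors lie in `γ_2` and change the difference
  -- in `S` by an element of `J`, which the comparison of powers tolerates.
  let c : ι → H × G := fun i => if i ∈ T then (h i, g i) else (m i * h i, n i * g i)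
  have hc : ∀ i, ∃ m ∈ lcsTerm H 2, ∃ n ∈ lcsTerm G 2, c i = (m * h i, n * g i) := by
    intro i
    by_cases hi : i ∈ T
    · exact ⟨1, one_mem _, 1, one_mem _, by simp [c, hi]⟩
    · exact ⟨m i, hm i, n i, hn i, by simp [c, hi]⟩
  have hsub : ∀ i, v (c i).1 - u (c i).2 ∈
      deltaSpan p u {b : G | b ^ p ^ e i ∈ lcsTerm G 2} * I ⊔ J := by
    intro i
    obtain ⟨m, hm, n, hn, hmn⟩ := hc i
    have e : v (c i).1 - u (c i).2 = (v (h i) - 1 - (u (g i) - 1))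
        + (((v m - 1) * (v (h i) - 1) + (v m - 1)) - ((u n - 1) * (u (g i) - 1) + (u n - 1))) := by
      rw [hmn, map_mul, map_mul]; noncomm_ring
    have hJI : J * I ≤ J := le_sup_right.trans hT.mixTwo_le
    rw [e]
    refine add_mem (Submodule.mem_sup_left (hg i)) (Submodule.mem_sup_right (sub_mem
      (add_mem (hJI (Submodule.mul_mem_mul (hv.two_mem m hm) (hv.sub_one_mem _)))
        (hv.two_mem m hm))
      (add_mem (hJI (Submodule.mul_mem_mul (hu.two_mem n hn) (hu.sub_one_mem _)))
        (hu.two_mem n hn))))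
  have hcpow : ∀ i, (c i).2 ^ p ^ e i ∈ lcsTerm G 2 := by
    intro i
    obtain ⟨m, hm, n, hn, hmn⟩ := hc i
    have h1 : ((n * g i : G) : G ⧸ lcsTerm G 2) = (g i : G ⧸ lcsTerm G 2) := by
      rw [QuotientGroup.mk_mul, (QuotientGroup.eq_one_iff n).2 hn, one_mul]
    rw [hmn, ← QuotientGroup.eq_one_iff, QuotientGroup.mk_pow, h1, ← QuotientGroup.mk_pow,
      QuotientGroup.eq_one_iff]
    exact hgq i
  refine ⟨ι, inferInstance, fun i => p ^ e i, c, T, fun i => pow_pos hp.pos _,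
    fun i => pow_mem_matchThree hT hu hv hodd ha (he i) (hcpow i) (hsub i),
    fun i => sup_le (hWI i) hT.le_sq (hsub i), ?_, hprod, hTcard, fun j hj => ?_⟩
  · rw [← top_le_iff, ← hgen]
    refine sup_le ?_ le_sup_right
    rw [Subgroup.closure_le]
    rintro _ ⟨i, rfl⟩
    obtain ⟨m, hm, n, hn, hmn⟩ := hc i
    have h1 : h i = m⁻¹ * (c i).1 := by rw [hmn, inv_mul_cancel_left]
    rw [h1]
    exact mul_mem (Subgroup.mem_sup_right (inv_mem hm))
      (Subgroup.mem_sup_left (Subgroup.subset_closure ⟨i, rfl⟩))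
  · have himg : c '' T = (fun i => (h i, g i)) '' T :=
      Set.image_congr fun i hi => by
        have hi' : i ∈ T := hi
        simp [c, hi']
    refine ⟨k j, himg ▸ hk j, fun y => ?_⟩
    have hcj : c j = (m j * h j, n j * g j) := by simp [c, hj]
    rw [hcj, Prod.fst_mul, Prod.snd_mul, Prod.fst_inv, Prod.snd_inv, mul_assoc, mul_assoc]
    exact ⟨hmc j y, hnc j y⟩

end Match

/-! ### Counting and conclusion -/

section Match

variable {p : ℕ} [Fact p.Prime] {S : Type*} [Ring S] [Algebra (ZMod p) S]
  {I J : Submodule (ZMod p) S} {G H : Type*} [Group G] [Group H] {u : G →* S} {v : H →* S}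
  (hT : IsTruncated I J) (hu : IsGroupBasis p I J u) (hv : IsGroupBasis p I J v)

theorem commutator_mem_lcsTerm_two {G : Type*} [Group G] (a b : G) : ⁅a, b⁆ ∈ lcsTerm G 2 := by
  rw [lcsTerm_two_eq]; exact Subgroup.commutator_mem_commutator trivial trivial

include hu hv

theorem commutator_pow_mem_matchThree (z z' : H × G) : ⁅z, z'⁆ ^ p ∈ matchThree p v u := by
  have h1 : ∀ i, ⁅z.1, z'.1⁆ ^ p ∈ gammaTwoPowMul H p i := fun i =>
    pow_mem_gammaTwoPowMul (commutator_mem_lcsTerm_two _ _)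
  have h2 : ∀ i, ⁅z.2, z'.2⁆ ^ p ∈ gammaTwoPowMul G p i := fun i =>
    pow_mem_gammaTwoPowMul (commutator_mem_lcsTerm_two _ _)
  exact ⟨⟨h1 3, h2 3⟩, ((hv.mem_four _).2 (h1 4)).trans ((hu.mem_four _).2 (h2 4)).symm⟩

include hT in
theorem commutator_commutator_mem_matchThree {a b c : H × G} (ha : v a.1 - u a.2 ∈ I * I)
    (hb : v b.1 - u b.2 ∈ I * I) (hc : v c.1 - u c.2 ∈ I * I) :
    ⁅⁅a, b⁆, c⁆ ∈ matchThree p v u := by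
  have h1 := commutator_mem_lcsTerm_two a.1 b.1
  have h2 := commutator_mem_lcsTerm_two a.2 b.2
  refine ⟨⟨Subgroup.mem_sup_right ?_, Subgroup.mem_sup_right ?_⟩,
    hu.commutator_eq_of_two hT hv h1 h2 (hu.commutator_sub_mem hT hv ha hb) hc⟩
  · rw [lcsTerm_succ H 2 (by norm_num)]
    exact Subgroup.commutator_mem_commutator h1 trivial
  · rw [lcsTerm_succ G 2 (by norm_num)]
    exact Subgroup.commutator_mem_commutator h2 trivial

theorem commutator_mem_matchThree_of_commute {a b : H × G}
    (hv' : Commute (v a.1) (v b.1)) (hu' : Commute (u a.2) (u b.2)) :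
    ⁅a, b⁆ ∈ matchThree p v u := by
  have h1 : v ⁅a.1, b.1⁆ = 1 := by
    rw [← sub_eq_zero, map_commutator_sub_one, sub_mul, mul_sub, mul_sub, sub_mul, sub_mul, hv'.eq]
    noncomm_ring
  have h2 : u ⁅a.2, b.2⁆ = 1 := by
    rw [← sub_eq_zero, map_commutator_sub_one, sub_mul, mul_sub, mul_sub, sub_mul, sub_mul, hu'.eq]
    noncomm_ring
  exact ⟨⟨gammaTwoPowMul_four_le H p ((hv.mem_four _).1 h1),
    gammaTwoPowMul_four_le G p ((hu.mem_four _).1 h2)⟩, h1.trans h2.symm⟩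

include hT

/-- The general order bound, applied to pairs congruent modulo `I * I`. Restricting to such pairs is
what makes the commutators of generators central modulo `matchThree`. -/
theorem relIndex_matchThree_closure_le [Finite G] [Finite H] {ι : Type} [Fintype ι] (q : ι → ℕ)
    (c : ι → H × G) (T : Finset ι) (hq : ∀ i, 0 < q i)
    (hcq : ∀ i, c i ^ q i ∈ matchThree p v u)
    (hc : ∀ i, v (c i).1 - u (c i).2 ∈ I * I)
    (hcT : ∀ j ∉ T, ∃ k ∈ Subgroup.closure (c '' T), ∀ y,
      Commute (v (c j * k⁻¹).1) y ∧ Commute (u (c j * k⁻¹).2) y) :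
    (matchThree p v u).relIndex (Subgroup.closure (Set.range c))
      ≤ (∏ i, q i) * p ^ T.card.choose 2 := by
  have hp : p.Prime := Fact.out
  let P := congrPairs v u hv.sub_one_mem hu.sub_one_mem hT.mul_le
  have hN : (matchThree p v u).Normal := matchThree_normal hT hu hv
  let N := (matchThree p v u).subgroupOf P
  let c' : ι → P := fun i => ⟨c i, hc i⟩
  let π := QuotientGroup.mk' N
  have hone : ∀ x : P, π x = 1 ↔ (x : H × G) ∈ matchThree p v u := fun x =>
    QuotientGroup.eq_one_iff x
  have hcenter : ∀ x : P, (∀ y : P, ⁅(x : H × G), (y : H × G)⁆ ∈ matchThree p v u) →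
      π x ∈ Subgroup.center (P ⧸ N) := by
    intro x hx
    rw [Subgroup.mem_center_iff]
    intro y
    obtain ⟨y, rfl⟩ := QuotientGroup.mk'_surjective N y
    have h := (hone ⁅x, y⁆).2 (hx y)
    rw [map_commutatorElement, commutatorElement_eq_one_iff_mul_comm] at h
    exact h.symm
  have key := Subgroup.card_closure_range_le_of_central_commutators (fun i => π (c' i)) q hq
    (fun i => by rw [← map_pow, hone]; exact hcq i) p hp.pos T
    (fun i _ j _ => by
      rw [← map_commutatorElement]
      exact hcenter _ fun y => commutator_commutator_mem_matchThree hT hu hv (hc i) (hc j) y.2)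
    (fun i _ j _ => by
      rw [← map_commutatorElement, ← map_pow, hone]
      exact commutator_pow_mem_matchThree hu hv _ _)
    (fun j hj => by
      obtain ⟨k, hk, hcom⟩ := hcT j hj
      have hk' : k ∈ (Subgroup.closure (c' '' T)).map P.subtype := by
        rw [MonoidHom.map_closure, ← Set.image_comp]; exact hk
      obtain ⟨k, hkT, rfl⟩ := hk'
      refine ⟨π k, ?_, ?_⟩
      · have h1 := Subgroup.mem_map_of_mem π hkT
        rwa [MonoidHom.map_closure, ← Set.image_comp] at h1
      · rw [← map_inv, ← map_mul]
        exact hcenter _ fun y => commutator_mem_matchThree_of_commute hu hv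
          (hcom _).1 (hcom _).2)
  have h1 : Subgroup.closure (Set.range fun i => π (c' i))
      = (Subgroup.closure (Set.range c')).map π := by
    rw [MonoidHom.map_closure, ← Set.range_comp]; rfl
  have h2 : Subgroup.closure (Set.range c) = (Subgroup.closure (Set.range c')).map P.subtype := by
    rw [MonoidHom.map_closure, ← Set.range_comp]; rfl
  rw [h1, ← Subgroup.relIndex_ker, QuotientGroup.ker_mk'] at key
  rw [h2, ← Subgroup.relIndex_comap]
  exact key

theorem nonempty_quotient_mulEquiv [Finite G] [Finite H] (hodd : p ≠ 2) (hH : IsPGroup p H) {d : ℕ}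
    (ha : powerSubgroup p (⊤ : Subgroup G) ⊓ lcsTerm G 2 ≤ gammaTwoPowMul G p 3)
    (hcen : ∀ w ∈ I * I, (∀ g, ∃ z ∈ lcsTerm G 2, w * u g - u g * w = u z - 1) →
      ∃ j ∈ J, ∀ g, Commute (w - j) (u g))
    (hpow : ∀ (e : ℕ) (x : S), x ^ p ^ e ∈ J → ∃ b ∈ {b : G | b ^ p ^ e ∈ lcsTerm G 2},
      x - (u b - 1) ∈ deltaSpan p u {b : G | b ^ p ^ e ∈ lcsTerm G 2} * I)
    (hfrat : ∀ g, u g - 1 ∈ I * I → g ∈ frattini G)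
    (hS : Module.Finite (ZMod p) S)
    (hrank : Module.finrank (ZMod p)
      (I.map (deltaSpan p u (Subgroup.center G : Set G) ⊔ I * I).mkQ) ≤ d)
    (hb : (gammaTwoPowMul G p 3).relIndex (lcsTerm G 2) = p ^ d.choose 2)
    (hindex : (lcsTerm H 2).index = (lcsTerm G 2).index) :
    Nonempty (G ⧸ gammaTwoPowMul G p 4 ≃* H ⧸ gammaTwoPowMul H p 4) := by
  have hp : p.Prime := Fact.out
  obtain ⟨ι, _, q, c, T, hq, hcq, hc, hgen, hprod, hTd, hcT⟩ :=
    exists_matching_generators hT hu hv hodd hH ha hcen hpow hS hrank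
  set D := Subgroup.closure (Set.range c)
  have hJJ : J * J ≤ mixTwo I J := (mul_le_mul_left (hT.le_sq.trans hT.mul_le) _).trans le_sup_left
  -- Both indices count `J` modulo `mixTwo I J`, so hypothesis (b) passes to `H`.
  have hbH : (gammaTwoPowMul H p 3).relIndex (lcsTerm H 2) = p ^ d.choose 2 := by
    rw [← hb, ← card_map_mkQ_eq_relIndex v hv.two_mem hv.exists_two_sub_mem
      (fun n _ => hv.mem_three n) hJJ, card_map_mkQ_eq_relIndex u hu.two_mem hu.exists_two_sub_mem
      (fun n _ => hu.mem_three n) hJJ]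
  have hcount : (matchThree p v u).relIndex D ≤ (lcsTerm H 2).index * p ^ d.choose 2 := by
    refine (relIndex_matchThree_closure_le hT hu hv q c T hq hcq hc hcT).trans ?_
    rw [hprod]
    exact Nat.mul_le_mul_left _ (Nat.pow_le_pow_right hp.pos (Nat.choose_le_choose 2 hTd))
  have hiH : (gammaTwoPowMul H p 3).index = (lcsTerm H 2).index * p ^ d.choose 2 := by
    rw [← Subgroup.relIndex_mul_index (gammaTwoPowMul_three_le H p), hbH, mul_comm]
  have hiG : (gammaTwoPowMul G p 3).index = (lcsTerm H 2).index * p ^ d.choose 2 := by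
    rw [← Subgroup.relIndex_mul_index (gammaTwoPowMul_three_le G p), hb, mul_comm, hindex]
  have hDP : ∀ z ∈ D, v z.1 - u z.2 ∈ I * I := by
    have hle : D ≤ congrPairs v u hv.sub_one_mem hu.sub_one_mem hT.mul_le := by
      rw [Subgroup.closure_le]; rintro _ ⟨i, rfl⟩; exact hc i
    exact fun z hz => hle hz
  have hfst : D.map (MonoidHom.fst H G) = ⊤ := by
    refine frattini_nongenerating (top_le_iff.1 ?_)
    rw [← hgen, MonoidHom.map_closure, ← Set.range_comp]
    exact sup_le_sup_left hH.lcsTerm_two_le_frattini _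
  -- Every `g` is congruent modulo `I * I` to some `h`, hence to the second coordinate of a pair in
  -- `D` over `h`; the quotient of the two lies in the Frattini subgroup.
  have hsnd : D.map (MonoidHom.snd H G) = ⊤ := by
    refine frattini_nongenerating (top_le_iff.1 fun g _ => ?_)
    obtain ⟨h, hh⟩ := hv.exists_sub_mem _ (hu.sub_one_mem g)
    obtain ⟨z, hz, rfl⟩ : h ∈ D.map (MonoidHom.fst H G) := by rw [hfst]; trivial
    have h1 : u g - u z.2 ∈ I * I := by
      have h2 := add_mem hh (hDP z hz)
      rwa [sub_sub_sub_cancel_right, MonoidHom.coe_fst, sub_add_sub_cancel] at h2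
    have h3 : u (z.2⁻¹ * g) - 1 ∈ I * I := by
      have e : u (z.2⁻¹ * g) - 1 = (u z.2⁻¹ - 1) * (u g - u z.2) + (u g - u z.2) := by
        rw [sub_mul, one_mul, sub_add_cancel, mul_sub, ← map_mul, ← map_mul, inv_mul_cancel,
          map_one]
      rw [e]
      exact add_mem (Submodule.mul_mem_mul (hu.sub_one_mem _) (hT.mul_le h1)) h1
    have e : g = z.2 * (z.2⁻¹ * g) := by rw [mul_inv_cancel_left]
    rw [e]
    exact Subgroup.mul_mem_sup ⟨z, hz, rfl⟩ (hfrat _ h3)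
  -- `D` maps onto `H`, so the preimage of the third layer already has the index that bounds that of
  -- the smaller `matchThree`; the two agree inside `D`.
  have hH' : ∀ z ∈ D, z.1 ∈ gammaTwoPowMul H p 3 → z ∈ matchThree p v u := by
    have h1 := Subgroup.inf_le_of_relIndex_le (D := D)
      (A := (gammaTwoPowMul H p 3).comap (MonoidHom.fst H G)) (B := matchThree p v u)
      (fun z hz => hz.1.1)
      (by rw [Subgroup.relIndex_comap, hfst, Subgroup.relIndex_top_right, hiH]; exact hcount)
    exact fun z hz h => h1 ⟨h, hz⟩
  have hG' : ∀ z ∈ D, z.2 ∈ gammaTwoPowMul G p 3 → z ∈ matchThree p v u := by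
    have h1 := Subgroup.inf_le_of_relIndex_le (D := D)
      (A := (gammaTwoPowMul G p 3).comap (MonoidHom.snd H G)) (B := matchThree p v u)
      (fun z hz => hz.1.2)
      (by rw [Subgroup.relIndex_comap, hsnd, Subgroup.relIndex_top_right, hiG]; exact hcount)
    exact fun z hz h => h1 ⟨h, hz⟩
  refine Subgroup.nonempty_quotient_mulEquiv D _ _ (fun h => ?_) (fun g => ?_) fun z hz => ?_
  · exact (hfst ▸ Subgroup.mem_top h : h ∈ D.map (MonoidHom.fst H G))
  · exact (hsnd ▸ Subgroup.mem_top g : g ∈ D.map (MonoidHom.snd H G))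
  · constructor
    · intro h
      rw [← hu.mem_four]
      exact (hH' z hz (gammaTwoPowMul_four_le H p h)).2.symm.trans ((hv.mem_four _).2 h)
    · intro h
      rw [← hv.mem_four]
      exact (hG' z hz (gammaTwoPowMul_four_le G p h)).2.trans ((hu.mem_four _).2 h)

end Match

theorem theoremB {G H : Type*} [Group G] [Group H] [Finite G] [Finite H]
    (p d : ℕ) (hp : p.Prime) (hodd : p ≠ 2)
    (hG : IsPGroup p G) (hH : IsPGroup p H)
    (hFGH : Nonempty (MonoidAlgebra (ZMod p) G ≃ₐ[ZMod p] MonoidAlgebra (ZMod p) H))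
    (hd : Nat.card (G ⧸ (frattini G ⊔ Subgroup.center G)) = p ^ d)
    (ha : powerSubgroup p (⊤ : Subgroup G) ⊓ lcsTerm G 2 ≤ gammaTwoPowMul G p 3)
    (hb : Nat.card (lcsTerm G 2 ⧸ (gammaTwoPowMul G p 3).subgroupOf (lcsTerm G 2)) =
      p ^ (d.choose 2)) :
    Nonempty (G ⧸ gammaTwoPowMul G p 4 ≃* H ⧸ gammaTwoPowMul H p 4) := by
  have : Fact p.Prime := ⟨hp⟩
  obtain ⟨φ⟩ := hFGH
  obtain ⟨S, _, _, π, hπ, hker⟩ := exists_quotient_algHom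
    (mixThree (augKer (augmentation p G)) (commSpan (ZMod p) (MonoidAlgebra (ZMod p) G)))
    (top_mul_mixThree _) (mixThree_mul_top _)
  -- `H` is mapped into the quotient built from `G`, so that both groups become bases for the same
  -- pair of ideals.
  let π' : MonoidAlgebra (ZMod p) H →ₐ[ZMod p] S := π.comp φ.symm.toAlgHom
  have hI := hH.map_augKer φ.symm
  have hJ : (commSpan (ZMod p) (MonoidAlgebra (ZMod p) H)).map φ.symm.toAlgHom.toLinearMap
      = commSpan (ZMod p) (MonoidAlgebra (ZMod p) G) := map_commSpan _ φ.symm.surjective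
  have hπ' : Function.Surjective π' := hπ.comp φ.symm.surjective
  have hker' : LinearMap.ker π'.toLinearMap = mixThree (augKer (augmentation p H))
      (commSpan (ZMod p) (MonoidAlgebra (ZMod p) H)) := by
    have h : LinearMap.ker π'.toLinearMap
        = (LinearMap.ker π.toLinearMap).comap φ.symm.toAlgHom.toLinearMap := rfl
    rw [h, hker, ← hI, ← hJ, ← map_mixThree]
    exact Submodule.comap_map_eq_of_injective φ.symm.injective _
  have hI' : (augKer (augmentation p H)).map π'.toLinearMap
      = (augKer (augmentation p G)).map π.toLinearMap := by
    rw [← hI, ← Submodule.map_comp]; rfl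
  have hJ' : (commSpan (ZMod p) (MonoidAlgebra (ZMod p) H)).map π'.toLinearMap
      = (commSpan (ZMod p) (MonoidAlgebra (ZMod p) G)).map π.toLinearMap := by
    rw [← hJ, ← Submodule.map_comp]; rfl
  have hv := isGroupBasis_of_surjective π' hπ' hker'
  rw [hI', hJ'] at hv
  have hfin : Module.Finite (ZMod p) (MonoidAlgebra (ZMod p) G) :=
    Module.Finite.of_basis (MonoidAlgebra.basis G (ZMod p))
  have hindex : (lcsTerm H 2).index = (lcsTerm G 2).index := by
    have h1 := card_abelianization_eq (p := p) (G := G)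
    have h2 := card_abelianization_eq (p := p) (G := H)
    have h3 := φ.toLinearEquiv.finrank_eq
    have h4 := φ.symm.toLinearEquiv.finrank_map_eq (commSpan (ZMod p) (MonoidAlgebra (ZMod p) H))
    change Module.finrank (ZMod p) ((commSpan (ZMod p) (MonoidAlgebra (ZMod p) H)).map
      φ.symm.toAlgHom.toLinearMap) = _ at h4
    rw [hJ] at h4
    change Nat.card (H ⧸ lcsTerm H 2) = Nat.card (G ⧸ lcsTerm G 2)
    omega
  exact nonempty_quotient_mulEquiv (isTruncated_of_surjective π hker)
    (isGroupBasis_of_surjective π hπ hker) hv hodd hH ha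
    (fun w hw h => map_exists_commSpan_sub_commute π hker hodd hd hb hw h)
    (map_exists_pow_mem_sub_mem π hker hπ)
    (fun g hg => IsPGroup.mem_frattini_of_map_sub_one_mem π hker hG hg)
    (Module.Finite.of_surjective π.toLinearMap hπ) (finrank_map_augKer_le π hd) hb hindex
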